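/- An overpartition of $n$ is a partition of $n$ in which the first occurrence of each part size may be overlined. Its rank is its largest part minus its number of parts (all parts being counted). Its (first residual) crank is the crank of the partition $\lambda$ formed by its non-overlined parts, where $\mathrm{crank}(\lambda)$ is the largest part of $\lambda$ ($0$ if $\lambda$ is empty) if $o(\lambda)=0$, and $\mu(\lambda)-o(\lambda)$ if $o(\lambda)>0$; here $o(\lambda)$ is the number of ones in $\lambda$ and $\mu(\lambda)$ is the number of parts larger than $o(\lambda)$. Let $\overline N(m,n)$ and $\overline M(m,n)$ be the number of overpartitions of $n$ with rank $m$ and with crank $m$, respectively; in $\overline M(m,n)$ the customary convention is used that an overpartition whose non-overlined parts form the partition $\lambda=(1)$ counts $1$ for each of $m=1$ and $m=-1$, and $-1$ for $m=0$. For an integer $r\ge 1$ put $$\overline\mu_r^+(n)=\sum_{m\ge 1}\binom{m+\lfloor\frac{r-1}{2}\rfloor}{r}\overline M(m,n),\qquad \overline\eta_r^+(n)=\sum_{m\ge 1}\binom{m+\lfloor\frac{r-1}{2}\rfloor}{r}\overline N(m,n).$$ Let $\eta(s)=(1-2^{1-s})\zeta(s)$, with $\zeta$ analytically continued and $\eta(1)=\log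 2$; let $\rho_r=0$ for odd $r$ and $\rho_r=\frac12$ for even $r$; and let $$\tilde c_r=\pi^{1-r}2^{r-\frac52}\,\eta(r),\qquad \tilde d_r=-\pi^{2-r}2^{r-\frac72}\left(\tfrac12\eta(r-2)+\rho_r\,\eta(r-1)\right),\qquad \tilde d_r'=-\pi^{2-r}2^{r-\frac72}\left(\eta(r-2)+\rho_r\,\eta(r-1)\right).$$ Let $I_\nu(x)=\sum_{k\ge0}\frac{(x/2)^{2k+\nu}}{k!\,\Gamma(k+\nu+1)}$ be the modified Bessel function of the first kind. **Theorem.** Let $r\ge1$ be an integer. As $N\to\infty$, $$\overline\mu_r^+(N)=\tilde c_r N^{\frac r2-\frac34}I_{r-\frac32}(\pi\sqrt N)+\tilde d_r N^{\frac r2-\frac54}I_{r-\frac52}(\pi\sqrt N)+O\left(N^{\frac r2-\frac74}e^{\pi\sqrt N}\right),$$ $$\overline\eta_r^+(N)=\tilde c_r N^{\frac r2-\frac34}I_{r-\frac32}(\pi\sqrt N)+\tilde d_r' N^{\frac r2-\frac54}I_{r-\frac52}(\pi\sqrt N)+O\left(N^{\frac r2-\frac74}e^{\pi\sqrt N}\right),$$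 where the implied constants may depend on $r$, and $\tilde d_r\ne\tilde d_r'$. The first expansion also holds, with the same constants, if $\overline M(m,n)$ is counted without the convention for $\lambda=(1)$, i.e. as the plain number of overpartitions of $n$ with crank $m$. -/

import Mathlib

open scoped Asymptotics

namespace Overpart

/-! ### Overpartitions, rank and crank -/

/-- An overpartition of `n`: a partition of `n` together with the set of those part sizes whose
first occurrence is overlined. -/
abbrev Overpartition (n : ℕ) : Type :=
  (p : n.Partition) × {S : Finset ℕ // S ∈ p.parts.toFinset.powerset}

/-- The largest element of a multiset of natural numbers (`0` for the empty multiset). -/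
def largestPart (s : Multiset ℕ) : ℕ := s.sup

/-- Dyson's rank: largest part minus number of parts. -/
def rank (s : Multiset ℕ) : ℤ := (largestPart s : ℤ) - (Multiset.card s : ℤ)

/-- The number of parts equal to one. -/
def numOnes (s : Multiset ℕ) : ℕ := s.count 1

/-- The number of parts larger than the number of ones. -/
def numLarge (s : Multiset ℕ) : ℕ := Multiset.card (s.filter (fun x => numOnes s < x))

/-- The Andrews–Garvan crank of a partition. -/
def crank (s : Multiset ℕ) : ℤ :=
  if numOnes s = 0 then (largestPart s : ℤ) else (numLarge s : ℤ) - (numOnes s : ℤ)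

namespace Overpartition

/-- All parts of an overpartition, overlined or not. -/
def parts {n : ℕ} (π : Overpartition n) : Multiset ℕ := π.1.parts

/-- The subpartition consisting of the non-overlined parts: one copy of every overlined size is
removed. -/
def nonOverlined {n : ℕ} (π : Overpartition n) : Multiset ℕ := π.1.parts - π.2.1.val

end Overpartition

/-- The number of overpartitions of `n` with rank `m`. -/
def rankCount (m : ℤ) (n : ℕ) : ℤ :=
  ((Finset.univ.filter (fun π : Overpartition n => rank π.parts = m)).card : ℤ)

/-- The number of overpartitions of `n` with first residual crank `m`, counted literally. -/
def crankCount (m : ℤ) (n : ℕ) : ℤ :=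
  ((Finset.univ.filter (fun π : Overpartition n => crank π.nonOverlined = m)).card : ℤ)

/-- The contribution of a partition to the crank value `m` with the customary convention for the
partition of one: it contributes `1` to each of the cranks `1` and `-1`, and `-1` to the crank `0`.
Every other partition contributes `1` to its own crank only. -/
def crankWeight (s : Multiset ℕ) (m : ℤ) : ℤ :=
  if s = {1} then (if m = 0 then -1 else if m = 1 ∨ m = -1 then 1 else 0)
  else if crank s = m then 1 else 0

/-- The number of overpartitions of `n` with first residual crank `m`, counted with the customary
convention for the partition of one. This is the coefficient of `z ^ m * q ^ n` in
`(-q)_∞ (q)_∞ / ((z q)_∞ (q / z)_∞)`, and it is symmetric in `m`. -/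
def crankCountConv (m : ℤ) (n : ℕ) : ℤ :=
  ∑ π : Overpartition n, crankWeight π.nonOverlined m

/-! ### Positive symmetrized moments -/

/-- The `r`-th positive symmetrized moment of a two-parameter family of counts (for `1 ≤ r`):
`∑_{m ≥ 1} binom (m + ⌊(r - 1) / 2⌋) r * a m n`. The sum stops at `m = n`, since the three counts
above vanish for `m > n`, as proved below. -/
noncomputable def posSymMoment (a : ℤ → ℕ → ℤ) (r n : ℕ) : ℝ :=
  ∑ m ∈ Finset.Icc 1 n, ((m + (r - 1) / 2).choose r : ℝ) * (a (m : ℤ) n : ℝ)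

/-- The positive symmetrized crank moment, with the customary convention for the partition of
one. -/
noncomputable def muPlus (r n : ℕ) : ℝ := posSymMoment crankCountConv r n

/-- The positive symmetrized crank moment, for the literal count. -/
noncomputable def muPlusLiteral (r n : ℕ) : ℝ := posSymMoment crankCount r n

/-- The positive symmetrized rank moment. -/
noncomputable def etaPlus (r n : ℕ) : ℝ := posSymMoment rankCount r n

/-! ### The counts vanish for `m > n` -/

theorem mem_le {n : ℕ} (π : Overpartition n) {x : ℕ} (hx : x ∈ π.parts) : x ≤ n :=
  (Multiset.le_sum_of_mem hx).trans_eq π.1.parts_sum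

theorem nonOverlined_le {n : ℕ} (π : Overpartition n) : π.nonOverlined ≤ π.parts :=
  Multiset.sub_le_self _ _

theorem largestPart_le {n : ℕ} (π : Overpartition n) {s : Multiset ℕ} (hs : s ≤ π.parts) :
    largestPart s ≤ n :=
  Multiset.sup_le.2 fun _ hx => mem_le π (Multiset.mem_of_le hs hx)

theorem card_le {n : ℕ} (π : Overpartition n) {s : Multiset ℕ} (hs : s ≤ π.parts) :
    Multiset.card s ≤ n := by
  refine (Multiset.card_le_card hs).trans ?_
  have h := Multiset.card_nsmul_le_sum (s := π.parts) (a := 1)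
    (fun x hx => π.1.parts_pos hx)
  have h2 : π.parts.sum = n := π.1.parts_sum
  simpa [h2] using h

theorem rank_le {n : ℕ} (π : Overpartition n) : rank π.parts ≤ n := by
  have := largestPart_le π le_rfl
  unfold rank
  omega

theorem crank_le {n : ℕ} (π : Overpartition n) : crank π.nonOverlined ≤ n := by
  have h1 := largestPart_le π (nonOverlined_le π)
  have h2 : numLarge π.nonOverlined ≤ n :=
    card_le π ((Multiset.filter_le _ _).trans (nonOverlined_le π))
  unfold crank
  split_ifs <;> omega

theorem rankCount_eq_zero {m : ℤ} {n : ℕ} (h : (n : ℤ) < m) : rankCount m n = 0 := by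
  unfold rankCount
  rw [Finset.filter_false_of_mem]
  · simp
  · intro π _ h2
    have := rank_le π
    omega

theorem crankCount_eq_zero {m : ℤ} {n : ℕ} (h : (n : ℤ) < m) : crankCount m n = 0 := by
  unfold crankCount
  rw [Finset.filter_false_of_mem]
  · simp
  · intro π _ h2
    have := crank_le π
    omega

theorem crankCountConv_eq_zero {m : ℤ} {n : ℕ} (h : (n : ℤ) < m) : crankCountConv m n = 0 := by
  unfold crankCountConv
  refine Finset.sum_eq_zero fun π _ => ?_
  have h1 := crank_le π
  have h2 := card_le π (nonOverlined_le π)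
  unfold crankWeight
  by_cases hs : π.nonOverlined = {1}
  · rw [hs] at h2
    simp only [Multiset.card_singleton] at h2
    rw [if_pos hs, if_neg (by omega), if_neg (by omega)]
  · rw [if_neg hs, if_neg (by omega)]

/-! ### Bessel functions and constants -/

/-- The modified Bessel function of the first kind of order `ν` at `x > 0`:
`I_ν(x) = ∑_{k ≥ 0} (x / 2) ^ (2 k + ν) / (k! Γ(k + ν + 1))`. For orders that are not negative
integers no pole of `Γ` is met. -/
noncomputable def besselI (ν x : ℝ) : ℝ :=
  ∑' k : ℕ, (x / 2) ^ (2 * (k : ℝ) + ν) / ((k.factorial : ℝ) * Real.Gamma ((k : ℝ) + ν + 1))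

/-- The value at the integer `s` of the entire function `(1 - 2 ^ (1 - s)) ζ(s)`, where `ζ` is the
analytically continued Riemann zeta function; at the removable singularity `s = 1` the value is
`log 2`. The values are real. -/
noncomputable def altZeta (s : ℤ) : ℝ :=
  if s = 1 then Real.log 2 else (1 - (2 : ℝ) ^ (1 - s)) * (riemannZeta (s : ℂ)).re

/-- `ρ = 0` for odd `r` and `ρ = 1 / 2` for even `r`. -/
noncomputable def rho (r : ℕ) : ℝ := if Odd r then 0 else 1 / 2

/-- The common leading constant. -/
noncomputable def cTilde (r : ℕ) : ℝ :=
  Real.pi ^ (1 - (r : ℝ)) * 2 ^ ((r : ℝ) - 5 / 2) * altZeta r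

/-- The second constant for the crank. -/
noncomputable def dTildeCrank (r : ℕ) : ℝ :=
  -(Real.pi ^ (2 - (r : ℝ)) * 2 ^ ((r : ℝ) - 7 / 2) *
    (altZeta ((r : ℤ) - 2) / 2 + rho r * altZeta ((r : ℤ) - 1)))

/-- The second constant for the rank. -/
noncomputable def dTildeRank (r : ℕ) : ℝ :=
  -(Real.pi ^ (2 - (r : ℝ)) * 2 ^ ((r : ℝ) - 7 / 2) *
    (altZeta ((r : ℤ) - 2) + rho r * altZeta ((r : ℤ) - 1)))

/-- The two-term main part with leading constant `c` and second constant `d`. -/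
noncomputable def mainPart (c d : ℝ) (r N : ℕ) : ℝ :=
  c * (N : ℝ) ^ ((r : ℝ) / 2 - 3 / 4) * besselI ((r : ℝ) - 3 / 2) (Real.pi * Real.sqrt N) +
  d * (N : ℝ) ^ ((r : ℝ) / 2 - 5 / 4) * besselI ((r : ℝ) - 5 / 2) (Real.pi * Real.sqrt N)

end Overpart

/-! Write P(q) for the generating function of overpartitions in |q| < 1. The generating function of
each moment is P(q) times an explicit alternating series. Both factors are expanded to second order
at q = exp(-t), t → 0, and the coefficients are extracted by the circle method with a single major
arc, the one at q = 1.

Algebra. Let R_m generate the overpartitions of rank at most m. Recurrences for overpartitions in an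
L × k box, symmetric in L and k, give P = 1 + q(R_1 + R_2) and R_m + R_{m+1} = 2P - q^{m+2}(R_{m+2}
+ R_{m+3}). For the crank, the overlined parts split off as a partition into distinct parts, and
Durfee rectangle sums give series C_m with C_m = P - q^{m+1}C_{m+1}, whose differences C_{m+1} - C_m
generate the counts of crank m + 1. Inside the disc these recursions unfold into alternating series
in q^n; the case m = 1 of the rank recursion is Gauss's identity P(q) Σ (-1)^n q^{n²} = 1, the sum
over all integers n. Summing over m against the binomial coefficients produces, with s = r - 1 -
⌊(r-1)/2⌋, the factor Σ_{n≥1} (-1)^{n+1} q^{n(n+1)/2 + sn}/(1-q^n)^r for the crank and Σ_{n≥1}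
(-1)^{n+1} 2q^{n(n+1) + sn}/((1+q^n)(1-q^n)^r) for the rank (`hasSum_muPlus`, `hasSum_etaPlus`).

Near q = 1. The theta transformation gives P(exp(-t)) = (t/π)^{1/2}/2 · exp(π²/(4t)) · (1 + O(t²))
in a cone around the positive axis (`norm_overFun_sub_overMain_le`). Apart from its sign, the n-th
term of the other factor is t^{-r} n^{-r}(1 - κtn² - ρ_r tn + O(t²n⁴)), with κ = 1/2 for the crank
and κ = 1 for the rank; this κ is the only source of the difference between the two second
constants. The alternating sums of n^{-r}, n^{2-r} and n^{1-r} are η(r), η(r-2) and η(r-1), but they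
may diverge, and so may the sum of the error terms. Five steps of the Euler transformation cure
both: they sum the powers (`eulerAlt_zpow`) and, since each difference of an analytic function gains
a factor 1/n by Cauchy's estimate, they make the remainder summable
(`exists_norm_tsum_cofactorTerm_sub_le`).

Away from q = 1. Comparing the product for P(q) factor by factor with that for P(|q|) saves a factor
exp(-δ/c) on |q| = exp(-c) (`norm_overFun_minor_le`).

Extraction. With c = π/(2√N) the major arc contributes integrals of t^{-ν-1} exp(π²/(4t) + Nt). For
ν > 0 the full vertical line gives the Bessel series exactly, and the part outside the arc is
exponentially smaller; the orders -1/2 and -3/2, needed for r ≤ 2, follow by a three-term recurrence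
(`BesselArc.pred`). The second order error c^{5/2-r} times the arc length c is the stated
N^{r/2-7/4}. Dropping the convention for (1) changes the moment by at most a constant times
exp(2√N), which is negligible since 2 < π. -/

namespace Overpart

open PowerSeries
open scoped PowerSeries.WithPiTopology

/-! ### Euler factors of multiplicative weights, and overpartitions in a box -/

section GenFun

variable {R : Type*} [CommRing R]

/-- The Euler factor at the part size `i` of a multiplicative weight on partitions. -/
noncomputable def localFactor (f : ℕ → ℕ → R) (i : ℕ) : R⟦X⟧ :=
  PowerSeries.mk fun n => if i ∣ n then (if n = 0 then 1 else f i (n / i)) else 0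

/-- The generating function is an infinite product over part sizes, and setting the weight at `i` to
zero replaces one factor by 1. The discrete topology on `R` only serves to give the product a
meaning. The product is indexed from 0, so index k belongs to part size k + 1. -/
theorem genFun_eq_localFactor_mul (f : ℕ → ℕ → R) {i : ℕ} (hi : 1 ≤ i) :
    Nat.Partition.genFun f = localFactor f i * Nat.Partition.genFun (Function.update f i 0) := by
  classical
  let : TopologicalSpace R := ⊥
  have : DiscreteTopology R := ⟨rfl⟩
  obtain ⟨i, rfl⟩ : ∃ j, i = j + 1 := ⟨i - 1, by omega⟩
  have hloc : (1 : R⟦X⟧) + ∑' j, f (i + 1) (j + 1) • X ^ ((i + 1) * (j + 1))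
      = localFactor f (i + 1) := by
    have : HasSum (fun j => f (i + 1) (j + 1) • (X : R⟦X⟧) ^ ((i + 1) * (j + 1)))
        (localFactor f (i + 1) - 1) := by
      rw [PowerSeries.WithPiTopology.hasSum_iff_hasSum_coeff]
      intro d
      by_cases hd : (i + 1) ∣ d ∧ d ≠ 0
      · obtain ⟨⟨c, rfl⟩, h0⟩ := hd
        obtain ⟨c, rfl⟩ : ∃ b, c = b + 1 := ⟨c - 1, by
          rcases c with _ | c
          · simp at h0
          · simp⟩
        have h := hasSum_ite_eq (L := SummationFilter.unconditional ℕ) c (f (i + 1) (c + 1))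
        convert! h using 1
        · funext j
          simp only [PowerSeries.coeff_smul, PowerSeries.coeff_X_pow, smul_eq_mul]
          by_cases hj : j = c
          · subst hj; simp
          · have : ¬ ((i + 1) * (c + 1) = (i + 1) * (j + 1)) := by
              intro h; apply hj
              have := Nat.eq_of_mul_eq_mul_left (Nat.succ_pos i) h
              omega
            simp [hj, this]
        · simp [localFactor, PowerSeries.coeff_one]
      · convert! (hasSum_zero : HasSum (fun _ : ℕ => (0 : R)) 0) using 1
        · funext j
          simp only [PowerSeries.coeff_smul, PowerSeries.coeff_X_pow, smul_eq_mul]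
          have : ¬ (d = (i + 1) * (j + 1)) := by
            rintro rfl
            exact hd ⟨dvd_mul_right _ _, by positivity⟩
          simp [this]
        · by_cases hd0 : d = 0
          · subst hd0; simp [localFactor]
          · have : ¬ (i + 1 ∣ d) := fun h => hd ⟨h, hd0⟩
            simp [localFactor, PowerSeries.coeff_one, hd0, this]
    rw [this.tsum_eq]; ring
  have hm := Nat.Partition.multipliable_genFun (Function.update f (i + 1) 0)
  have h1 := Nat.Partition.genFun_eq_tprod f
  have h2 := Nat.Partition.genFun_eq_tprod (Function.update f (i + 1) 0)
  have e : (fun k => (1 : R⟦X⟧) + ∑' j, (Function.update f (i + 1) 0) (k + 1) (j + 1) •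
        X ^ ((k + 1) * (j + 1))) =
      Function.update (fun k => (1 : R⟦X⟧) + ∑' j, f (k + 1) (j + 1) •
        X ^ ((k + 1) * (j + 1))) i 1 := by
    funext k
    by_cases hk : k = i
    · subst hk; simp
    · simp [Function.update_of_ne hk, Function.update_of_ne (show k + 1 ≠ i + 1 by omega)]
  rw [e] at hm h2
  rw [h1, Multipliable.tprod_eq_mul_tprod_ite' i hm, hloc, h2]
  congr 1
  apply tprod_congr
  intro k
  by_cases hk : k = i
  · subst hk; simp
  · simp [hk]

/-- The common source of the functional equations below: for weights that agree off one part size, a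
linear relation need only be checked on the single Euler factor at that size. -/
theorem genFun_congr_off {f g : ℕ → ℕ → R} {i : ℕ} (hi : 1 ≤ i) (h : ∀ j ≠ i, f j = g j)
    {A B : R⟦X⟧} (hloc : A * localFactor f i = B * localFactor g i) :
    A * Nat.Partition.genFun f = B * Nat.Partition.genFun g := by
  have : Function.update f i 0 = Function.update g i 0 := by
    funext j
    by_cases hj : j = i
    · subst hj; simp
    · simp [Function.update_of_ne hj, h j hj]
  rw [genFun_eq_localFactor_mul f hi, genFun_eq_localFactor_mul g hi, this, ← mul_assoc, hloc,
    mul_assoc]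

theorem localFactor_of_eq_zero {f : ℕ → ℕ → R} {i : ℕ} (hi : 1 ≤ i) (h : ∀ c, 1 ≤ c → f i c = 0) :
    localFactor f i = 1 := by
  ext n
  rw [localFactor, PowerSeries.coeff_mk, PowerSeries.coeff_one]
  by_cases hn : n = 0
  · simp [hn]
  · by_cases hd : i ∣ n
    · simp [hn, hd, h (n / i) (Nat.div_pos (Nat.le_of_dvd (by omega) hd) (by omega))]
    · simp [hn, hd]

/-- A weight (a + b)a^c at multiplicity c + 1 sums to the Euler factor (1 + bX^i)/(1 - aX^i). The
pairs (a, b) used are (1, 0) for partitions, (0, 1) for distinct parts, (1, 1) for overpartitions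
and (z, z) for overpartitions with parts marked by z. -/
theorem one_sub_mul_localFactor {f : ℕ → ℕ → R} {i : ℕ} (hi : 1 ≤ i) {a b : R}
    (h1 : f i 1 = a + b) (h2 : ∀ c, f i (c + 2) = a * f i (c + 1)) :
    (1 - C a * X ^ i) * localFactor f i = 1 + C b * X ^ i := by
  ext n
  rw [sub_mul, one_mul, mul_assoc, map_sub, map_add, PowerSeries.coeff_C_mul,
    PowerSeries.coeff_C_mul, PowerSeries.coeff_X_pow_mul', localFactor, PowerSeries.coeff_mk,
    PowerSeries.coeff_one, PowerSeries.coeff_X_pow]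
  by_cases hd : i ∣ n
  · obtain ⟨c, rfl⟩ := hd
    rcases c with _ | _ | c
    · have : i ≠ 0 := by omega
      simp [this, this.symm]
    · have : i ≠ 0 := by omega
      simp [this, h1, Nat.div_self hi]
    · have e : i * (c + 1 + 1) - i = i * (c + 1) := by
        rw [Nat.mul_add i (c + 1) 1]; omega
      have h3 : i ≤ i * (c + 1 + 1) := Nat.le_mul_of_pos_right _ (by omega)
      have h4 : i ≠ 0 := by omega
      have h5 : ¬ (i * (c + 1 + 1) = i) := by
        intro h; have := Nat.eq_of_mul_eq_mul_left hi (h.trans (mul_one i).symm); omega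
      rw [PowerSeries.coeff_mk, e]
      simp [h3, h4, h5, Nat.mul_div_cancel_left _ hi, h2]
  · have h1 : n ≠ 0 := by rintro rfl; simp at hd
    have h2 : n ≠ i := by rintro rfl; simp at hd
    by_cases h : i ≤ n
    · have h3 : ¬ i ∣ (n - i) := by
        intro h'; apply hd; have := (Nat.dvd_add_self_right (m := i)).2 h'
        rwa [Nat.sub_add_cancel h] at this
      simp [hd, h1, h2, h, h3]
    · simp [hd, h1, h2, h]

theorem genFun_eq_one {f : ℕ → ℕ → R} (h : ∀ i c, 1 ≤ i → 1 ≤ c → f i c = 0) :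
    Nat.Partition.genFun f = 1 := by
  ext n
  rw [Nat.Partition.coeff_genFun, PowerSeries.coeff_one]
  by_cases hn : n = 0
  · subst hn
    simp [Finsupp.prod]
  · rw [if_neg hn]
    refine Finset.sum_eq_zero fun p _ => ?_
    obtain ⟨x, hx⟩ : ∃ x, x ∈ p.parts := by
      by_contra hcon
      push Not at hcon
      have := Multiset.eq_zero_of_forall_notMem hcon
      have h2 := p.parts_sum
      rw [this] at h2
      simp at h2; omega
    apply Finset.prod_eq_zero (i := x)
    · simpa using hx
    · apply h
      · exact p.parts_pos hx
      · simpa [Nat.one_le_iff_ne_zero] using hx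

end GenFun

/-- The power series of coefficients of `z ^ k` of a power series over `ℤ[z]`. -/
noncomputable def zCoeff (k : ℕ) : (Polynomial ℤ)⟦X⟧ →+ ℤ⟦X⟧ where
  toFun F := PowerSeries.mk fun n => (PowerSeries.coeff n F).coeff k
  map_zero' := by ext; simp
  map_add' := by intros; ext; simp

@[simp] theorem coeff_zCoeff (k n : ℕ) (F : (Polynomial ℤ)⟦X⟧) :
    PowerSeries.coeff n (zCoeff k F) = (PowerSeries.coeff n F).coeff k := by
  simp [zCoeff]

theorem zCoeff_X_pow_mul (k i : ℕ) (F : (Polynomial ℤ)⟦X⟧) :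
    zCoeff k (X ^ i * F) = X ^ i * zCoeff k F := by
  ext n
  rw [coeff_zCoeff, PowerSeries.coeff_X_pow_mul', PowerSeries.coeff_X_pow_mul']
  split_ifs <;> simp

theorem zCoeff_C_X_mul_succ (k i : ℕ) (F : (Polynomial ℤ)⟦X⟧) :
    zCoeff (k + 1) (C Polynomial.X * X ^ i * F) = X ^ i * zCoeff k F := by
  rw [← zCoeff_X_pow_mul]
  ext n
  rw [mul_assoc, coeff_zCoeff, coeff_zCoeff, PowerSeries.coeff_C_mul, Polynomial.coeff_X_mul]

theorem zCoeff_C_X_mul_zero (i : ℕ) (F : (Polynomial ℤ)⟦X⟧) :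
    zCoeff 0 (C Polynomial.X * X ^ i * F) = 0 := by
  ext n
  rw [mul_assoc, coeff_zCoeff, PowerSeries.coeff_C_mul]
  simp

/-- Each part size contributes `w` once, whatever its multiplicity. Hence w = 2 records the choice
of overlining its first occurrence, while z counts all parts. -/
theorem prod_toFinsupp_boole_pow (s : Multiset ℕ) (P : ℕ → Prop) [DecidablePred P] (w : ℕ)
    {S : Type*} [CommSemiring S] (z : S) :
    s.toFinsupp.prod (fun i c => if P i then (w : S) * z ^ c else 0) =
      if ∀ x ∈ s, P x then ((w ^ s.toFinset.card : ℕ) : S) * z ^ Multiset.card s else 0 := by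
  classical
  have hsupp : s.toFinsupp.support = s.toFinset := by ext; simp
  have hmem : (∀ i ∈ s.toFinset, P i) ↔ ∀ x ∈ s, P x := by simp
  rw [Finsupp.prod, Finset.prod_ite_zero, hsupp, if_congr hmem rfl rfl]
  split_ifs with h
  · rw [Finset.prod_mul_distrib, Finset.prod_const, Finset.prod_pow_eq_pow_sum]
    congr 2
    · push_cast; rfl
    · simp
  · rfl

/-- The weight of overpartitions with parts at most `L`, with `z` marking the number of parts. -/
noncomputable def boxWeight (L : ℕ) (i c : ℕ) : Polynomial ℤ :=
  if i ≤ L then ((2 : ℕ) : Polynomial ℤ) * Polynomial.X ^ c else 0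

/-- The generating function of overpartitions with exactly `k` parts, all at most `L`. -/
noncomputable def boxExact (L k : ℕ) : ℤ⟦X⟧ := zCoeff k (Nat.Partition.genFun (boxWeight L))

theorem coeff_boxExact (L k n : ℕ) :
    PowerSeries.coeff n (boxExact L k) =
      ((Finset.univ.filter (fun π : Overpartition n =>
        (∀ x ∈ π.parts, x ≤ L) ∧ Multiset.card π.parts = k)).card : ℤ) := by
  classical
  rw [boxExact, coeff_zCoeff, Nat.Partition.coeff_genFun]
  rw [show boxWeight L = fun i c =>
    if i ≤ L then ((2 : ℕ) : Polynomial ℤ) * Polynomial.X ^ c else 0 from rfl]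
  have h := fun p : n.Partition =>
    prod_toFinsupp_boole_pow p.parts (fun i => i ≤ L) 2 (Polynomial.X : Polynomial ℤ)
  rw [Finset.sum_congr rfl (fun p _ => h p), Polynomial.finsetSum_coeff,
    Finset.card_filter, Nat.cast_sum, Fintype.sum_sigma]
  refine Finset.sum_congr rfl fun p _ => ?_
  rw [Finset.sum_congr rfl (fun y _ => show _ =
    (if (∀ x ∈ p.parts, x ≤ L) ∧ Multiset.card p.parts = k then (1 : ℤ) else 0) from by
      push_cast; exact if_congr Iff.rfl rfl rfl), Finset.sum_const, Finset.card_univ, Fintype.card_coe, Finset.card_powerset]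
  split_ifs with h1 h2 h2
  · rw [← Polynomial.C_eq_natCast, Polynomial.coeff_C_mul]
    simp [Polynomial.coeff_X_pow, h2.2]
  · have : ¬ (k = Multiset.card p.parts) := fun h3 => h2 ⟨h1, h3.symm⟩
    rw [← Polynomial.C_eq_natCast, Polynomial.coeff_C_mul]
    simp [Polynomial.coeff_X_pow, this]
  · exact absurd h2.1 h1
  · simp

theorem genFun_boxWeight_succ (L : ℕ) :
    (1 - C Polynomial.X * X ^ (L + 1)) * Nat.Partition.genFun (boxWeight (L + 1)) =
      (1 + C Polynomial.X * X ^ (L + 1)) * Nat.Partition.genFun (boxWeight L) := by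
  apply genFun_congr_off (i := L + 1) (by omega)
  · intro j hj
    funext c
    simp only [boxWeight]
    congr 1
    apply propext; omega
  · rw [one_sub_mul_localFactor (b := Polynomial.X) (by omega) _ _, localFactor_of_eq_zero, mul_one]
    · omega
    · intro c _; simp [boxWeight]
    · simp [boxWeight]; ring
    · intro c; simp [boxWeight]; ring

theorem boxExact_zero_left (k : ℕ) : boxExact 0 k = if k = 0 then 1 else 0 := by
  rw [boxExact, genFun_eq_one]
  · ext n
    rw [coeff_zCoeff, PowerSeries.coeff_one]
    split_ifs <;> simp_all [Polynomial.coeff_one, PowerSeries.coeff_one]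
  · intro i c hi _
    simp [boxWeight]; omega

theorem boxExact_zero_right (L : ℕ) : boxExact L 0 = 1 := by
  induction L with
  | zero => simp [boxExact_zero_left]
  | succ L ih =>
    have := congrArg (zCoeff 0) (genFun_boxWeight_succ L)
    rw [sub_mul, add_mul, map_sub, map_add, zCoeff_C_X_mul_zero, zCoeff_C_X_mul_zero] at this
    simp only [one_mul, sub_zero, add_zero] at this
    exact this.trans ih

theorem boxExact_succ_succ (L k : ℕ) : boxExact (L + 1) (k + 1) =
    boxExact L (k + 1) + X ^ (L + 1) * (boxExact (L + 1) k + boxExact L k) := by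
  have := congrArg (zCoeff (k + 1)) (genFun_boxWeight_succ L)
  rw [sub_mul, add_mul, map_sub, map_add, zCoeff_C_X_mul_succ, zCoeff_C_X_mul_succ, one_mul,
    one_mul] at this
  change boxExact (L + 1) (k + 1) - X ^ (L + 1) * boxExact (L + 1) k =
    boxExact L (k + 1) + X ^ (L + 1) * boxExact L k at this
  linear_combination this

end Overpart

/-! ### Symmetry of the box and recursions for the rank -/

namespace Overpart

open PowerSeries

/-- The generating function of overpartitions with at most `k` parts, all at most `L`. -/
noncomputable def boxAtMost (L k : ℕ) : ℤ⟦X⟧ := ∑ j ∈ Finset.range (k + 1), boxExact L j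

theorem boxAtMost_zero_right (L : ℕ) : boxAtMost L 0 = 1 := by
  simp [boxAtMost, boxExact_zero_right]

theorem boxAtMost_succ (L k : ℕ) : boxAtMost L (k + 1) = boxAtMost L k + boxExact L (k + 1) := by
  rw [boxAtMost, Finset.sum_range_succ, boxAtMost]

theorem boxAtMost_zero_left (k : ℕ) : boxAtMost 0 k = 1 := by
  induction k with
  | zero => exact boxAtMost_zero_right 0
  | succ k ih => rw [boxAtMost_succ, ih, boxExact_zero_left]; simp

theorem boxAtMost_succ_left (L k : ℕ) : boxAtMost (L + 1) (k + 1) =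
    boxAtMost L (k + 1) + X ^ (L + 1) * (boxAtMost (L + 1) k + boxAtMost L k) := by
  induction k with
  | zero =>
    rw [boxAtMost_succ, boxAtMost_succ, boxExact_succ_succ]
    simp only [boxAtMost_zero_right, boxExact_zero_right, zero_add]
    ring
  | succ k ih =>
    have h1 := boxAtMost_succ (L + 1) (k + 1)
    have h2 := boxExact_succ_succ L (k + 1)
    have h3 := boxAtMost_succ L (k + 1)
    have h4 := boxAtMost_succ L k
    have h5 := boxAtMost_succ (L + 1) k
    linear_combination h1 + h2 + ih - h3 - X ^ (L + 1) * (h4 + h5)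

/-- The mirror image of `boxAtMost_succ_left` under exchange of the two sides of the box. It is
derived from that recurrence alone, by a double induction, so that no conjugation of overpartitions
has to be constructed. -/
theorem boxAtMost_succ_right (L k : ℕ) : boxAtMost (L + 1) (k + 1) =
    boxAtMost (L + 1) k + X ^ (k + 1) * (boxAtMost L (k + 1) + boxAtMost L k) := by
  induction L generalizing k with
  | zero =>
    induction k with
    | zero =>
      rw [boxAtMost_succ_left]
      simp only [boxAtMost_zero_right, boxAtMost_zero_left, zero_add]
    | succ k ih =>
      have h1 := boxAtMost_succ_left 0 (k + 1)
      have h2 := boxAtMost_succ_left 0 k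
      simp only [boxAtMost_zero_left, zero_add] at *
      linear_combination h1 - h2 + X * ih
  | succ L ihL =>
    have h1 := boxAtMost_succ_left (L + 1) k
    have h2 := ihL k
    have h3 := boxAtMost_succ_left L k
    rcases k with _ | k
    · simp only [boxAtMost_zero_right, zero_add] at *
      linear_combination h1 + h2 - X * h3
    · have h4 := boxAtMost_succ_left (L + 1) k
      have h5 := boxAtMost_succ_left L k
      have h6 := ihL k
      -- The same recurrence for the enlarged box with one part fewer, obtained by an inner
      -- induction on the number of parts.
      have h7 : boxAtMost (L + 1 + 1) (k + 1) =
        boxAtMost (L + 1 + 1) k + X ^ (k + 1) * (boxAtMost (L + 1) (k + 1) + boxAtMost (L + 1) k) := by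
        induction k with
        | zero =>
          have h2 := ihL 0
          simp only [boxAtMost_zero_right, zero_add] at *
          linear_combination h4 + h2 - X * h5
        | succ k ih =>
          have g1 := boxAtMost_succ_left (L + 1) k
          have g5 := boxAtMost_succ_left L k
          have g6 := ihL k
          have := ih (boxAtMost_succ_left (L+1) (k + 1)) (ihL (k + 1))
            (boxAtMost_succ_left L (k + 1)) g1 g5 g6
          linear_combination h4 + h6 - g1 + X ^ (L + 2) * (this + g6)
             - X ^ (k + 2) * (h5 + g5)
      linear_combination h1 + h2 - h4 + X ^ (L + 2) * (h7 + h6) - X ^ (k + 2) * (h3 + h5)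

/-- Combinatorially, 1 is subtracted from each of the k + 1 parts. The second summand corresponds to
an overlined 1, which leaves at most k positive parts. -/
theorem boxExact_succ_succ' (L k : ℕ) : boxExact (L + 1) (k + 1) =
    X ^ (k + 1) * (boxAtMost L (k + 1) + boxAtMost L k) := by
  have := boxAtMost_succ (L + 1) k
  linear_combination boxAtMost_succ_right L k - this

/-- The left and right recurrences are exchanged by swapping the sides, and the boundary values are
all 1. -/
theorem boxAtMost_symm (L k : ℕ) : boxAtMost L k = boxAtMost k L := by
  induction L generalizing k with
  | zero => rw [boxAtMost_zero_left, boxAtMost_zero_right]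
  | succ L ihL =>
    induction k with
    | zero => rw [boxAtMost_zero_left, boxAtMost_zero_right]
    | succ k ih =>
      rw [boxAtMost_succ_left, boxAtMost_succ_right k L, ihL (k + 1), ih, ihL k]

/-- A finite form of P = 1 + q(R_2 + R_1): a box with k parts bounded by k + m collects rank at most
m, so the sums along diagonals become rank generating functions as K grows. -/
theorem boxAtMost_diag (K : ℕ) : boxAtMost K K =
    1 + X * ∑ k ∈ Finset.range K, (boxExact (k + 2) k + boxExact (k + 1) k) := by
  induction K with
  | zero => simp [boxAtMost_zero_right]
  | succ K ih =>
    rw [Finset.sum_range_succ]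
    rcases K with _ | K
    · have := boxAtMost_succ_left 0 0
      simp only [boxAtMost_zero_right, boxAtMost_zero_left, boxExact_zero_right] at *
      rw [this]; simp
    · have h1 := boxAtMost_succ_left (K + 1) (K + 1)
      have h2 := boxAtMost_succ (K + 1) (K + 1)
      have h3 := boxExact_succ_succ' K (K + 1)
      have h4 := boxExact_succ_succ' (K + 2) K
      have h5 := boxExact_succ_succ' (K + 1) K
      rw [boxAtMost_symm K (K + 1 + 1), boxAtMost_symm K (K + 1)] at h3
      simp only [Nat.add_assoc, Nat.reduceAdd] at *
      linear_combination h1 + h2 + h3 + ih - X * h4 - X * h5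

/-- A finite form of the recursion for R_m + R_{m+1}. The left side tends to 2P, and the three
diagonal sums tend to R_m, R_{m+1} and R_{m+3} + R_{m+2}. -/
theorem boxAtMost_add_diag (m K : ℕ) :
    boxAtMost (K + m + 1) (K + 1) + boxAtMost (K + m + 1) K =
      ∑ k ∈ Finset.range (K + 2), boxExact (k + m) k +
      ∑ k ∈ Finset.range (K + 1), boxExact (k + (m + 1)) k +
      X ^ (m + 2) * ∑ k ∈ Finset.range K, (boxExact (k + (m + 3)) k + boxExact (k + (m + 2)) k) := by
  induction K with
  | zero =>
    have := boxAtMost_succ (m + 1) 0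
    simp only [boxAtMost_zero_right, boxExact_zero_right, Finset.sum_range_succ, zero_add,
      Finset.sum_range_zero] at *
    rw [this, add_comm 1 m]; ring
  | succ K ih =>
    rw [Finset.sum_range_succ (fun k => boxExact (k + m) k) (K + 2),
      Finset.sum_range_succ (fun k => boxExact (k + (m + 1)) k) (K + 1),
      Finset.sum_range_succ (fun k => boxExact (k + (m + 3)) k + boxExact (k + (m + 2)) k) K]
    have h1 := boxAtMost_succ (K + m + 2) (K + 1)
    have h2 := boxAtMost_succ (K + m + 2) K
    have h3 := boxAtMost_succ_left (K + m + 1) K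
    have e1 : K + 1 + m + 1 = K + m + 2 := by ring
    have e2 : K + 2 + m = K + m + 2 := by ring
    have e3 : K + 1 + (m + 1) = K + m + 2 := by ring
    have e4 : K + (m + 3) = K + m + 3 := by ring
    have e5 : K + (m + 2) = K + m + 2 := by ring
    rw [e1, e2, e3, e4, e5]
    rcases K with _ | K
    · simp only [boxAtMost_zero_right, boxExact_zero_right, zero_add] at *
      have h6 : m + 1 + 1 = m + 2 := rfl
      rw [h6] at h3
      linear_combination h1 + h2 + h3 + ih - h2 + h2
    · have h4 := boxAtMost_succ_left (K + 1 + m + 1) K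
      have h5 := boxExact_succ_succ' (K + 1 + m + 2) K
      have h6 := boxExact_succ_succ' (K + 1 + m + 1) K
      simp only [Nat.add_assoc, Nat.reduceAdd] at *
      linear_combination h1 + h2 + h3 + h4 + ih - X ^ (m + 2) * (h5 + h6)

/-- The generating function of overpartitions. -/
noncomputable def overGF : ℤ⟦X⟧ := PowerSeries.mk fun n => (Fintype.card (Overpartition n) : ℤ)

/-- The generating function of overpartitions with rank at most `m`. -/
noncomputable def rankLeGF (m : ℕ) : ℤ⟦X⟧ :=
  PowerSeries.mk fun n => PowerSeries.coeff n (∑ k ∈ Finset.range (n + 1), boxExact (k + m) k)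

theorem coeff_boxExact_eq_zero {L k n : ℕ} (h : n < k) : PowerSeries.coeff n (boxExact L k) = 0 := by
  rw [coeff_boxExact, Finset.filter_false_of_mem]
  · simp
  · rintro π _ ⟨-, h2⟩
    have := card_le π (le_refl π.parts)
    omega

theorem coeff_boxExact_of_le {L k n : ℕ} (h : n ≤ L) : PowerSeries.coeff n (boxExact L k) =
    ((Finset.univ.filter (fun π : Overpartition n => Multiset.card π.parts = k)).card : ℤ) := by
  rw [coeff_boxExact]
  congr 2
  ext π
  simp only [Finset.mem_filter, Finset.mem_univ, true_and, and_iff_right_iff_imp]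
  exact fun _ x hx => (mem_le π hx).trans h

theorem coeff_boxAtMost {L k n : ℕ} (hL : n ≤ L) (hk : n ≤ k) :
    PowerSeries.coeff n (boxAtMost L k) = PowerSeries.coeff n overGF := by
  rw [boxAtMost, map_sum, Finset.sum_congr rfl (fun j _ => coeff_boxExact_of_le hL), overGF,
    PowerSeries.coeff_mk, ← Nat.cast_sum, ← Finset.card_univ]
  congr 1
  symm
  apply Finset.card_eq_sum_card_fiberwise
  intro π _
  have := card_le π (le_refl π.parts)
  simp; omega

theorem coeff_sum_boxExact {m n K : ℕ} (h : n < K) :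
    PowerSeries.coeff n (∑ k ∈ Finset.range K, boxExact (k + m) k) =
      PowerSeries.coeff n (rankLeGF m) := by
  rw [rankLeGF, PowerSeries.coeff_mk, map_sum, map_sum]
  symm
  apply Finset.sum_subset
  · intro x; simp; omega
  · intro x _ hx
    apply coeff_boxExact_eq_zero
    simp at hx; omega

/-- The limit of `boxAtMost_diag`: the coefficient at n is already stable in a box of side n + 1. -/
theorem overGF_eq_one_add : overGF = 1 + X * (rankLeGF 2 + rankLeGF 1) := by
  ext n
  rw [← coeff_boxAtMost (L := n + 1) (k := n + 1) (by omega) (by omega), boxAtMost_diag, map_add,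
    map_add, Finset.sum_add_distrib]
  congr 1
  rcases n with _ | n
  · simp
  · rw [PowerSeries.coeff_succ_X_mul, PowerSeries.coeff_succ_X_mul, map_add, map_add,
      coeff_sum_boxExact (by omega), coeff_sum_boxExact (by omega)]

theorem rankLeGF_add_succ (m : ℕ) : rankLeGF m + rankLeGF (m + 1) =
    2 * overGF - X ^ (m + 2) * (rankLeGF (m + 3) + rankLeGF (m + 2)) := by
  ext n
  have h := congrArg (PowerSeries.coeff n) (boxAtMost_add_diag m (n + 1))
  rw [map_add, coeff_boxAtMost (by omega) (by omega), coeff_boxAtMost (by omega) (by omega),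
    map_add, map_add, coeff_sum_boxExact (by omega), coeff_sum_boxExact (by omega),
    PowerSeries.coeff_X_pow_mul', Finset.sum_add_distrib, map_add] at h
  rw [map_add, map_sub, PowerSeries.coeff_X_pow_mul', map_add, two_mul, map_add]
  split_ifs with hn
  · rw [if_pos hn, coeff_sum_boxExact (by omega), coeff_sum_boxExact (by omega)] at h
    linarith
  · rw [if_neg hn] at h
    linarith

theorem coeff_rankLeGF (m n : ℕ) : PowerSeries.coeff n (rankLeGF m) =
    ((Finset.univ.filter (fun π : Overpartition n => rank π.parts ≤ m)).card : ℤ) := by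
  classical
  rw [rankLeGF, PowerSeries.coeff_mk, map_sum, Finset.sum_congr rfl
    (fun j _ => coeff_boxExact _ _ _), ← Nat.cast_sum]
  congr 1
  rw [Finset.card_eq_sum_card_fiberwise (t := Finset.range (n + 1))
    (f := fun π : Overpartition n => Multiset.card π.parts)]
  · refine Finset.sum_congr rfl fun k _ => ?_
    rw [Finset.filter_filter]
    congr 1
    ext π
    rw [Finset.mem_filter, Finset.mem_filter]
    simp only [Finset.mem_univ, true_and, rank, largestPart]
    constructor
    · rintro ⟨h1, h2⟩
      refine ⟨?_, h2⟩
      have : π.parts.sup ≤ k + m := Multiset.sup_le.2 h1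
      omega
    · rintro ⟨h1, h2⟩
      refine ⟨?_, h2⟩
      apply Multiset.sup_le.1
      omega
  · intro π _
    have := card_le π (le_refl π.parts)
    simp; omega

theorem coeff_rankLeGF_nonneg (m n : ℕ) : 0 ≤ PowerSeries.coeff n (rankLeGF m) := by
  rw [coeff_rankLeGF]; positivity

theorem coeff_rankLeGF_le (m n : ℕ) :
    PowerSeries.coeff n (rankLeGF m) ≤ PowerSeries.coeff n overGF := by
  rw [coeff_rankLeGF, overGF, PowerSeries.coeff_mk]
  exact_mod_cast Finset.card_filter_le _ _

theorem rankCount_succ (m n : ℕ) : rankCount ((m + 1 : ℕ) : ℤ) n =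
    PowerSeries.coeff n (rankLeGF (m + 1)) - PowerSeries.coeff n (rankLeGF m) := by
  classical
  rw [coeff_rankLeGF, coeff_rankLeGF, rankCount, eq_sub_iff_add_eq, ← Nat.cast_add,
    ← Finset.card_union_of_disjoint, ← Finset.filter_or]
  · congr 2
    ext π
    simp only [Finset.mem_filter, Finset.mem_univ, true_and]
    push_cast
    omega
  · rw [Finset.disjoint_filter]
    intro π _ h
    push_cast at *
    omega

end Overpart

/-! ### The crank side: separating overlined parts, ones and large parts -/

namespace Overpart

open PowerSeries

/-! Splitting an overpartition into its overlined and non-overlined parts. -/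

/-- An overpartition is a pair consisting of a partition into distinct parts (the overlined ones)
and an arbitrary partition. The union of the two is the underlying partition, and the support of the
first is the set of overlined sizes. -/
theorem sum_nonOverlined (w : Multiset ℕ → ℤ) (n : ℕ) :
    ∑ π : Overpartition n, w π.nonOverlined =
      ∑ x ∈ Finset.HasAntidiagonal.antidiagonal n, ((Nat.Partition.distincts x.1).card : ℤ) *
        ∑ p : x.2.Partition, w p.parts := by
  classical
  have h : ∀ x : ℕ × ℕ, ((Nat.Partition.distincts x.1).card : ℤ) * ∑ p : x.2.Partition, w p.parts =
      ∑ y ∈ (Nat.Partition.distincts x.1 ×ˢ (Finset.univ : Finset x.2.Partition)), w y.2.parts := by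
    intro x
    rw [Finset.sum_product]
    simp
  simp_rw [h]
  rw [Finset.sum_sigma']
  symm
  have hsum : ∀ z ∈ ((Finset.HasAntidiagonal.antidiagonal n).sigma fun x : ℕ × ℕ =>
      (Nat.Partition.distincts x.1 ×ˢ (Finset.univ : Finset x.2.Partition))),
      (z.2.1.parts + z.2.2.parts).sum = n := by
    intro z hz
    simp only [Finset.mem_sigma, Finset.HasAntidiagonal.mem_antidiagonal] at hz
    rw [Multiset.sum_add, z.2.1.parts_sum, z.2.2.parts_sum, hz.1]
  refine Finset.sum_bij (fun z hz => (⟨⟨z.2.1.parts + z.2.2.parts, ?_, hsum z hz⟩,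
    ⟨z.2.1.parts.toFinset, ?_⟩⟩ : Overpartition n)) ?_ ?_ ?_ ?_
  · intro i hi
    rw [Multiset.mem_add] at hi
    rcases hi with hi | hi
    · exact z.2.1.parts_pos hi
    · exact z.2.2.parts_pos hi
  · rw [Finset.mem_powerset]
    intro x hx
    simp only [Multiset.mem_toFinset, Multiset.mem_add] at hx ⊢
    exact Or.inl hx
  · intros; exact Finset.mem_univ _
  · rintro ⟨⟨a, b⟩, D, l⟩ h1 ⟨⟨a', b'⟩, D', l'⟩ h2 heq
    simp only [Finset.mem_sigma, Finset.mem_product, Nat.Partition.distincts, Finset.mem_filter,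
      Finset.mem_univ, true_and, and_true] at h1 h2
    have e1 : D.parts + l.parts = D'.parts + l'.parts :=
      congrArg (fun π : Overpartition n => π.1.parts) heq
    have e2 : D.parts.toFinset = D'.parts.toFinset :=
      congrArg (fun π : Overpartition n => π.2.1) heq
    have e3 : D.parts = D'.parts := by
      rw [← Multiset.dedup_eq_self.2 h1.2, ← Multiset.dedup_eq_self.2 h2.2]
      have := congrArg Finset.val e2
      simpa using this
    have e4 : l.parts = l'.parts := by
      rw [e3] at e1; exact add_left_cancel e1
    have ea : a = a' := D.parts_sum.symm.trans ((congrArg Multiset.sum e3).trans D'.parts_sum)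
    have eb : b = b' := l.parts_sum.symm.trans ((congrArg Multiset.sum e4).trans l'.parts_sum)
    subst ea; subst eb
    have e5 : D = D' := Nat.Partition.ext e3
    have e6 : l = l' := Nat.Partition.ext e4
    rw [e5, e6]
  · rintro ⟨p, S, hS⟩ _
    rw [Finset.mem_powerset] at hS
    have hle : S.val ≤ p.parts := by
      rw [Multiset.le_iff_subset S.nodup]
      intro x hx
      have := hS (Finset.mem_def.2 hx)
      simpa using this
    have hadd : S.val + (p.parts - S.val) = p.parts := by
      rw [add_comm]; exact Multiset.sub_add_cancel hle
    refine ⟨⟨⟨S.val.sum, (p.parts - S.val).sum⟩, ⟨S.val, ?_, rfl⟩,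
      ⟨p.parts - S.val, ?_, rfl⟩⟩, ?_, ?_⟩
    · intro i hi; exact p.parts_pos (Multiset.mem_of_le hle hi)
    · intro i hi; exact p.parts_pos (Multiset.mem_of_le (Multiset.sub_le_self _ _) hi)
    · simp only [Finset.mem_sigma, Finset.mem_product, Nat.Partition.distincts, Finset.mem_filter,
        Finset.mem_univ, true_and, and_true, Finset.HasAntidiagonal.mem_antidiagonal]
      refine ⟨?_, S.nodup⟩
      rw [← Multiset.sum_add, hadd, p.parts_sum]
    · have e : (⟨S.val + (p.parts - S.val), by
          rw [hadd]; exact fun {i} hi => p.parts_pos hi, by rw [hadd]; exact p.parts_sum⟩ :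
          n.Partition) = p := Nat.Partition.ext hadd
      refine Sigma.ext e ?_
      simp only
      -- The type of the set of overlined sizes depends on the partition, so the second components
      -- are compared heterogeneously after transport along the equality of partitions.
      have key : ∀ (p' : n.Partition) (h : p' = p)
          (h1 : S ∈ p'.parts.toFinset.powerset) (h2 : S ∈ p.parts.toFinset.powerset),
          HEq (⟨S, h1⟩ : {S : Finset ℕ // S ∈ p'.parts.toFinset.powerset})
            (⟨S, h2⟩ : {S : Finset ℕ // S ∈ p.parts.toFinset.powerset}) := by
        rintro p' rfl _ _; rfl
      have hT : S.val.toFinset = S := by simp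
      simp only [hT]
      exact key _ e _ _
  · rintro ⟨⟨a, b⟩, D, l⟩ h1
    simp only [Finset.mem_sigma, Finset.mem_product, Nat.Partition.distincts, Finset.mem_filter,
      Finset.mem_univ, true_and, and_true] at h1
    simp only [Overpartition.nonOverlined]
    congr 1
    rw [Multiset.toFinset_val, Multiset.dedup_eq_self.2 h1.2, add_tsub_cancel_left]

/-- The generating function of partitions into distinct parts. -/
noncomputable def distinctGF : ℤ⟦X⟧ :=
  PowerSeries.mk fun n => ((Nat.Partition.distincts n).card : ℤ)

/-- The generating function of partitions with parts at most `j`. -/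
noncomputable def partLeGF (j : ℕ) : ℤ⟦X⟧ :=
  Nat.Partition.genFun (fun i _ => if i ≤ j then (1 : ℤ) else 0)

theorem coeff_genFun_boole (P : ℕ → Prop) [DecidablePred P] (n : ℕ) :
    PowerSeries.coeff n (Nat.Partition.genFun (fun i _ => if P i then (1 : ℤ) else 0)) =
      ((Finset.univ.filter fun p : n.Partition => ∀ x ∈ p.parts, P x).card : ℤ) := by
  rw [Nat.Partition.coeff_genFun, Finset.card_filter, Nat.cast_sum]
  refine Finset.sum_congr rfl fun p _ => ?_
  have := prod_toFinsupp_boole_pow p.parts P 1 (1 : ℤ)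
  simp only [one_pow, mul_one, Nat.cast_one] at this
  rw [this]
  split_ifs <;> simp

theorem partLeGF_zero : partLeGF 0 = 1 := by
  apply genFun_eq_one
  intro i c hi _
  rw [if_neg (by omega)]

theorem one_sub_mul_partLeGF (j : ℕ) : (1 - X ^ (j + 1)) * partLeGF (j + 1) = partLeGF j := by
  rw [partLeGF, partLeGF]
  nth_rw 2 [← one_mul (Nat.Partition.genFun _)]
  apply genFun_congr_off (i := j + 1) (by omega)
  · intro i hi
    funext c
    congr 1
    apply propext; omega
  · have h := one_sub_mul_localFactor (f := fun i _ => if i ≤ j + 1 then (1 : ℤ) else 0)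
      (i := j + 1) (a := 1) (b := 0) (by omega) (by simp) (by simp)
    rw [localFactor_of_eq_zero (f := fun i _ => if i ≤ j then (1 : ℤ) else 0)
      (by omega : 1 ≤ j + 1) (by simp)]
    simpa using h

theorem coeff_partLeGF_nonneg (j n : ℕ) : 0 ≤ PowerSeries.coeff n (partLeGF j) := by
  rw [partLeGF, coeff_genFun_boole]; positivity

/-- The generating function of all partitions. -/
noncomputable def partGF : ℤ⟦X⟧ := PowerSeries.mk fun n => (Fintype.card n.Partition : ℤ)

theorem coeff_partLeGF_of_le {j n : ℕ} (h : n ≤ j) :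
    PowerSeries.coeff n (partLeGF j) = PowerSeries.coeff n partGF := by
  rw [partLeGF, coeff_genFun_boole, partGF, PowerSeries.coeff_mk, Finset.filter_true_of_mem]
  · rfl
  · intro p _ x hx
    exact (p.le_of_mem_parts hx).trans h

theorem distinctGF_mul_partGF : distinctGF * partGF = overGF := by
  ext n
  have := sum_nonOverlined (fun _ => 1) n
  rw [PowerSeries.coeff_mul]
  simp only [distinctGF, partGF, overGF, PowerSeries.coeff_mk]
  simpa using this.symm

/-! Partitions by the number of ones and the number of large parts. -/

/-- A weight on part sizes and multiplicities restricted by `P`, in which `z` marks the parts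
larger than `j`. -/
noncomputable def markWeight (P : ℕ → ℕ → Prop) [∀ i c, Decidable (P i c)] (j i c : ℕ) :
    Polynomial ℤ :=
  if P i c then Polynomial.X ^ (if j < i then c else 0) else 0

theorem prod_markWeight (P : ℕ → ℕ → Prop) [∀ i c, Decidable (P i c)] (j : ℕ) (s : Multiset ℕ) :
    s.toFinsupp.prod (markWeight P j) =
      if ∀ i ∈ s, P i (s.count i) then Polynomial.X ^ Multiset.card (s.filter (j < ·)) else 0 := by
  classical
  have hsupp : s.toFinsupp.support = s.toFinset := by ext; simp
  have hmem : (∀ i ∈ s.toFinset, P i (s.toFinsupp i)) ↔ ∀ x ∈ s, P x (s.count x) := by simp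
  rw [Finsupp.prod, show markWeight P j = fun i c => if P i c then
    (Polynomial.X : Polynomial ℤ) ^ (if j < i then c else 0) else 0 from rfl,
    Finset.prod_ite_zero, hsupp, if_congr hmem rfl rfl]
  split_ifs with h
  · rw [Finset.prod_pow_eq_pow_sum]
    congr 1
    rw [← Multiset.toFinset_sum_count_eq, Multiset.toFinset_filter, Finset.sum_filter]
    refine Finset.sum_congr rfl fun x _ => ?_
    split_ifs with hx
    · simp [hx]
    · rfl
  · rfl

/-- The weight of partitions with parts larger than `a`, in which `z` marks parts larger than
`j`. -/
noncomputable def gapWeight (a j : ℕ) : ℕ → ℕ → Polynomial ℤ :=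
  markWeight (fun i _ => i = 0 ∨ a < i) j

theorem genFun_gapWeight_succ {a j : ℕ} (h : a < j) :
    (1 - X ^ (a + 1)) * Nat.Partition.genFun (gapWeight a j) =
      Nat.Partition.genFun (gapWeight (a + 1) j) := by
  nth_rw 2 [← one_mul (Nat.Partition.genFun _)]
  apply genFun_congr_off (i := a + 1) (by omega)
  · intro i hi
    funext c
    simp only [gapWeight, markWeight]
    congr 1
    apply propext; omega
  · have h := one_sub_mul_localFactor (f := gapWeight a j)
      (i := a + 1) (a := 1) (b := 0) (by omega)
      (by simp [gapWeight, markWeight]; omega)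
      (by simp [gapWeight, markWeight, show ¬ (j < a + 1) by omega])
    rw [localFactor_of_eq_zero (f := gapWeight (a + 1) j) (by omega : 1 ≤ a + 1)
      (by simp [gapWeight, markWeight])]
    simpa using h

theorem genFun_gapWeight_diag_succ (j : ℕ) :
    (1 - C Polynomial.X * X ^ (j + 1)) * Nat.Partition.genFun (gapWeight j j) =
      Nat.Partition.genFun (gapWeight (j + 1) (j + 1)) := by
  nth_rw 2 [← one_mul (Nat.Partition.genFun _)]
  apply genFun_congr_off (i := j + 1) (by omega)
  · intro i hi
    funext c
    simp only [gapWeight, markWeight]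
    have h1 : (i = 0 ∨ j < i) ↔ (i = 0 ∨ j + 1 < i) := by omega
    have h2 : (j < i) ↔ (j + 1 < i) := by omega
    simp only [h2]
  · have h := one_sub_mul_localFactor (f := gapWeight j j)
      (i := j + 1) (a := Polynomial.X) (b := 0) (by omega)
      (by simp [gapWeight, markWeight])
      (by intro c; simp [gapWeight, markWeight]; ring)
    rw [localFactor_of_eq_zero (f := gapWeight (j + 1) (j + 1)) (by omega : 1 ≤ j + 1)
      (by simp [gapWeight, markWeight])]
    simpa using h

/-- The generating function of partitions into exactly `k` parts, all larger than `j`. -/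
noncomputable def largeGF (j k : ℕ) : ℤ⟦X⟧ := zCoeff k (Nat.Partition.genFun (gapWeight j j))

theorem coeff_largeGF_of_le {j k n : ℕ} (h : n ≤ j) :
    PowerSeries.coeff n (largeGF j k) = if n = 0 ∧ k = 0 then 1 else 0 := by
  rw [largeGF, coeff_zCoeff, Nat.Partition.coeff_genFun]
  by_cases hn : n = 0
  · subst hn
    simp [Finsupp.prod, Polynomial.coeff_one]
  · rw [if_neg (by tauto), Finset.sum_eq_zero]
    · simp
    · intro p _
      rw [gapWeight, prod_markWeight, if_neg]
      intro hall
      obtain ⟨x, hx⟩ : ∃ x, x ∈ p.parts := by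
        by_contra hcon
        push Not at hcon
        have h2 := p.parts_sum
        rw [Multiset.eq_zero_of_forall_notMem hcon] at h2
        simp at h2; omega
      have h1 := hall x hx
      have h2 := p.parts_pos hx
      have h3 := p.le_of_mem_parts hx
      omega

theorem largeGF_succ (j k : ℕ) :
    largeGF j (k + 1) = largeGF (j + 1) (k + 1) + X ^ (j + 1) * largeGF j k := by
  have := congrArg (zCoeff (k + 1)) (genFun_gapWeight_diag_succ j)
  rw [sub_mul, map_sub, zCoeff_C_X_mul_succ, one_mul] at this
  change largeGF j (k + 1) - X ^ (j + 1) * largeGF j k = largeGF (j + 1) (k + 1) at this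
  linear_combination this

theorem largeGF_zero (j : ℕ) : largeGF j 0 = largeGF (j + 1) 0 := by
  have := congrArg (zCoeff 0) (genFun_gapWeight_diag_succ j)
  rw [sub_mul, map_sub, zCoeff_C_X_mul_zero, one_mul, sub_zero] at this
  exact this

/-- Euler's expansion of 1/(zq^{j+1}; q)_∞. For a fixed exponent n, the recursion raises j until j ≥
n, where partitions into parts larger than j are too big to contribute; the outer induction is on
the number of parts. -/
theorem largeGF_eq (j k : ℕ) : largeGF j k = X ^ (k * (j + 1)) * partLeGF k := by
  induction k generalizing j with
  | zero =>
    ext n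
    have key : ∀ d j, n ≤ j + d →
        PowerSeries.coeff n (largeGF j 0) = if n = 0 then 1 else 0 := by
      intro d
      induction d with
      | zero => intro j h; rw [coeff_largeGF_of_le (by omega)]; simp
      | succ d ih => intro j h; rw [largeGF_zero]; exact ih _ (by omega)
    rw [key n j (by omega), partLeGF_zero]
    simp [PowerSeries.coeff_one]
  | succ k ihk =>
    ext n
    have key : ∀ d j, n ≤ j + d → PowerSeries.coeff n (largeGF j (k + 1)) =
        PowerSeries.coeff n (X ^ ((k + 1) * (j + 1)) * partLeGF (k + 1)) := by
      intro d
      induction d with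
      | zero =>
        intro j h
        rw [coeff_largeGF_of_le (by omega), PowerSeries.coeff_X_pow_mul', if_neg (by omega),
          if_neg]
        nlinarith
      | succ d ih =>
        intro j h
        rw [largeGF_succ, map_add, ih _ (by omega), ihk, ← map_add, ← one_sub_mul_partLeGF k]
        congr 1
        ring
    exact key n j (by omega)

/-- The parts between 2 and j contribute (1 - q)/(q)_j and the marked parts above j contribute
Euler's q^{k(j+1)}/(q)_k. The proof removes the small sizes one at a time, keeping the product with
1/(q)_a invariant. -/
theorem genFun_gapWeight_one {j : ℕ} (hj : 1 ≤ j) (k : ℕ) :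
    zCoeff k (Nat.Partition.genFun (gapWeight 1 j)) =
      (1 - X) * partLeGF j * (X ^ (k * (j + 1)) * partLeGF k) := by
  rw [← largeGF_eq]
  have key : ∀ d a, a + d = j → partLeGF a * zCoeff k (Nat.Partition.genFun (gapWeight a j)) =
      partLeGF j * largeGF j k := by
    intro d
    induction d with
    | zero => intro a h; rw [add_zero] at h; subst h; rfl
    | succ d ih =>
      intro a h
      have h1 := congrArg (zCoeff k) (genFun_gapWeight_succ (show a < j by omega))
      rw [sub_mul, map_sub, zCoeff_X_pow_mul, one_mul] at h1
      rw [← ih (a + 1) (by omega), ← h1, ← one_sub_mul_partLeGF a]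
      ring
  have h1 := key (j - 1) 1 (by omega)
  have h2 := one_sub_mul_partLeGF 0
  rw [partLeGF_zero] at h2
  simp only [zero_add, pow_one] at h2
  linear_combination (1 - X) * h1 - zCoeff k (Nat.Partition.genFun (gapWeight 1 j)) * h2

theorem card_ones_large {j : ℕ} (hj : 1 ≤ j) (k n : ℕ) :
    ((Finset.univ.filter fun p : n.Partition =>
      p.parts.count 1 = j ∧ Multiset.card (p.parts.filter (j < ·)) = k).card : ℤ) =
    PowerSeries.coeff n (X ^ j * ((1 - X) * partLeGF j * (X ^ (k * (j + 1)) * partLeGF k))) := by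
  classical
  rw [← genFun_gapWeight_one hj, ← zCoeff_X_pow_mul]
  have hf : Nat.Partition.genFun (markWeight (fun i c => i = 1 → c = j) j) =
      (1 + X ^ j) * Nat.Partition.genFun (gapWeight 1 j) := by
    rw [← one_mul (Nat.Partition.genFun (markWeight _ j))]
    apply genFun_congr_off (i := 1) le_rfl
    -- Size 0, which no part has, is admitted by `gapWeight` so that the two weights agree at every
    -- index other than 1.
    · intro i hi
      funext c
      simp only [gapWeight, markWeight]
      congr 1
      apply propext; omega
    · rw [localFactor_of_eq_zero (f := gapWeight 1 j) le_rfl (by simp [gapWeight, markWeight]),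
        one_mul, mul_one]
      ext1 n
      rw [localFactor, PowerSeries.coeff_mk, map_add, PowerSeries.coeff_one,
        PowerSeries.coeff_X_pow]
      by_cases hn : n = 0
      · subst hn
        simp [show ¬ (0 = j) by omega]
      · simp [hn, markWeight, show ¬ (j < 1) by omega]
  -- The weight in `hf` allows 0 or j ones; subtracting the partitions without ones leaves exactly j
  -- ones.
  have h2 : X ^ j * Nat.Partition.genFun (gapWeight 1 j) =
      Nat.Partition.genFun (markWeight (fun i c => i = 1 → c = j) j) -
        Nat.Partition.genFun (gapWeight 1 j) := by rw [hf]; ring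
  rw [h2, map_sub, map_sub, coeff_zCoeff, coeff_zCoeff, Nat.Partition.coeff_genFun,
    Nat.Partition.coeff_genFun, Polynomial.finsetSum_coeff, Polynomial.finsetSum_coeff,
    ← Finset.sum_sub_distrib, Finset.card_filter, Nat.cast_sum]
  refine Finset.sum_congr rfl fun p _ => ?_
  rw [gapWeight, prod_markWeight, prod_markWeight]
  have hpos : ∀ i ∈ p.parts, i ≠ 0 := fun i hi => (p.parts_pos hi).ne'
  by_cases h1 : 1 ∈ p.parts
  · have h0 : ¬ ∀ i ∈ p.parts, i = 0 ∨ 1 < i := fun h => by have := h 1 h1; omega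
    rw [if_neg h0]
    by_cases hc : p.parts.count 1 = j
    · rw [if_pos (fun i _ hi => by rw [hi]; exact hc)]
      simp [hc, Polynomial.coeff_X_pow, eq_comm]
    · have h3 : ¬ ∀ i ∈ p.parts, i = 1 → p.parts.count i = j := fun h => hc (h 1 h1 rfl)
      rw [if_neg h3]
      simp [hc]
  · have hc : ¬ p.parts.count 1 = j := by
      rw [Multiset.count_eq_zero_of_notMem h1]; omega
    have h3 : ∀ i ∈ p.parts, i = 1 → p.parts.count i = j := fun i hi h => absurd (h ▸ hi) h1
    have h4 : ∀ i ∈ p.parts, i = 0 ∨ 1 < i := by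
      intro i hi
      have h3 := hpos i hi
      have : i ≠ 1 := fun h => h1 (h ▸ hi)
      omega
    rw [if_pos h3, if_pos h4]
    simp [hc]

end Overpart

/-! ### Durfee sums and the generating function of the crank -/

namespace Overpart

open PowerSeries

theorem one_sub_mul_partLeGF_eq {m : ℕ} (hm : 1 ≤ m) : (1 - X) * partLeGF m =
    Nat.Partition.genFun (fun i _ => if (i = 0 ∨ 1 < i) ∧ i ≤ m then (1 : ℤ) else 0) := by
  rw [partLeGF, ← one_mul (Nat.Partition.genFun (fun i _ => if (i = 0 ∨ 1 < i) ∧ i ≤ m then _ else _))]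
  apply genFun_congr_off (i := 1) le_rfl
  · intro i hi
    funext c
    congr 1
    apply propext; omega
  · have h := one_sub_mul_localFactor (f := fun i _ => if i ≤ m then (1 : ℤ) else 0)
      (i := 1) (a := 1) (b := 0) le_rfl (by simp [hm]) (by simp)
    rw [localFactor_of_eq_zero (f := fun i _ => if (i = 0 ∨ 1 < i) ∧ i ≤ m then (1 : ℤ) else 0)
      le_rfl (by simp)]
    simpa using h

/-- The right side is (1 - q)(1/(q)_{m+1} - 1/(q)_m). At m = 0 it equals q, although no partition
without ones has largest part 1. The correction term is exactly the contribution of (1) to crank 1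
under the customary convention, which therefore makes the crank series uniform in m. -/
theorem card_no_ones_sup (m n : ℕ) :
    ((Finset.univ.filter fun p : n.Partition =>
      p.parts.count 1 = 0 ∧ p.parts.sup = m + 1).card : ℤ) + (if n = 1 ∧ m = 0 then 1 else 0) =
    PowerSeries.coeff n ((1 - X) * (X ^ (m + 1) * partLeGF (m + 1))) := by
  classical
  have hX : (1 - X) * (X ^ (m + 1) * partLeGF (m + 1)) =
      (1 - X) * partLeGF (m + 1) - (1 - X) * partLeGF m := by
    rw [← one_sub_mul_partLeGF m]; ring
  rcases m with _ | m
  · have h := one_sub_mul_partLeGF 0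
    rw [partLeGF_zero, zero_add, pow_one] at h
    rw [partLeGF_zero, zero_add, h, mul_one] at hX
    rw [zero_add, hX, Finset.filter_false_of_mem]
    · simp [PowerSeries.coeff_X]
    · rintro p _ ⟨h1, h2⟩
      apply Multiset.count_eq_zero.1 h1
      have hle : ∀ x ∈ p.parts, x = 1 := fun x hx => by
        have := Multiset.le_sup hx
        have := p.parts_pos hx
        omega
      by_contra hcon
      have : p.parts = 0 := Multiset.eq_zero_of_forall_notMem fun x hx => hcon (hle x hx ▸ hx)
      rw [this] at h2; simp at h2
  · rw [hX, one_sub_mul_partLeGF_eq (by omega), one_sub_mul_partLeGF_eq (by omega), map_sub,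
      coeff_genFun_boole, coeff_genFun_boole, if_neg (by omega), add_zero, eq_sub_iff_add_eq,
      ← Nat.cast_add, ← Finset.card_union_of_disjoint, ← Finset.filter_or]
    · congr 2
      ext p
      rw [Finset.mem_filter, Finset.mem_filter]
      simp only [Finset.mem_univ, true_and]
      have h1 : p.parts.count 1 = 0 ↔ ∀ x ∈ p.parts, (x = 0 ∨ 1 < x) := by
        rw [Multiset.count_eq_zero]
        constructor
        · intro h x hx
          have : x ≠ 1 := fun e => h (e ▸ hx)
          omega
        · intro h h1; have := h 1 h1; omega
      have h2 : ∀ M, (∀ x ∈ p.parts, (x = 0 ∨ 1 < x) ∧ x ≤ M) ↔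
          (p.parts.count 1 = 0 ∧ p.parts.sup ≤ M) := by
        intro M
        rw [h1, Multiset.sup_le]
        exact ⟨fun h => ⟨fun x hx => (h x hx).1, fun x hx => (h x hx).2⟩,
          fun h x hx => ⟨h.1 x hx, h.2 x hx⟩⟩
      rw [h2, h2]
      omega
    · rw [Finset.disjoint_filter]
      rintro p _ ⟨-, h2⟩ h3
      have : p.parts.sup ≤ m + 1 := Multiset.sup_le.2 fun x hx => (h3 x hx).2
      omega

theorem crankWeight_eq {m n : ℕ} (p : n.Partition) :
    crankWeight p.parts ((m + 1 : ℕ) : ℤ) =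
      (if p.parts.count 1 = 0 ∧ p.parts.sup = m + 1 then 1 else 0) +
      (if p.parts = {1} ∧ m = 0 then 1 else 0) +
      ∑ j ∈ Finset.range n, (if p.parts.count 1 = j + 1 ∧
        Multiset.card (p.parts.filter (j + 1 < ·)) = m + 1 + (j + 1) then 1 else 0) := by
  classical
  have hcard : p.parts.count 1 ≤ n := by
    have h1 := Multiset.count_le_card 1 p.parts
    have h := Multiset.card_nsmul_le_sum (s := p.parts) (a := 1) (fun x hx => p.parts_pos hx)
    rw [p.parts_sum] at h
    simp at h; omega
  rcases ho : p.parts.count 1 with _ | o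
  · have hne : p.parts ≠ {1} := by
      intro h; rw [h] at ho; simp at ho
    rw [Finset.sum_eq_zero (by intro j _; rw [if_neg]; omega)]
    rw [crankWeight, if_neg hne, crank, numOnes, if_pos ho, largestPart]
    simp only [hne, false_and, if_false, add_zero, true_and]
    congr 1
    apply propext; omega
  · rw [Finset.sum_eq_single o]
    · have hc : crank p.parts = (Multiset.card (p.parts.filter (o + 1 < ·)) : ℤ) - (o + 1) := by
        rw [crank, numLarge, numOnes, ho, if_neg (by omega)]
        push_cast; rfl
      rw [crankWeight]
      by_cases h1 : p.parts = {1}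
      · have h2 : o = 0 := by rw [h1] at ho; simpa using ho.symm
        subst h2
        rw [if_pos h1]
        have h3 : ¬ (((m + 1 : ℕ) : ℤ) = 0) := by omega
        have h4 : ¬ (((m + 1 : ℕ) : ℤ) = -1) := by omega
        simp only [h3, h4, if_false, or_false]
        simp [h1, Multiset.filter_singleton]
      · rw [if_neg h1, hc]
        simp only [h1, false_and, if_false, true_and, add_zero]
        rw [if_neg (show ¬ (o + 1 = 0 ∧ p.parts.sup = m + 1) by omega), zero_add]
        congr 1
        apply propext; push_cast; omega
    · intro j _ hj
      rw [if_neg]; omega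
    · intro h; simp at h; omega

/-- The terms of the Durfee rectangle dissection of partitions. -/
noncomputable def durfeeTerm (m s j : ℕ) : ℤ⟦X⟧ :=
  X ^ (j * j + j * m + s * j) * (partLeGF j * partLeGF (m + j))

theorem coeff_durfeeTerm_eq_zero {m s j n : ℕ} (h : n < j) :
    PowerSeries.coeff n (durfeeTerm m s j) = 0 := by
  rw [durfeeTerm, PowerSeries.coeff_X_pow_mul', if_neg]
  nlinarith

/-- The sum of all Durfee terms. -/
noncomputable def durfeeSum (m s : ℕ) : ℤ⟦X⟧ :=
  PowerSeries.mk fun n => PowerSeries.coeff n (∑ j ∈ Finset.range (n + 1), durfeeTerm m s j)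

theorem coeff_sum_durfeeTerm {m s n K : ℕ} (h : n < K) :
    PowerSeries.coeff n (∑ j ∈ Finset.range K, durfeeTerm m s j) =
      PowerSeries.coeff n (durfeeSum m s) := by
  rw [durfeeSum, PowerSeries.coeff_mk, map_sum, map_sum]
  symm
  apply Finset.sum_subset
  · intro x; simp; omega
  · intro x _ hx
    apply coeff_durfeeTerm_eq_zero
    simp at hx; omega

theorem coeff_X_pow_mul_sum_durfeeTerm {m s n K e : ℕ} (h : n < K) :
    PowerSeries.coeff n (X ^ e * ∑ j ∈ Finset.range K, durfeeTerm m s j) =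
      PowerSeries.coeff n (X ^ e * durfeeSum m s) := by
  rw [PowerSeries.coeff_X_pow_mul', PowerSeries.coeff_X_pow_mul']
  split_ifs
  · exact coeff_sum_durfeeTerm (by omega)
  · rfl

/-- Termwise the difference carries 1 - q^j, which cancels the last factor of (q)_j; the index is
then shifted by one. -/
theorem durfeeSum_sub (m s : ℕ) :
    durfeeSum m s - durfeeSum m (s + 1) = X ^ (m + 1 + s) * durfeeSum (m + 1) (s + 1) := by
  have key : ∀ K, ∑ j ∈ Finset.range (K + 1), durfeeTerm m s j -
      ∑ j ∈ Finset.range (K + 1), durfeeTerm m (s + 1) j =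
      X ^ (m + 1 + s) * ∑ j ∈ Finset.range K, durfeeTerm (m + 1) (s + 1) j := by
    intro K
    induction K with
    | zero => simp [durfeeTerm]
    | succ K ih =>
      rw [Finset.sum_range_succ (durfeeTerm m s) (K + 1),
        Finset.sum_range_succ (durfeeTerm m (s + 1)) (K + 1),
        Finset.sum_range_succ (durfeeTerm (m + 1) (s + 1)) K, mul_add, ← ih]
      have : durfeeTerm m s (K + 1) - durfeeTerm m (s + 1) (K + 1) =
          X ^ (m + 1 + s) * durfeeTerm (m + 1) (s + 1) K := by
        simp only [durfeeTerm]
        rw [← one_sub_mul_partLeGF K, show m + (K + 1) = m + 1 + K by ring]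
        ring
      linear_combination this
  ext n
  have h := congrArg (PowerSeries.coeff n) (key (n + 1))
  rw [map_sub, coeff_sum_durfeeTerm (by omega), coeff_sum_durfeeTerm (by omega),
    coeff_X_pow_mul_sum_durfeeTerm (by omega)] at h
  rw [map_sub, h]

/-- Termwise the difference carries 1 - q^{m+1+j}, which turns 1/(q)_{m+1+j} into 1/(q)_{m+j}. -/
theorem durfeeSum_succ_sub (m s : ℕ) :
    durfeeSum (m + 1) s - X ^ (m + 1) * durfeeSum (m + 1) (s + 1) = durfeeSum m (s + 1) := by
  have key : ∀ K, ∑ j ∈ Finset.range K, durfeeTerm (m + 1) s j -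
      X ^ (m + 1) * ∑ j ∈ Finset.range K, durfeeTerm (m + 1) (s + 1) j =
      ∑ j ∈ Finset.range K, durfeeTerm m (s + 1) j := by
    intro K
    rw [Finset.mul_sum, ← Finset.sum_sub_distrib]
    refine Finset.sum_congr rfl fun j _ => ?_
    simp only [durfeeTerm]
    rw [← one_sub_mul_partLeGF (m + j), show m + 1 + j = m + j + 1 by ring]
    ring
  ext n
  have h := congrArg (PowerSeries.coeff n) (key (n + 1))
  rw [map_sub, coeff_sum_durfeeTerm (by omega), coeff_sum_durfeeTerm (by omega),
    coeff_X_pow_mul_sum_durfeeTerm (by omega)] at h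
  rw [map_sub, h]

/-- The Durfee rectangle identity. At s = 0 the two recurrences show independence of m, and for m >
n only the term j = 0, that is 1/(q)_m, reaches exponent n. -/
theorem durfeeSum_zero (m : ℕ) : durfeeSum m 0 = partGF := by
  have hstep : ∀ m, durfeeSum m 0 = durfeeSum (m + 1) 0 := fun m => by
    linear_combination durfeeSum_sub m 0 - durfeeSum_succ_sub m 0
  have hall : ∀ d m, durfeeSum m 0 = durfeeSum (m + d) 0 := by
    intro d
    induction d with
    | zero => intro m; rfl
    | succ d ih => intro m; rw [ih m, hstep (m + d), add_assoc]
  ext n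
  rw [hall (n + 1) m, durfeeSum, PowerSeries.coeff_mk, map_sum, Finset.sum_eq_single 0]
  · simp only [durfeeTerm]
    simp only [mul_zero, zero_mul, add_zero, pow_zero, one_mul, partLeGF_zero]
    exact coeff_partLeGF_of_le (by omega)
  · intro j _ hj
    rw [durfeeTerm, PowerSeries.coeff_X_pow_mul', if_neg]
    have : 1 ≤ j := by omega
    nlinarith
  · intro h; simp at h

theorem coeff_durfeeSum_nonneg (m s n : ℕ) : 0 ≤ PowerSeries.coeff n (durfeeSum m s) := by
  rw [durfeeSum, PowerSeries.coeff_mk, map_sum]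
  refine Finset.sum_nonneg fun j _ => ?_
  rw [durfeeTerm, PowerSeries.coeff_X_pow_mul']
  split_ifs
  · rw [PowerSeries.coeff_mul]
    exact Finset.sum_nonneg fun x _ =>
      mul_nonneg (coeff_partLeGF_nonneg _ _) (coeff_partLeGF_nonneg _ _)
  · rfl

theorem durfeeSum_one_eq (m : ℕ) :
    durfeeSum m 1 = partGF - X ^ (m + 1) * durfeeSum (m + 1) 1 := by
  have := durfeeSum_sub m 0
  rw [durfeeSum_zero] at this
  linear_combination -this

/-- The difference equals (1 - q)q^{m+1} times the Durfee sum with parameters m + 1 and 2. There the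
term j = 0 generates the partitions without ones, corrected by the convention for (1), and the term
of index j ≥ 1 generates those with j ones and m + 1 + j larger parts. -/
theorem sum_crankWeight (m : ℕ) :
    (PowerSeries.mk fun n => ∑ p : n.Partition, crankWeight p.parts ((m + 1 : ℕ) : ℤ)) =
      durfeeSum (m + 1) 1 - durfeeSum m 1 := by
  classical
  have hV : durfeeSum (m + 1) 1 - durfeeSum m 1 =
      (1 - X) * X ^ (m + 1) * durfeeSum (m + 1) 2 := by
    linear_combination durfeeSum_succ_sub m 1 - durfeeSum_sub m 1
  ext n
  have hfin : PowerSeries.coeff n ((1 - X) * X ^ (m + 1) * durfeeSum (m + 1) 2) =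
      PowerSeries.coeff n ((1 - X) * X ^ (m + 1) * ∑ j ∈ Finset.range (n + 1),
        durfeeTerm (m + 1) 2 j) := by
    have e : ∀ F : ℤ⟦X⟧, (1 - X) * X ^ (m + 1) * F = X ^ (m + 1) * F - X ^ (m + 2) * F := by
      intro F; ring
    rw [e, e, map_sub, map_sub, coeff_X_pow_mul_sum_durfeeTerm (by omega),
      coeff_X_pow_mul_sum_durfeeTerm (by omega)]
  rw [hV, hfin, PowerSeries.coeff_mk, Finset.sum_congr rfl (fun p _ => crankWeight_eq p),
    Finset.sum_add_distrib, Finset.sum_add_distrib, Finset.sum_comm, Finset.sum_range_succ',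
    mul_add, map_add, Finset.mul_sum, map_sum]
  have h1 := card_no_ones_sup m n
  rw [Finset.card_filter, Nat.cast_sum] at h1
  push_cast at h1
  have h2 : ∑ p : n.Partition, (if p.parts = {1} ∧ m = 0 then (1 : ℤ) else 0) =
      if n = 1 ∧ m = 0 then 1 else 0 := by
    by_cases hn : n = 1
    · subst hn
      simp [Nat.Partition.partition_one_parts]
    · rw [if_neg (by tauto), Finset.sum_eq_zero]
      intro p _
      rw [if_neg]
      rintro ⟨h, -⟩
      apply hn
      rw [← p.parts_sum, h]; simp
  have h3 : durfeeTerm (m + 1) 2 0 = partLeGF (m + 1) := by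
    simp [durfeeTerm, partLeGF_zero]
  rw [h2, h1, h3, add_comm]
  congr 1
  · refine Finset.sum_congr rfl fun j _ => ?_
    have := card_ones_large (show 1 ≤ j + 1 by omega) (m + 1 + (j + 1)) n
    rw [Finset.card_filter, Nat.cast_sum] at this
    push_cast at this
    rw [this, durfeeTerm]
    congr 1
    ring
  · congr 1; ring

/-- The generating functions through which the overpartition crank counts telescope. -/
noncomputable def crankGF (m : ℕ) : ℤ⟦X⟧ := distinctGF * durfeeSum m 1

theorem crankGF_eq (m : ℕ) : crankGF m = overGF - X ^ (m + 1) * crankGF (m + 1) := by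
  rw [crankGF, durfeeSum_one_eq, crankGF, ← distinctGF_mul_partGF]; ring

theorem crankCountConv_succ (m n : ℕ) : crankCountConv ((m + 1 : ℕ) : ℤ) n =
    PowerSeries.coeff n (crankGF (m + 1)) - PowerSeries.coeff n (crankGF m) := by
  rw [crankCountConv, sum_nonOverlined (fun s => crankWeight s _), ← map_sub, crankGF, crankGF,
    ← mul_sub, ← sum_crankWeight, PowerSeries.coeff_mul]
  simp only [distinctGF, PowerSeries.coeff_mk]

theorem coeff_crankGF_nonneg (m n : ℕ) : 0 ≤ PowerSeries.coeff n (crankGF m) := by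
  rw [crankGF, PowerSeries.coeff_mul]
  refine Finset.sum_nonneg fun x _ => mul_nonneg ?_ (coeff_durfeeSum_nonneg _ _ _)
  rw [distinctGF, PowerSeries.coeff_mk]; positivity

/-- By `crankGF_eq` the defect from `overGF` is a shift of the next series, which has nonnegative
coefficients. -/
theorem coeff_crankGF_le (m n : ℕ) :
    PowerSeries.coeff n (crankGF m) ≤ PowerSeries.coeff n overGF := by
  rw [crankGF_eq, map_sub, PowerSeries.coeff_X_pow_mul']
  split_ifs
  · linarith [coeff_crankGF_nonneg (m + 1) (n - (m + 1))]
  · simp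

/-- The literal count and the conventional one differ by a count of distinct partitions. -/
theorem crankCountConv_sub_crankCount (m n : ℕ) :
    crankCountConv ((m + 1 : ℕ) : ℤ) (n + 1) - crankCount ((m + 1 : ℕ) : ℤ) (n + 1) =
      if m = 0 then PowerSeries.coeff n distinctGF else 0 := by
  classical
  have h : crankCount ((m + 1 : ℕ) : ℤ) (n + 1) =
      ∑ π : Overpartition (n + 1), if crank π.nonOverlined = ((m + 1 : ℕ) : ℤ) then 1 else 0 := by
    rw [crankCount, Finset.card_filter]; push_cast; rfl
  have hw : ∀ s : Multiset ℕ, crankWeight s ((m + 1 : ℕ) : ℤ) -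
      (if crank s = ((m + 1 : ℕ) : ℤ) then 1 else 0) = if s = {1} ∧ m = 0 then 1 else 0 := by
    intro s
    rw [crankWeight]
    by_cases hs : s = {1}
    · subst hs
      have hc : crank {1} = -1 := by
        simp [crank, numOnes, numLarge, Multiset.filter_singleton]
      have h1 : ¬ ((-1 : ℤ) = ((m + 1 : ℕ) : ℤ)) := by omega
      have h2 : ¬ (((m + 1 : ℕ) : ℤ) = 0) := by omega
      have h3 : (((m + 1 : ℕ) : ℤ) = 1 ∨ ((m + 1 : ℕ) : ℤ) = -1) ↔ m = 0 := by omega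
      simp only [hc, h1, h2, h3, if_true, if_false, true_and, sub_zero]
    · simp [hs]
  -- Only the non-overlined part (1) is counted differently, so the overlined parts form a partition
  -- of n into distinct parts.
  rw [crankCountConv, h, ← Finset.sum_sub_distrib, Finset.sum_congr rfl (fun π _ => hw _),
    sum_nonOverlined (fun s => if s = {1} ∧ m = 0 then 1 else 0), Finset.sum_eq_single (n, 1)]
  · split_ifs with hm
    · simp [hm, distinctGF, Nat.Partition.partition_one_parts]
    · simp [hm]
  · rintro ⟨a, b⟩ hab hne
    rw [Finset.sum_eq_zero, mul_zero]
    intro p _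
    rw [if_neg]
    rintro ⟨h, -⟩
    have hb : b = 1 := by
      have := p.parts_sum
      rw [h] at this; simpa using this.symm
    rw [Finset.HasAntidiagonal.mem_antidiagonal] at hab
    apply hne
    simp only at hab hb
    rw [Prod.mk.injEq]; omega
  · intro h; exact absurd (by simp) h

end Overpart

/-! ### Convergence in the unit disc and the product for P -/

namespace Overpart

open PowerSeries Filter Topology

/-! Evaluation of integer power series at complex numbers. -/

/-- The value of an integer power series at `q` is `a`, as an unconditionally convergent sum. -/
def HasEval (A : ℤ⟦X⟧) (q a : ℂ) : Prop :=
  HasSum (fun n => ((PowerSeries.coeff n A : ℤ) : ℂ) * q ^ n) a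

theorem HasEval.add {A B : ℤ⟦X⟧} {q a b : ℂ} (hA : HasEval A q a) (hB : HasEval B q b) :
    HasEval (A + B) q (a + b) := by
  have := HasSum.add hA hB
  unfold HasEval
  convert! this using 2 with n
  simp [add_mul]

theorem HasEval.sub {A B : ℤ⟦X⟧} {q a b : ℂ} (hA : HasEval A q a) (hB : HasEval B q b) :
    HasEval (A - B) q (a - b) := by
  have := HasSum.sub hA hB
  unfold HasEval
  convert! this using 2 with n
  simp [sub_mul]

theorem HasEval.X_pow_mul {A : ℤ⟦X⟧} {q a : ℂ} (hA : HasEval A q a) (k : ℕ) :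
    HasEval (X ^ k * A) q (q ^ k * a) := by
  unfold HasEval
  have hinj : Function.Injective (fun n : ℕ => n + k) := add_left_injective k
  rw [← hinj.hasSum_iff]
  · have := HasSum.mul_left (q ^ k) hA
    convert! this using 2 with n
    simp only [Function.comp, PowerSeries.coeff_X_pow_mul', if_pos (Nat.le_add_left k n),
      Nat.add_sub_cancel]
    ring
  · intro n hn
    rw [PowerSeries.coeff_X_pow_mul', if_neg]
    · simp
    · intro h
      exact hn ⟨n - k, Nat.sub_add_cancel h⟩

theorem HasEval.one (q : ℂ) : HasEval 1 q 1 := by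
  have := hasSum_ite_eq (L := SummationFilter.unconditional ℕ) 0 (1 : ℂ)
  unfold HasEval
  convert! this using 2 with n
  rw [PowerSeries.coeff_one]
  split_ifs with h <;> simp [h]

theorem HasEval.unique {A : ℤ⟦X⟧} {q a b : ℂ} (hA : HasEval A q a) (hB : HasEval A q b) : a = b :=
  HasSum.unique hA hB

/-- Nonnegative series inherit bounds on partial sums through a relation of Euler factors. -/
theorem sum_coeff_le_of_euler {A B : ℤ⟦X⟧} {k : ℕ} (a : ℕ) (hk : 1 ≤ k)
    (hrel : (1 - (a : ℤ⟦X⟧) * X ^ k) * A = (1 + X ^ k) * B) (ha : a ≤ 1)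
    (hA : ∀ n, 0 ≤ PowerSeries.coeff n A)
    (hB : ∀ n, 0 ≤ PowerSeries.coeff n B) {r M : ℝ} (hr0 : 0 ≤ r) (hr1 : r < 1)
    (hM : ∀ N, ∑ n ∈ Finset.range N, ((PowerSeries.coeff n B : ℤ) : ℝ) * r ^ n ≤ M) (N : ℕ) :
    ∑ n ∈ Finset.range N, ((PowerSeries.coeff n A : ℤ) : ℝ) * r ^ n ≤
      (1 + r ^ k) / (1 - a * r ^ k) * M := by
  have hshift : ∀ D : ℤ⟦X⟧, (∀ n, 0 ≤ PowerSeries.coeff n D) →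
      ∑ n ∈ Finset.range N, ((PowerSeries.coeff n (X ^ k * D) : ℤ) : ℝ) * r ^ n ≤
        r ^ k * ∑ n ∈ Finset.range N, ((PowerSeries.coeff n D : ℤ) : ℝ) * r ^ n := by
    intro D hD
    have h1 : ∑ n ∈ Finset.range N, ((PowerSeries.coeff n (X ^ k * D) : ℤ) : ℝ) * r ^ n ≤
        ∑ n ∈ Finset.range (N + k), ((PowerSeries.coeff n (X ^ k * D) : ℤ) : ℝ) * r ^ n := by
      apply Finset.sum_le_sum_of_subset_of_nonneg
      · intro x; simp; omega
      · intro i _ _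
        rw [PowerSeries.coeff_X_pow_mul']
        split_ifs
        · have := hD (i - k)
          have : (0 : ℝ) ≤ ((PowerSeries.coeff (i - k) D : ℤ) : ℝ) := by exact_mod_cast this
          positivity
        · simp
    refine h1.trans ?_
    rw [add_comm N k, Finset.sum_range_add, Finset.sum_eq_zero, zero_add, Finset.mul_sum]
    · apply le_of_eq
      refine Finset.sum_congr rfl fun n _ => ?_
      rw [PowerSeries.coeff_X_pow_mul', if_pos (by omega), Nat.add_sub_cancel_left]
      ring
    · intro x hx
      simp at hx
      rw [PowerSeries.coeff_X_pow_mul', if_neg (by omega)]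
      simp
  have hAeq : A = (a : ℤ⟦X⟧) * (X ^ k * A) + (B + X ^ k * B) := by linear_combination hrel
  set s := ∑ n ∈ Finset.range N, ((PowerSeries.coeff n A : ℤ) : ℝ) * r ^ n with hs
  have hle : s ≤ a * (r ^ k * s) + (M + r ^ k * M) := by
    have e : s = a * ∑ n ∈ Finset.range N, ((PowerSeries.coeff n (X ^ k * A) : ℤ) : ℝ) * r ^ n +
        (∑ n ∈ Finset.range N, ((PowerSeries.coeff n B : ℤ) : ℝ) * r ^ n +
        ∑ n ∈ Finset.range N, ((PowerSeries.coeff n (X ^ k * B) : ℤ) : ℝ) * r ^ n) := by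
      rw [hs, Finset.mul_sum, ← Finset.sum_add_distrib, ← Finset.sum_add_distrib]
      refine Finset.sum_congr rfl fun n _ => ?_
      have : PowerSeries.coeff n A = a * PowerSeries.coeff n (X ^ k * A) +
          (PowerSeries.coeff n B + PowerSeries.coeff n (X ^ k * B)) := by
        conv_lhs => rw [hAeq]
        rw [map_add, map_add]
        congr 1
        have : (a : ℤ⟦X⟧) = C (a : ℤ) := by simp
        rw [this, PowerSeries.coeff_C_mul]
      rw [this]
      push_cast
      ring
    rw [e]
    have h1 := hshift A hA
    have h2 := hshift B hB
    have h3 := mul_le_mul_of_nonneg_left (hM N) (pow_nonneg hr0 k)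
    have h4 := mul_le_mul_of_nonneg_left h1 (Nat.cast_nonneg (α := ℝ) a)
    have h5 := hM N
    rw [← e]
    linarith
  have hrk : r ^ k < 1 := pow_lt_one₀ hr0 hr1 (by omega)
  have hrk0 : 0 ≤ r ^ k := pow_nonneg hr0 k
  have ha' : (a : ℝ) ≤ 1 := by exact_mod_cast ha
  have hpos : 0 < 1 - a * r ^ k := by nlinarith
  rw [div_mul_eq_mul_div, le_div_iff₀ hpos]
  nlinarith

/-- The generating function of overpartitions with parts at most `L`. -/
noncomputable def overLeGF (L : ℕ) : ℤ⟦X⟧ :=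
  Nat.Partition.genFun (fun i _ => if i ≤ L then (2 : ℤ) else 0)

theorem coeff_overLeGF (L n : ℕ) : PowerSeries.coeff n (overLeGF L) =
    ∑ p : n.Partition, if ∀ x ∈ p.parts, x ≤ L then ((2 ^ p.parts.toFinset.card : ℕ) : ℤ) else 0 := by
  rw [overLeGF, Nat.Partition.coeff_genFun]
  refine Finset.sum_congr rfl fun p _ => ?_
  have := prod_toFinsupp_boole_pow p.parts (fun i => i ≤ L) 2 (1 : ℤ)
  simp only [one_pow, mul_one] at this
  exact_mod_cast this

theorem coeff_overGF (n : ℕ) : PowerSeries.coeff n overGF =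
    ∑ p : n.Partition, ((2 ^ p.parts.toFinset.card : ℕ) : ℤ) := by
  rw [overGF, PowerSeries.coeff_mk, ← Nat.cast_sum, Fintype.card_sigma]
  congr 1
  refine Finset.sum_congr rfl fun p _ => ?_
  rw [Fintype.card_coe, Finset.card_powerset]

theorem coeff_overLeGF_nonneg (L n : ℕ) : 0 ≤ PowerSeries.coeff n (overLeGF L) := by
  rw [coeff_overLeGF]
  exact Finset.sum_nonneg fun p _ => by split_ifs <;> positivity

theorem coeff_overGF_nonneg (n : ℕ) : 0 ≤ PowerSeries.coeff n overGF := by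
  rw [coeff_overGF]; positivity

theorem coeff_overLeGF_le (L n : ℕ) :
    PowerSeries.coeff n (overLeGF L) ≤ PowerSeries.coeff n overGF := by
  rw [coeff_overLeGF, coeff_overGF]
  exact Finset.sum_le_sum fun p _ => by
    split_ifs
    · exact le_rfl
    · positivity

theorem coeff_overLeGF_of_le {L n : ℕ} (h : n ≤ L) :
    PowerSeries.coeff n (overLeGF L) = PowerSeries.coeff n overGF := by
  rw [coeff_overLeGF, coeff_overGF]
  exact Finset.sum_congr rfl fun p _ =>
    if_pos fun x hx => (p.le_of_mem_parts hx).trans h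

theorem overLeGF_zero : overLeGF 0 = 1 := by
  apply genFun_eq_one
  intro i c hi _
  rw [if_neg (by omega)]

theorem one_sub_mul_overLeGF (L : ℕ) :
    (1 - X ^ (L + 1)) * overLeGF (L + 1) = (1 + X ^ (L + 1)) * overLeGF L := by
  rw [overLeGF, overLeGF]
  apply genFun_congr_off (i := L + 1) (by omega)
  · intro i hi
    funext c
    congr 1
    apply propext; omega
  · have h := one_sub_mul_localFactor (f := fun i _ => if i ≤ L + 1 then (2 : ℤ) else 0)
      (i := L + 1) (a := 1) (b := 1) (by omega) (by simp) (by simp)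
    rw [localFactor_of_eq_zero (f := fun i _ => if i ≤ L then (2 : ℤ) else 0)
      (by omega : 1 ≤ L + 1) (by simp)]
    simpa using h

theorem sum_coeff_one_le {r : ℝ} (N : ℕ) :
    ∑ n ∈ Finset.range N, ((PowerSeries.coeff n (1 : ℤ⟦X⟧) : ℤ) : ℝ) * r ^ n ≤ 1 := by
  rcases N with _ | N
  · simp
  · rw [Finset.sum_range_succ', Finset.sum_eq_zero]
    · simp
    · intro n _; simp [PowerSeries.coeff_one]

/-- With x = r^{L+1} ≤ r one has (1 + x)/(1 - x) ≤ 1 + 2x/(1 - r) ≤ exp(2x/(1 - r)). The exponents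
form a geometric series, so the bound is uniform in L and gives the convergence of P. -/
theorem sum_coeff_overLeGF_le {r : ℝ} (hr0 : 0 ≤ r) (hr1 : r < 1) (L N : ℕ) :
    ∑ n ∈ Finset.range N, ((PowerSeries.coeff n (overLeGF L) : ℤ) : ℝ) * r ^ n ≤
      Real.exp (∑ i ∈ Finset.range L, 2 * r ^ (i + 1) / (1 - r)) := by
  induction L generalizing N with
  | zero =>
    rw [overLeGF_zero]
    simpa using sum_coeff_one_le (r := r) N
  | succ L ih =>
    have h := sum_coeff_le_of_euler (A := overLeGF (L + 1)) (B := overLeGF L) (k := L + 1) 1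
      (by omega) (by simpa using one_sub_mul_overLeGF L) le_rfl (coeff_overLeGF_nonneg _)
      (coeff_overLeGF_nonneg _) hr0 hr1 ih N
    refine h.trans ?_
    rw [Finset.sum_range_succ, Real.exp_add, mul_comm]
    gcongr
    have hx : r ^ (L + 1) ≤ r := by
      calc r ^ (L + 1) ≤ r ^ 1 := pow_le_pow_of_le_one hr0 hr1.le (by omega)
        _ = r := pow_one r
    have hx0 : 0 ≤ r ^ (L + 1) := pow_nonneg hr0 _
    have h1 : (1 + r ^ (L + 1)) / (1 - ((1 : ℕ) : ℝ) * r ^ (L + 1)) =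
        2 * r ^ (L + 1) / (1 - r ^ (L + 1)) + 1 := by
      have : 1 - r ^ (L + 1) ≠ 0 := by linarith
      rw [Nat.cast_one, one_mul]
      field_simp
      ring
    rw [h1]
    refine le_trans ?_ (Real.add_one_le_exp _)
    gcongr

theorem summable_overGF {r : ℝ} (hr0 : 0 ≤ r) (hr1 : r < 1) :
    Summable fun n => ((PowerSeries.coeff n overGF : ℤ) : ℝ) * r ^ n := by
  refine summable_of_sum_range_le (c := Real.exp (2 / (1 - r) * (1 - r)⁻¹)) ?_ ?_
  · intro n
    have := coeff_overGF_nonneg n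
    have : (0 : ℝ) ≤ ((PowerSeries.coeff n overGF : ℤ) : ℝ) := by exact_mod_cast this
    positivity
  · intro N
    have h := sum_coeff_overLeGF_le hr0 hr1 N N
    rw [Finset.sum_congr rfl (g := fun n => ((PowerSeries.coeff n overGF : ℤ) : ℝ) * r ^ n)] at h
    · refine h.trans (Real.exp_le_exp.2 ?_)
      have h1 : 0 < 1 - r := by linarith
      have : ∑ i ∈ Finset.range N, 2 * r ^ (i + 1) / (1 - r) =
          2 / (1 - r) * ∑ i ∈ Finset.range N, r ^ (i + 1) := by
        rw [Finset.mul_sum]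
        refine Finset.sum_congr rfl fun i _ => by ring
      rw [this]
      gcongr
      calc ∑ i ∈ Finset.range N, r ^ (i + 1) ≤ ∑ i ∈ Finset.range N, r ^ i := by
            refine Finset.sum_le_sum fun i _ => pow_le_pow_of_le_one hr0 hr1.le (by omega)
        _ ≤ ∑' i, r ^ i := (summable_geometric_of_lt_one hr0 hr1).sum_le_tsum _
            (fun i _ => pow_nonneg hr0 i)
        _ = (1 - r)⁻¹ := tsum_geometric_of_lt_one hr0 hr1
    · intro n hn
      rw [coeff_overLeGF_of_le (Finset.mem_range.1 hn).le]

theorem summable_of_coeff_le {A : ℤ⟦X⟧} {q : ℂ} (hq : ‖q‖ < 1)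
    (h0 : ∀ n, 0 ≤ PowerSeries.coeff n A)
    (hA : ∀ n, PowerSeries.coeff n A ≤ PowerSeries.coeff n overGF) :
    Summable fun n => ((PowerSeries.coeff n A : ℤ) : ℂ) * q ^ n := by
  refine Summable.of_norm_bounded (summable_overGF (norm_nonneg q) hq) fun n => ?_
  rw [norm_mul, norm_pow]
  gcongr
  have h1 := h0 n
  have h2 := hA n
  rw [Complex.norm_intCast, abs_of_nonneg (by exact_mod_cast h1)]
  exact_mod_cast h2

/-- The generating function of overpartitions, as a function on the unit disc. -/
noncomputable def overFun (q : ℂ) : ℂ :=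
  ∑' n, ((PowerSeries.coeff n overGF : ℤ) : ℂ) * q ^ n

theorem hasEval_overGF {q : ℂ} (hq : ‖q‖ < 1) : HasEval overGF q (overFun q) :=
  (summable_of_coeff_le hq coeff_overGF_nonneg fun _ => le_rfl).hasSum

/-- A series dominated by the overpartition generating function takes values bounded by it. -/
theorem HasEval.norm_le {A : ℤ⟦X⟧} {q a : ℂ} (hA : HasEval A q a) (hq : ‖q‖ < 1)
    (h0 : ∀ n, 0 ≤ PowerSeries.coeff n A)
    (h1 : ∀ n, PowerSeries.coeff n A ≤ PowerSeries.coeff n overGF) :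
    ‖a‖ ≤ ∑' n, ((PowerSeries.coeff n overGF : ℤ) : ℝ) * ‖q‖ ^ n := by
  rw [← hA.tsum_eq]
  refine tsum_of_norm_bounded (summable_overGF (norm_nonneg q) hq).hasSum fun n => ?_
  rw [norm_mul, norm_pow]
  gcongr
  have h2 := h0 n
  have h3 := h1 n
  rw [Complex.norm_intCast, abs_of_nonneg (by exact_mod_cast h2)]
  exact_mod_cast h3

theorem hasEval_overLeGF {q : ℂ} (hq : ‖q‖ < 1) (L : ℕ) :
    HasEval (overLeGF L) q (∏ i ∈ Finset.range L, (1 + q ^ (i + 1)) / (1 - q ^ (i + 1))) := by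
  induction L with
  | zero => rw [overLeGF_zero]; simpa using HasEval.one q
  | succ L ih =>
    have hs := (summable_of_coeff_le hq (coeff_overLeGF_nonneg (L + 1))
      (coeff_overLeGF_le (L + 1))).hasSum
    set a := ∑' n, ((PowerSeries.coeff n (overLeGF (L + 1)) : ℤ) : ℂ) * q ^ n
    have hs' : HasEval (overLeGF (L + 1)) q a := hs
    have h1 := hs'.sub (hs'.X_pow_mul (L + 1))
    have h2 := ih.add (ih.X_pow_mul (L + 1))
    have e1 : overLeGF (L + 1) - X ^ (L + 1) * overLeGF (L + 1) =
        overLeGF L + X ^ (L + 1) * overLeGF L := by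
      linear_combination one_sub_mul_overLeGF L
    rw [e1] at h1
    have h3 := h1.unique h2
    have hne : 1 - q ^ (L + 1) ≠ 0 := by
      intro h
      have : ‖q ^ (L + 1)‖ = 1 := by rw [← sub_eq_zero.1 h]; simp
      rw [norm_pow] at this
      have := pow_lt_one₀ (norm_nonneg q) hq (show L + 1 ≠ 0 by omega)
      linarith
    rw [Finset.prod_range_succ]
    convert! hs' using 1
    field_simp
    linear_combination -h3

/-- The coefficients for parts at most L are dominated by, and eventually equal to, those of P, so
dominated convergence applies to the series. -/
theorem tendsto_prod_overFun {q : ℂ} (hq : ‖q‖ < 1) :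
    Tendsto (fun L => ∏ i ∈ Finset.range L, (1 + q ^ (i + 1)) / (1 - q ^ (i + 1))) atTop
      (𝓝 (overFun q)) := by
  have h : ∀ L, ∏ i ∈ Finset.range L, (1 + q ^ (i + 1)) / (1 - q ^ (i + 1)) =
      ∑' n, ((PowerSeries.coeff n (overLeGF L) : ℤ) : ℂ) * q ^ n := fun L =>
    (hasEval_overLeGF hq L).tsum_eq.symm
  simp_rw [h]
  refine tendsto_tsum_of_dominated_convergence (summable_overGF (norm_nonneg q) hq) ?_ ?_
  · intro n
    apply tendsto_const_nhds.congr'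
    filter_upwards [eventually_ge_atTop n] with L hL
    rw [coeff_overLeGF_of_le hL]
  · refine Eventually.of_forall fun L n => ?_
    rw [norm_mul, norm_pow]
    gcongr
    have h2 := coeff_overLeGF_nonneg L n
    have h3 := coeff_overLeGF_le L n
    rw [Complex.norm_intCast, abs_of_nonneg (by exact_mod_cast h2)]
    exact_mod_cast h3

/-- A bounded solution of an alternating first-order recursion is the alternating series. -/
theorem hasSum_of_recursion {y a : ℕ → ℂ} {c : ℂ} {ρ B : ℝ} (hρ0 : 0 ≤ ρ) (hρ : ρ < 1)
    (hy : ∀ n, y n = c - a n * y (n + 1)) (ha : ∀ n, ‖a n‖ ≤ ρ) (hB : ∀ n, ‖y n‖ ≤ B) :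
    HasSum (fun n => c * ((-1) ^ n * ∏ i ∈ Finset.range n, a i)) (y 0) := by
  have hprod : ∀ n, ‖∏ i ∈ Finset.range n, a i‖ ≤ ρ ^ n := by
    intro n
    rw [norm_prod]
    calc ∏ i ∈ Finset.range n, ‖a i‖ ≤ ∏ i ∈ Finset.range n, ρ :=
          Finset.prod_le_prod (fun i _ => norm_nonneg _) (fun i _ => ha i)
      _ = ρ ^ n := by simp
  have hfin : ∀ n, y 0 = ∑ j ∈ Finset.range n, c * ((-1) ^ j * ∏ i ∈ Finset.range j, a i) +
      (-1) ^ n * (∏ i ∈ Finset.range n, a i) * y n := by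
    intro n
    induction n with
    | zero => simp
    | succ n ih =>
      rw [Finset.sum_range_succ, Finset.prod_range_succ, ih, hy n]
      ring
  have hsum : Summable fun n => c * ((-1) ^ n * ∏ i ∈ Finset.range n, a i) := by
    apply Summable.mul_left
    refine Summable.of_norm_bounded (summable_geometric_of_lt_one hρ0 hρ) fun n => ?_
    rw [norm_mul, norm_pow, norm_neg, norm_one, one_pow, one_mul]
    exact hprod n
  rw [hsum.hasSum_iff_tendsto_nat]
  have h0 : Tendsto (fun n => (-1) ^ n * (∏ i ∈ Finset.range n, a i) * y n) atTop (𝓝 0) := by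
    have h1 : Tendsto (fun n => ρ ^ n * B) atTop (𝓝 0) := by
      simpa using (tendsto_pow_atTop_nhds_zero_of_lt_one hρ0 hρ).mul_const B
    refine squeeze_zero_norm (fun n => ?_) h1
    rw [norm_mul, norm_mul, norm_pow, norm_neg, norm_one, one_pow, one_mul]
    exact mul_le_mul (hprod n) (hB n) (norm_nonneg _) (pow_nonneg hρ0 n)
  have h2 : (fun n => ∑ j ∈ Finset.range n, c * ((-1) ^ j * ∏ i ∈ Finset.range j, a i)) =
      fun n => y 0 - (-1) ^ n * (∏ i ∈ Finset.range n, a i) * y n := by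
    funext n
    rw [hfin n]; ring
  rw [h2]
  simpa using tendsto_const_nhds.sub h0

end Overpart

/-! ### Alternating series for the crank and rank counts -/

namespace Overpart

open PowerSeries Filter Topology

/-- Iteration of C_m = P - q^{m+1}C_{m+1}; the values stay bounded because all coefficients are
dominated by those of P. -/
theorem hasSum_crankGF {q : ℂ} (hq : ‖q‖ < 1) (m : ℕ) :
    HasEval (crankGF m) q (∑' n : ℕ, overFun q * ((-1) ^ n * (q ^ (n + 1).choose 2 * (q ^ n) ^ m))) ∧
    HasSum (fun n : ℕ => overFun q * ((-1) ^ n * (q ^ (n + 1).choose 2 * (q ^ n) ^ m)))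
      (∑' n : ℕ, overFun q * ((-1) ^ n * (q ^ (n + 1).choose 2 * (q ^ n) ^ m))) := by
  have hE : ∀ m, HasEval (crankGF m) q
      (∑' n, ((PowerSeries.coeff n (crankGF m) : ℤ) : ℂ) * q ^ n) := fun m =>
    (summable_of_coeff_le hq (coeff_crankGF_nonneg m) (coeff_crankGF_le m)).hasSum
  set v : ℕ → ℂ := fun m => ∑' n, ((PowerSeries.coeff n (crankGF m) : ℤ) : ℂ) * q ^ n with hv
  have hrec : ∀ m, v m = overFun q - q ^ (m + 1) * v (m + 1) := by
    intro m
    have h1 := (hasEval_overGF hq).sub ((hE (m + 1)).X_pow_mul (m + 1))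
    rw [← crankGF_eq m] at h1
    exact (hE m).unique h1
  have h := hasSum_of_recursion (y := fun n => v (m + n)) (a := fun n => q ^ (m + n + 1))
    (norm_nonneg q) hq (fun n => hrec (m + n)) (fun n => by
      rw [norm_pow]
      calc ‖q‖ ^ (m + n + 1) ≤ ‖q‖ ^ 1 := pow_le_pow_of_le_one (norm_nonneg q) hq.le (by omega)
        _ = ‖q‖ := pow_one _)
    (fun n => (hE (m + n)).norm_le hq (coeff_crankGF_nonneg _) (coeff_crankGF_le _))
  have hprod : ∀ n, ∏ i ∈ Finset.range n, q ^ (m + i + 1) = q ^ (n + 1).choose 2 * (q ^ n) ^ m := by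
    intro n
    induction n with
    | zero => simp
    | succ n ih =>
      rw [Finset.prod_range_succ, ih, Nat.choose_succ_succ' (n + 1) 1, Nat.choose_one_right]
      ring
  simp only [hprod, add_zero] at h
  refine ⟨?_, h.summable.hasSum⟩
  rw [h.tsum_eq]
  exact hE m

theorem hasEval_crank_sub {q : ℂ} (hq : ‖q‖ < 1) (m : ℕ) :
    HasEval (crankGF (m + 1) - crankGF m) q
      (∑' n : ℕ, overFun q * ((-1) ^ n * q ^ (n + 2).choose 2 * (1 - q ^ (n + 1))) *
        (q ^ (n + 1)) ^ m) := by
  have h1 := hasSum_crankGF hq (m + 1)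
  have h0 := hasSum_crankGF hq m
  have h := h1.2.sub h0.2
  have hE := h1.1.sub h0.1
  -- The terms with n = 0 do not depend on m and cancel in the difference.
  rw [← h.tsum_eq, h.summable.tsum_eq_zero_add] at hE
  convert! hE using 1
  simp only [pow_zero, one_pow, sub_self, zero_add]
  refine tsum_congr fun n => ?_
  ring

/-- The values of sums of consecutive rank generating functions. -/
theorem hasSum_rankLeGF_add {q : ℂ} (hq : ‖q‖ < 1) (m : ℕ) :
    HasEval (rankLeGF m + rankLeGF (m + 1)) q
      (∑' n : ℕ, 2 * overFun q * ((-1) ^ n * (q ^ (n * (n + 1)) * (q ^ n) ^ m))) ∧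
    HasSum (fun n : ℕ => 2 * overFun q * ((-1) ^ n * (q ^ (n * (n + 1)) * (q ^ n) ^ m)))
      (∑' n : ℕ, 2 * overFun q * ((-1) ^ n * (q ^ (n * (n + 1)) * (q ^ n) ^ m))) := by
  have hE : ∀ m, HasEval (rankLeGF m) q
      (∑' n, ((PowerSeries.coeff n (rankLeGF m) : ℤ) : ℂ) * q ^ n) := fun m =>
    (summable_of_coeff_le hq (coeff_rankLeGF_nonneg m) (coeff_rankLeGF_le m)).hasSum
  set e : ℕ → ℂ := fun m => ∑' n, ((PowerSeries.coeff n (rankLeGF m) : ℤ) : ℂ) * q ^ n with he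
  have hrec : ∀ m, e m + e (m + 1) = 2 * overFun q - q ^ (m + 2) * (e (m + 2) + e (m + 2 + 1)) := by
    intro m
    have h0 := hasEval_overGF hq
    have h1 := (h0.add h0).sub (((hE (m + 3)).add (hE (m + 2))).X_pow_mul (m + 2))
    rw [← two_mul, ← rankLeGF_add_succ m] at h1
    rw [((hE m).add (hE (m + 1))).unique h1]
    ring
  have hb : ∀ m, ‖e m + e (m + 1)‖ ≤
      2 * ∑' n, ((PowerSeries.coeff n overGF : ℤ) : ℝ) * ‖q‖ ^ n := by
    intro m
    have h1 := (hE m).norm_le hq (coeff_rankLeGF_nonneg _) (coeff_rankLeGF_le _)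
    have h2 := (hE (m + 1)).norm_le hq (coeff_rankLeGF_nonneg _) (coeff_rankLeGF_le _)
    calc ‖e m + e (m + 1)‖ ≤ ‖e m‖ + ‖e (m + 1)‖ := norm_add_le _ _
      _ ≤ _ := by linarith
  -- The recursion for R_m + R_{m+1} advances m by two, and the product of q^{m+2i+2} over i < n is
  -- q^{n(n+1)+nm}.
  have h := hasSum_of_recursion (y := fun n => e (m + 2 * n) + e (m + 2 * n + 1))
    (a := fun n => q ^ (m + 2 * n + 2))
    (norm_nonneg q) hq (fun n => hrec (m + 2 * n)) (fun n => by
      rw [norm_pow]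
      calc ‖q‖ ^ (m + 2 * n + 2) ≤ ‖q‖ ^ 1 :=
            pow_le_pow_of_le_one (norm_nonneg q) hq.le (by omega)
        _ = ‖q‖ := pow_one _)
    (fun n => hb _)
  have hprod : ∀ n, ∏ i ∈ Finset.range n, q ^ (m + 2 * i + 2) =
      q ^ (n * (n + 1)) * (q ^ n) ^ m := by
    intro n
    induction n with
    | zero => simp
    | succ n ih =>
      rw [Finset.prod_range_succ, ih]
      ring
  simp only [hprod, mul_zero, add_zero] at h
  refine ⟨?_, h.summable.hasSum⟩
  rw [h.tsum_eq]
  exact (hE m).add (hE (m + 1))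

/-- Gauss's identity: the overpartition generating function inverts the alternating theta
series. -/
theorem overFun_mul_theta {q : ℂ} (hq : ‖q‖ < 1) :
    overFun q * (1 + ∑' n : ℕ, 2 * (-1) ^ (n + 1) * q ^ ((n + 1) ^ 2)) = 1 := by
  obtain ⟨h1, h2⟩ := hasSum_rankLeGF_add hq 1
  have h3 := (HasEval.one q).add (h1.X_pow_mul 1)
  have e : (1 : ℤ⟦X⟧) + X ^ 1 * (rankLeGF 1 + rankLeGF (1 + 1)) = overGF := by
    rw [overGF_eq_one_add]; ring
  rw [e] at h3
  have h4 := (hasEval_overGF hq).unique h3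
  rw [mul_add, mul_one, ← tsum_mul_left]
  rw [pow_one, ← tsum_mul_left] at h4
  have h5 : ∑' n : ℕ, overFun q * (2 * (-1) ^ (n + 1) * q ^ ((n + 1) ^ 2)) =
      - ∑' n : ℕ, q * (2 * overFun q * ((-1) ^ n * (q ^ (n * (n + 1)) * (q ^ n) ^ 1))) := by
    rw [← tsum_neg]
    refine tsum_congr fun n => ?_
    ring
  rw [h5]
  linear_combination h4

theorem one_sub_le_norm_one_add_pow {q : ℂ} (hq : ‖q‖ < 1) (n : ℕ) :
    1 - ‖q‖ ≤ ‖1 + q ^ (n + 1)‖ ∧ 1 - ‖q‖ ≤ ‖1 - q ^ (n + 1)‖ := by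
  have h : ‖q ^ (n + 1)‖ ≤ ‖q‖ := by
    rw [norm_pow]
    calc ‖q‖ ^ (n + 1) ≤ ‖q‖ ^ 1 := pow_le_pow_of_le_one (norm_nonneg q) hq.le (by omega)
      _ = ‖q‖ := pow_one _
  constructor
  · have := norm_sub_norm_le (1 : ℂ) (-q ^ (n + 1))
    rw [sub_neg_eq_add, norm_neg, norm_one] at this
    linarith
  · have := norm_sub_norm_le (1 : ℂ) (q ^ (n + 1))
    rw [norm_one] at this
    linarith

theorem norm_pow_mul_div_le {q : ℂ} (hq : ‖q‖ < 1) (c : ℂ) (e n m : ℕ) (hn : n ≤ e) :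
    ‖c * ((-1) ^ n * (q ^ e / (1 + q ^ (n + 1)) * (q ^ (n + 1)) ^ m))‖ ≤
      ‖c‖ / (1 - ‖q‖) * ‖q‖ ^ m * ‖q‖ ^ n := by
  have h0 := norm_nonneg q
  have h1 : 0 < 1 - ‖q‖ := by linarith
  rw [norm_mul, norm_mul, norm_mul, norm_div, norm_pow, norm_neg, norm_one, one_pow, one_mul,
    norm_pow, norm_pow, norm_pow]
  have h2 : ‖q‖ ^ e ≤ ‖q‖ ^ n := pow_le_pow_of_le_one h0 hq.le hn
  have h3 : (‖q‖ ^ (n + 1)) ^ m ≤ ‖q‖ ^ m := by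
    rw [← pow_mul]
    exact pow_le_pow_of_le_one h0 hq.le (Nat.le_mul_of_pos_left _ (by omega))
  have h4 := (one_sub_le_norm_one_add_pow hq n).1
  calc ‖c‖ * (‖q‖ ^ e / ‖1 + q ^ (n + 1)‖ * (‖q‖ ^ (n + 1)) ^ m)
      ≤ ‖c‖ * (‖q‖ ^ n / (1 - ‖q‖) * ‖q‖ ^ m) := by gcongr
    _ = _ := by ring

/-- Only sums of consecutive R_m are known so far. The defect d_m = P - R_m and the series T_m, got
by dividing the n-th term by 1 + q^{n+1}, have the same consecutive sums, and both tend to 0 as m →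
∞; this forces d_m = T_m. -/
theorem hasEval_rank_sub {q : ℂ} (hq : ‖q‖ < 1) (m : ℕ) :
    HasEval (rankLeGF (m + 1) - rankLeGF m) q
      (∑' n : ℕ, overFun q * (2 * (-1) ^ n * q ^ ((n + 1) * (n + 2)) * (1 - q ^ (n + 1)) /
        (1 + q ^ (n + 1))) * (q ^ (n + 1)) ^ m) := by
  have hE : ∀ m, HasEval (rankLeGF m) q
      (∑' n, ((PowerSeries.coeff n (rankLeGF m) : ℤ) : ℂ) * q ^ n) := fun m =>
    (summable_of_coeff_le hq (coeff_rankLeGF_nonneg m) (coeff_rankLeGF_le m)).hasSum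
  set e : ℕ → ℂ := fun m => ∑' n, ((PowerSeries.coeff n (rankLeGF m) : ℤ) : ℂ) * q ^ n with he
  have h1q : 0 < 1 - ‖q‖ := by linarith
  set T : ℕ → ℕ → ℂ := fun m n => 2 * overFun q * ((-1) ^ n *
    (q ^ ((n + 1) * (n + 2)) / (1 + q ^ (n + 1)) * (q ^ (n + 1)) ^ m)) with hT
  have hTb : ∀ m n, ‖T m n‖ ≤ ‖2 * overFun q‖ / (1 - ‖q‖) * ‖q‖ ^ m * ‖q‖ ^ n := fun m n =>
    norm_pow_mul_div_le hq _ _ n m (by nlinarith)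
  have hTs : ∀ m, Summable (T m) := fun m => Summable.of_norm_bounded
    ((summable_geometric_of_lt_one (norm_nonneg q) hq).mul_left _) (hTb m)
  have hne : ∀ n, 1 + q ^ (n + 1) ≠ 0 := fun n h => by
    have := (one_sub_le_norm_one_add_pow hq n).1
    rw [h, norm_zero] at this; linarith
  set d : ℕ → ℂ := fun m => overFun q - e m with hd
  have hdd : ∀ m, d m + d (m + 1) = ∑' n, T m n + ∑' n, T (m + 1) n := by
    intro m
    obtain ⟨h1, h2⟩ := hasSum_rankLeGF_add hq m
    have h3 := ((hE m).add (hE (m + 1))).unique h1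
    rw [h2.summable.tsum_eq_zero_add] at h3
    rw [← (hTs m).tsum_add (hTs (m + 1))]
    have h4 : ∑' n, (T m n + T (m + 1) n) = - ∑' n : ℕ, 2 * overFun q * ((-1) ^ (n + 1) *
        (q ^ ((n + 1) * (n + 1 + 1)) * (q ^ (n + 1)) ^ m)) := by
      rw [← tsum_neg]
      refine tsum_congr fun n => ?_
      simp only [hT]
      have := hne n
      field_simp
      ring
    rw [h4]
    simp only [hd]
    simp only [zero_mul, pow_zero, one_pow, mul_one] at h3
    linear_combination -h3
  have hd0 : Tendsto d atTop (𝓝 0) := by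
    have h1 : Tendsto e atTop (𝓝 (overFun q)) := by
      refine tendsto_tsum_of_dominated_convergence (summable_overGF (norm_nonneg q) hq) ?_ ?_
      · intro n
        apply tendsto_const_nhds.congr'
        filter_upwards [eventually_ge_atTop n] with M hM
        have : PowerSeries.coeff n (rankLeGF M) = PowerSeries.coeff n overGF := by
          rw [coeff_rankLeGF, Finset.filter_true_of_mem]
          · simp [overGF]
          · intro π _
            exact (rank_le π).trans (by exact_mod_cast hM)
        rw [this]
      · refine Eventually.of_forall fun L n => ?_
        rw [norm_mul, norm_pow]
        gcongr
        have h2 := coeff_rankLeGF_nonneg L n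
        have h3 := coeff_rankLeGF_le L n
        rw [Complex.norm_intCast, abs_of_nonneg (by exact_mod_cast h2)]
        exact_mod_cast h3
    have h2 := (tendsto_const_nhds (x := overFun q)).sub h1
    rwa [sub_self] at h2
  have hT0 : Tendsto (fun m => ∑' n, T m n) atTop (𝓝 0) := by
    have hlim : Tendsto (fun m => ‖2 * overFun q‖ / (1 - ‖q‖) * ‖q‖ ^ m * (1 - ‖q‖)⁻¹) atTop
        (𝓝 0) := by
      have := (tendsto_pow_atTop_nhds_zero_of_lt_one (norm_nonneg q) hq).const_mul
        (‖2 * overFun q‖ / (1 - ‖q‖))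
      simpa using this.mul_const (1 - ‖q‖)⁻¹
    refine squeeze_zero_norm (fun m => ?_) hlim
    refine tsum_of_norm_bounded ?_ (hTb m)
    exact (hasSum_geometric_of_lt_one (norm_nonneg q) hq).mul_left _
  have hall : ∀ m, d m = ∑' n, T m n := by
    intro m
    -- The difference changes only its sign from m to m + 1, so its modulus is constant in m while
    -- its limit is 0.
    have hz : ∀ k, d m - ∑' n, T m n = (-1) ^ k * (d (m + k) - ∑' n, T (m + k) n) := by
      intro k
      induction k with
      | zero => simp
      | succ k ih =>
        rw [ih, pow_succ, ← add_assoc]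
        linear_combination (-1) ^ k * hdd (m + k)
    have hlim : Tendsto (fun k => (-1) ^ k * (d (m + k) - ∑' n, T (m + k) n)) atTop (𝓝 0) := by
      have h1 := hd0.sub hT0
      rw [sub_zero] at h1
      have h2 := h1.comp (tendsto_add_atTop_nat m)
      rw [tendsto_zero_iff_norm_tendsto_zero] at h2 ⊢
      refine h2.congr fun k => ?_
      simp [add_comm]
    have : (fun k : ℕ => (-1) ^ k * (d (m + k) - ∑' n, T (m + k) n)) =
        fun _ => d m - ∑' n, T m n := funext fun k => (hz k).symm
    rw [this] at hlim
    exact sub_eq_zero.1 (tendsto_nhds_unique tendsto_const_nhds hlim)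
  have hfin := (hE (m + 1)).sub (hE m)
  convert! hfin using 1
  have h1 : e (m + 1) - e m = d m - d (m + 1) := by simp only [hd]; ring
  change _ = e (m + 1) - e m
  rw [h1, hall, hall, ← (hTs m).tsum_sub (hTs (m + 1))]
  refine tsum_congr fun n => ?_
  simp only [hT]
  have := hne n
  field_simp
  ring

end Overpart

/-! ### Generating functions of the moments -/

namespace Overpart

open PowerSeries Filter Topology

/-- For ρ < σ < 1 the polynomial factor is absorbed by (ρ/σ)^N, and the series converges at σ. -/
theorem summable_pow_mul_overGF (j k : ℕ) {ρ : ℝ} (h0 : 0 ≤ ρ) (h1 : ρ < 1) :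
    Summable fun N : ℕ => ((N : ℝ) + k) ^ j * (((PowerSeries.coeff N overGF : ℤ) : ℝ) * ρ ^ N) := by
  obtain ⟨σ, hσ0, hσ1⟩ := exists_between h1
  have hσpos : 0 < σ := lt_of_le_of_lt h0 hσ0
  have hs := summable_overGF hσpos.le hσ1
  have hlim : Tendsto (fun N : ℕ => ((N : ℝ) + k) ^ j * (ρ / σ) ^ N) atTop (𝓝 0) := by
    have hlt : |ρ / σ| < 1 := by
      rw [abs_of_nonneg (by positivity), div_lt_one hσpos]; exact hσ0
    have h2 : Tendsto (fun N : ℕ => (k + 1 : ℝ) ^ j * ((N : ℝ) ^ j * (ρ / σ) ^ N)) atTop (𝓝 0) := by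
      simpa using (tendsto_pow_const_mul_const_pow_of_abs_lt_one j hlt).const_mul ((k + 1 : ℝ) ^ j)
    refine squeeze_zero' (Eventually.of_forall fun N => by positivity) ?_ h2
    filter_upwards [eventually_ge_atTop 1] with N hN
    have hN' : (1 : ℝ) ≤ N := by exact_mod_cast hN
    rw [← mul_assoc, ← mul_pow]
    gcongr
    nlinarith [Nat.cast_nonneg (α := ℝ) k]
  refine summable_of_isBigO_nat hs ?_
  refine Asymptotics.IsBigO.of_bound 1 ?_
  filter_upwards [hlim.eventually (gt_mem_nhds (show (0 : ℝ) < 1 by norm_num))] with N hN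
  have hc : (0 : ℝ) ≤ ((PowerSeries.coeff N overGF : ℤ) : ℝ) := by
    exact_mod_cast coeff_overGF_nonneg N
  rw [Real.norm_of_nonneg (by positivity), Real.norm_of_nonneg (by positivity), one_mul]
  calc ((N : ℝ) + k) ^ j * (((PowerSeries.coeff N overGF : ℤ) : ℝ) * ρ ^ N)
      = (((PowerSeries.coeff N overGF : ℤ) : ℝ) * σ ^ N) * (((N : ℝ) + k) ^ j * (ρ / σ) ^ N) := by
        rw [div_pow]; field_simp
    _ ≤ (((PowerSeries.coeff N overGF : ℤ) : ℝ) * σ ^ N) * 1 := by gcongr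
    _ = _ := mul_one _

/-- The first r - 1 - ⌊(r-1)/2⌋ binomial coefficients vanish; after them the series is the binomial
series of 1/(1 - x)^{r+1}. -/
theorem hasSum_choose_mul_pow {r : ℕ} (hr : 1 ≤ r) {x : ℂ} (hx : ‖x‖ < 1) :
    HasSum (fun m : ℕ => ((m + 1 + (r - 1) / 2).choose r : ℂ) * x ^ m)
      (x ^ (r - 1 - (r - 1) / 2) / (1 - x) ^ (r + 1)) := by
  set s := r - 1 - (r - 1) / 2 with hs
  have hsk : s + (1 + (r - 1) / 2) = r := by omega
  rw [← (add_left_injective s).hasSum_iff]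
  · have h := (hasSum_choose_mul_geometric_of_norm_lt_one r hx).mul_left (x ^ s)
    rw [mul_one_div] at h
    convert! h using 2 with m
    simp only [Function.comp]
    rw [show m + s + 1 + (r - 1) / 2 = m + r by omega]
    ring
  · intro m hm
    have : m < s := by
      by_contra hcon
      exact hm ⟨m - s, Nat.sub_add_cancel (by omega)⟩
    rw [Nat.choose_eq_zero_of_lt (by omega)]
    simp

/-- The generating function of positive symmetrized moments of a family of counts whose generating
functions are geometric expansions. -/
theorem hasSum_posSymMoment {b : ℤ → ℕ → ℤ} (hvan : ∀ (m : ℤ) (n : ℕ), (n : ℤ) < m → b m n = 0)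
    (hb : ∀ m n : ℕ, |b ((m + 1 : ℕ) : ℤ) n| ≤ PowerSeries.coeff n overGF)
    {q : ℂ} (hq : ‖q‖ < 1) {β : ℕ → ℂ} {K : ℝ} (hβ : ∀ n, ‖β n‖ ≤ K * ‖q‖ ^ n)
    (h : ∀ m : ℕ, HasSum (fun n => (b ((m + 1 : ℕ) : ℤ) n : ℂ) * q ^ n)
      (∑' n, overFun q * β n * (q ^ (n + 1)) ^ m)) {r : ℕ} (hr : 1 ≤ r) :
    HasSum (fun N => (posSymMoment b r N : ℂ) * q ^ N)
      (overFun q * ∑' n, β n * ((q ^ (n + 1)) ^ (r - 1 - (r - 1) / 2) /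
        (1 - q ^ (n + 1)) ^ (r + 1))) := by
  set k := (r - 1) / 2 with hk
  set w : ℕ → ℂ := fun m => ((m + 1 + k).choose r : ℂ) with hw
  have hq0 := norm_nonneg q
  -- the double family over `(N, m)`
  set F : ℕ × ℕ → ℂ := fun p => w p.2 * ((b ((p.2 + 1 : ℕ) : ℤ) p.1 : ℂ) * q ^ p.1) with hF
  have hFz : ∀ N m, m ∉ Finset.range N → F (N, m) = 0 := by
    intro N m hm
    simp only [Finset.mem_range, not_lt] at hm
    simp only [hF]
    rw [hvan _ _ (by push_cast; omega)]
    simp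
  have hFb : ∀ N m, m ∈ Finset.range N → ‖F (N, m)‖ ≤
      ((N : ℝ) + k) ^ r * (((PowerSeries.coeff N overGF : ℤ) : ℝ) * ‖q‖ ^ N) := by
    intro N m hm
    rw [Finset.mem_range] at hm
    simp only [hF, hw, norm_mul, norm_pow, Complex.norm_natCast]
    have h1 : ((m + 1 + k).choose r : ℝ) ≤ ((N : ℝ) + k) ^ r := by
      have h2 : (m + 1 + k).choose r ≤ (N + k) ^ r :=
        (Nat.choose_le_pow _ _).trans (Nat.pow_le_pow_left (by omega) r)
      exact_mod_cast h2
    have h3 : ‖(b ((m + 1 : ℕ) : ℤ) N : ℂ)‖ ≤ ((PowerSeries.coeff N overGF : ℤ) : ℝ) := by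
      rw [Complex.norm_intCast]
      exact_mod_cast hb m N
    gcongr
  have hFs : Summable F := by
    apply Summable.of_norm
    rw [summable_prod_of_nonneg (fun _ => norm_nonneg _)]
    have hfib : ∀ N, HasSum (fun m => ‖F (N, m)‖) (∑ m ∈ Finset.range N, ‖F (N, m)‖) := fun N =>
      hasSum_sum_of_ne_finset_zero fun m hm => by rw [hFz N m hm, norm_zero]
    refine ⟨fun N => (hfib N).summable, ?_⟩
    refine Summable.of_nonneg_of_le (fun N => tsum_nonneg fun _ => norm_nonneg _) (fun N => ?_)
      (summable_pow_mul_overGF (r + 1) k hq0 hq)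
    rw [(hfib N).tsum_eq]
    refine (Finset.sum_le_card_nsmul _ _ _ (hFb N)).trans ?_
    rw [Finset.card_range, nsmul_eq_mul, pow_succ]
    have hc : (0 : ℝ) ≤ ((PowerSeries.coeff N overGF : ℤ) : ℝ) := by
      exact_mod_cast coeff_overGF_nonneg N
    have : (N : ℝ) ≤ N + k := by linarith [Nat.cast_nonneg (α := ℝ) k]
    calc (N : ℝ) * (((N : ℝ) + k) ^ r * (((PowerSeries.coeff N overGF : ℤ) : ℝ) * ‖q‖ ^ N))
        ≤ ((N : ℝ) + k) * (((N : ℝ) + k) ^ r *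
          (((PowerSeries.coeff N overGF : ℤ) : ℝ) * ‖q‖ ^ N)) := by gcongr
      _ = _ := by ring
  have hT := hFs.hasSum
  set T := ∑' p, F p
  -- Summing the double family first over m gives the moments; summing it first over N gives, in
  -- `hm`, the values of the generating functions of fixed m.
  have hN : HasSum (fun N => (posSymMoment b r N : ℂ) * q ^ N) T := by
    refine hT.prod_fiberwise fun N => ?_
    have h1 : HasSum (fun m => F (N, m)) (∑ m ∈ Finset.range N, F (N, m)) :=
      hasSum_sum_of_ne_finset_zero (hFz N)
    convert! h1 using 1
    have hI : ∀ f : ℕ → ℝ, ∑ m ∈ Finset.Icc 1 N, f m = ∑ m ∈ Finset.range N, f (m + 1) := by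
      intro f
      rw [Finset.range_eq_Ico, Finset.sum_Ico_add' f 0 N 1]
      refine Finset.sum_congr ?_ fun _ _ => rfl
      ext; simp
    rw [posSymMoment, hI]
    push_cast
    rw [Finset.sum_mul]
    refine Finset.sum_congr rfl fun m _ => ?_
    simp only [hF, hw]
    push_cast
    ring
  have hm : HasSum (fun m => w m * ∑' n, overFun q * β n * (q ^ (n + 1)) ^ m) T := by
    have hT' : HasSum (F ∘ Prod.swap) T := (Equiv.prodComm ℕ ℕ).hasSum_iff.2 hT
    exact hT'.prod_fiberwise fun m => (h m).mul_left (w m)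
  -- the double family over `(m, n)`
  set G : ℕ × ℕ → ℂ := fun p => w p.1 * (overFun q * β p.2 * (q ^ (p.2 + 1)) ^ p.1) with hG
  have hK : 0 ≤ K := by
    have := (norm_nonneg _).trans (hβ 0)
    simpa using this
  have hGb : ∀ m n, ‖overFun q * β n * (q ^ (n + 1)) ^ m‖ ≤
      ‖overFun q‖ * K * ‖q‖ ^ n * ‖q‖ ^ m := by
    intro m n
    rw [norm_mul, norm_mul, norm_pow, norm_pow]
    have h3 : (‖q‖ ^ (n + 1)) ^ m ≤ ‖q‖ ^ m := by
      rw [← pow_mul]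
      exact pow_le_pow_of_le_one hq0 hq.le (Nat.le_mul_of_pos_left _ (by omega))
    have h4 := hβ n
    calc ‖overFun q‖ * ‖β n‖ * (‖q‖ ^ (n + 1)) ^ m
        ≤ ‖overFun q‖ * (K * ‖q‖ ^ n) * ‖q‖ ^ m := by gcongr
      _ = _ := by ring
  have hws : Summable fun m : ℕ => ‖w m * q ^ m‖ := (hasSum_choose_mul_pow hr hq).summable.norm
  have hgs : Summable fun n : ℕ => ‖overFun q‖ * K * ‖q‖ ^ n :=
    (summable_geometric_of_lt_one hq0 hq).mul_left _
  have hGs : Summable G := by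
    refine Summable.of_norm_bounded (hws.mul_of_nonneg hgs (fun _ => norm_nonneg _)
      (fun _ => by positivity)) ?_
    rintro ⟨m, n⟩
    simp only [hG]
    rw [norm_mul (w m)]
    calc ‖w m‖ * ‖overFun q * β n * (q ^ (n + 1)) ^ m‖
        ≤ ‖w m‖ * (‖overFun q‖ * K * ‖q‖ ^ n * ‖q‖ ^ m) := by gcongr; exact hGb m n
      _ = ‖w m * q ^ m‖ * (‖overFun q‖ * K * ‖q‖ ^ n) := by rw [norm_mul, norm_pow]; ring
  have hGt := hGs.hasSum
  have hbs : ∀ m, Summable fun n => overFun q * β n * (q ^ (n + 1)) ^ m := fun m =>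
    Summable.of_norm_bounded (hgs.mul_right (‖q‖ ^ m)) (hGb m)
  have h1 : HasSum (fun m => w m * ∑' n, overFun q * β n * (q ^ (n + 1)) ^ m) (∑' p, G p) :=
    hGt.prod_fiberwise fun m => (hbs m).hasSum.mul_left (w m)
  have h2 : HasSum (fun n => overFun q * (β n * ((q ^ (n + 1)) ^ (r - 1 - (r - 1) / 2) /
        (1 - q ^ (n + 1)) ^ (r + 1)))) (∑' p, G p) := by
    have hGt' : HasSum (G ∘ Prod.swap) (∑' p, G p) := (Equiv.prodComm ℕ ℕ).hasSum_iff.2 hGt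
    refine hGt'.prod_fiberwise fun n => ?_
    have hx : ‖q ^ (n + 1)‖ < 1 := by
      rw [norm_pow]; exact pow_lt_one₀ hq0 hq (by omega)
    have h3 := (hasSum_choose_mul_pow hr hx).mul_left (overFun q * β n)
    rw [← mul_assoc]
    convert! h3 using 2 with m
    simp only [hG, hw, Function.comp, Prod.swap]
    ring
  rw [hm.unique h1, ← h2.tsum_eq, tsum_mul_left] at hN
  exact hN

/-- The cofactor of the overpartition function in the generating function of crank moments. -/
noncomputable def crankCofactor (r : ℕ) (q : ℂ) : ℂ :=
  ∑' n : ℕ, (-1) ^ n * (q ^ (n + 2).choose 2 * (q ^ (n + 1)) ^ (r - 1 - (r - 1) / 2) /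
    (1 - q ^ (n + 1)) ^ r)

/-- The cofactor of the overpartition function in the generating function of rank moments. -/
noncomputable def rankCofactor (r : ℕ) (q : ℂ) : ℂ :=
  ∑' n : ℕ, (-1) ^ n * (2 * q ^ ((n + 1) * (n + 2)) * (q ^ (n + 1)) ^ (r - 1 - (r - 1) / 2) /
    ((1 + q ^ (n + 1)) * (1 - q ^ (n + 1)) ^ r))

theorem one_sub_pow_ne_zero {q : ℂ} (hq : ‖q‖ < 1) (n : ℕ) : 1 - q ^ (n + 1) ≠ 0 := fun h => by
  have := (one_sub_le_norm_one_add_pow hq n).2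
  rw [h, norm_zero] at this; linarith

theorem norm_one_sub_pow_le {q : ℂ} (hq : ‖q‖ < 1) (n : ℕ) : ‖1 - q ^ n‖ ≤ 2 := by
  have h1 : ‖q ^ n‖ ≤ 1 := by rw [norm_pow]; exact pow_le_one₀ (norm_nonneg q) hq.le
  calc ‖1 - q ^ n‖ ≤ ‖(1 : ℂ)‖ + ‖q ^ n‖ := norm_sub_le _ _
    _ ≤ 2 := by rw [norm_one]; linarith

/-- The factor 1 - q^{n+1} in the series of the crank counts cancels one of the r + 1 factors in the
denominator of the binomial series. -/
theorem hasSum_muPlus {r : ℕ} (hr : 1 ≤ r) {q : ℂ} (hq : ‖q‖ < 1) :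
    HasSum (fun N => (muPlus r N : ℂ) * q ^ N) (overFun q * crankCofactor r q) := by
  have h := hasSum_posSymMoment (b := crankCountConv) (q := q) (r := r)
    (β := fun n => (-1) ^ n * q ^ (n + 2).choose 2 * (1 - q ^ (n + 1))) (K := 2)
    (fun m n h => crankCountConv_eq_zero h) ?_ hq ?_ ?_ hr
  · convert! h using 2
    refine tsum_congr fun n => ?_
    have := one_sub_pow_ne_zero hq n
    field_simp
    ring
  · intro m n
    rw [crankCountConv_succ, abs_le]
    have h1 := coeff_crankGF_nonneg m n
    have h2 := coeff_crankGF_nonneg (m + 1) n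
    have h3 := coeff_crankGF_le m n
    have h4 := coeff_crankGF_le (m + 1) n
    constructor <;> linarith
  · intro n
    rw [norm_mul, norm_mul, norm_pow, norm_neg, norm_one, one_pow, one_mul, norm_pow, mul_comm]
    have h1 : ‖q‖ ^ (n + 2).choose 2 ≤ ‖q‖ ^ n := by
      apply pow_le_pow_of_le_one (norm_nonneg q) hq.le
      rw [Nat.choose_succ_succ' (n + 1) 1, Nat.choose_one_right]; omega
    have h2 := norm_one_sub_pow_le hq (n + 1)
    gcongr
  · intro m
    have := hasEval_crank_sub hq m
    unfold HasEval at this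
    convert! this using 3 with n
    rw [crankCountConv_succ, map_sub]

theorem hasSum_etaPlus {r : ℕ} (hr : 1 ≤ r) {q : ℂ} (hq : ‖q‖ < 1) :
    HasSum (fun N => (etaPlus r N : ℂ) * q ^ N) (overFun q * rankCofactor r q) := by
  have h := hasSum_posSymMoment (b := rankCount) (q := q) (r := r)
    (β := fun n => 2 * (-1) ^ n * q ^ ((n + 1) * (n + 2)) * (1 - q ^ (n + 1)) /
        (1 + q ^ (n + 1))) (K := 4 / (1 - ‖q‖))
    (fun m n h => rankCount_eq_zero h) ?_ hq ?_ ?_ hr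
  · convert! h using 2
    refine tsum_congr fun n => ?_
    have := one_sub_pow_ne_zero hq n
    have : 1 + q ^ (n + 1) ≠ 0 := fun h => by
      have := (one_sub_le_norm_one_add_pow hq n).1
      rw [h, norm_zero] at this; linarith
    field_simp
    ring
  · intro m n
    rw [rankCount_succ, abs_le]
    have h1 := coeff_rankLeGF_nonneg m n
    have h2 := coeff_rankLeGF_nonneg (m + 1) n
    have h3 := coeff_rankLeGF_le m n
    have h4 := coeff_rankLeGF_le (m + 1) n
    constructor <;> linarith
  · intro n
    rw [norm_div, norm_mul, norm_mul, norm_mul, norm_pow, norm_neg, norm_one, one_pow, mul_one,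
      norm_pow, Complex.norm_ofNat]
    have h1 : ‖q‖ ^ ((n + 1) * (n + 2)) ≤ ‖q‖ ^ n := by
      apply pow_le_pow_of_le_one (norm_nonneg q) hq.le
      nlinarith
    have h2 := norm_one_sub_pow_le hq (n + 1)
    have h3 := (one_sub_le_norm_one_add_pow hq n).1
    have h4 : 0 < 1 - ‖q‖ := by linarith
    calc 2 * ‖q‖ ^ ((n + 1) * (n + 2)) * ‖1 - q ^ (n + 1)‖ / ‖1 + q ^ (n + 1)‖
        ≤ 2 * ‖q‖ ^ n * 2 / (1 - ‖q‖) := by gcongr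
      _ = _ := by ring
  · intro m
    have := hasEval_rank_sub hq m
    unfold HasEval at this
    convert! this using 3 with n
    rw [rankCount_succ, map_sub]

/-! The literal count. -/

/-- The generating function of partitions into distinct parts, all at most `L`. -/
noncomputable def distinctLeGF (L : ℕ) : ℤ⟦X⟧ :=
  Nat.Partition.genFun (fun i c => if c = 1 ∧ i ≤ L then (1 : ℤ) else 0)

theorem coeff_distinctLeGF (L n : ℕ) : PowerSeries.coeff n (distinctLeGF L) =
    ((Finset.univ.filter fun p : n.Partition =>
      ∀ x ∈ p.parts, p.parts.count x = 1 ∧ x ≤ L).card : ℤ) := by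
  classical
  rw [distinctLeGF, Nat.Partition.coeff_genFun, Finset.card_filter, Nat.cast_sum]
  refine Finset.sum_congr rfl fun p _ => ?_
  rw [Finsupp.prod, Finset.prod_ite_zero]
  simp

theorem coeff_distinctGF_eq {L n : ℕ} (h : n ≤ L) :
    PowerSeries.coeff n distinctGF = PowerSeries.coeff n (distinctLeGF L) := by
  rw [coeff_distinctLeGF, distinctGF, PowerSeries.coeff_mk, Nat.Partition.distincts]
  congr 2
  ext p
  rw [Finset.mem_filter, Finset.mem_filter]
  simp only [Finset.mem_univ, true_and, Multiset.nodup_iff_count_le_one]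
  constructor
  · intro h1 x hx
    exact ⟨le_antisymm (h1 x) (Multiset.one_le_count_iff_mem.2 hx), (p.le_of_mem_parts hx).trans h⟩
  · intro h1 x
    by_cases hx : x ∈ p.parts
    · exact (h1 x hx).1.le
    · rw [Multiset.count_eq_zero_of_notMem hx]; exact zero_le_one

theorem distinctLeGF_succ (L : ℕ) :
    distinctLeGF (L + 1) = (1 + X ^ (L + 1)) * distinctLeGF L := by
  rw [distinctLeGF, distinctLeGF]
  rw [← one_mul (Nat.Partition.genFun fun i c => if c = 1 ∧ i ≤ L + 1 then _ else _)]
  apply genFun_congr_off (i := L + 1) (by omega)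
  · intro i hi
    funext c
    congr 1
    apply propext; omega
  · have h := one_sub_mul_localFactor (f := fun i c => if c = 1 ∧ i ≤ L + 1 then (1 : ℤ) else 0)
      (i := L + 1) (a := 0) (b := 1) (by omega) (by simp) (by simp)
    rw [localFactor_of_eq_zero (f := fun i c => if c = 1 ∧ i ≤ L then (1 : ℤ) else 0)
      (by omega : 1 ≤ L + 1) (by simp)]
    simpa using h

theorem sum_coeff_distinctLeGF_le {r : ℝ} (hr0 : 0 ≤ r) (hr1 : r < 1) (L N : ℕ) :
    ∑ n ∈ Finset.range N, ((PowerSeries.coeff n (distinctLeGF L) : ℤ) : ℝ) * r ^ n ≤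
      Real.exp (∑ i ∈ Finset.range L, r ^ (i + 1)) := by
  have hnn : ∀ L n, 0 ≤ PowerSeries.coeff n (distinctLeGF L) := fun L n => by
    rw [coeff_distinctLeGF]; positivity
  induction L generalizing N with
  | zero =>
    have : distinctLeGF 0 = 1 := by
      apply genFun_eq_one
      intro i c hi _
      rw [if_neg (by omega)]
    rw [this]
    simpa using sum_coeff_one_le (r := r) N
  | succ L ih =>
    have h := sum_coeff_le_of_euler (A := distinctLeGF (L + 1)) (B := distinctLeGF L) (k := L + 1) 0
      (by omega) (by simpa using distinctLeGF_succ L) zero_le_one (hnn _) (hnn _) hr0 hr1 ih N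
    refine h.trans ?_
    rw [Finset.sum_range_succ, Real.exp_add, mul_comm, Nat.cast_zero, zero_mul, sub_zero, div_one]
    gcongr
    rw [add_comm]
    exact Real.add_one_le_exp _

/-- A single coefficient is bounded by the product of 1 + e^{-ix}, hence by the exponential of Σ
e^{-ix} = 1/(e^x - 1) ≤ 1/x. With x = 1/√n this gives exp(2√n), and an exponent constant below π is
all that is needed. -/
theorem coeff_distinctGF_le (n : ℕ) {x : ℝ} (hx : 0 < x) :
    ((PowerSeries.coeff n distinctGF : ℤ) : ℝ) ≤ Real.exp (n * x + 1 / x) := by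
  have hr1 : Real.exp (-x) < 1 := by rw [Real.exp_lt_one_iff]; linarith
  have hr0 := (Real.exp_pos (-x)).le
  have h := sum_coeff_distinctLeGF_le hr0 hr1 n (n + 1)
  have h1 : ((PowerSeries.coeff n (distinctLeGF n) : ℤ) : ℝ) * Real.exp (-x) ^ n ≤
      ∑ k ∈ Finset.range (n + 1),
        ((PowerSeries.coeff k (distinctLeGF n) : ℤ) : ℝ) * Real.exp (-x) ^ k := by
    refine Finset.single_le_sum (f := fun k =>
      ((PowerSeries.coeff k (distinctLeGF n) : ℤ) : ℝ) * Real.exp (-x) ^ k) (fun k _ => ?_)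
      (Finset.self_mem_range_succ n)
    have : 0 ≤ PowerSeries.coeff k (distinctLeGF n) := by rw [coeff_distinctLeGF]; positivity
    have : (0 : ℝ) ≤ ((PowerSeries.coeff k (distinctLeGF n) : ℤ) : ℝ) := by exact_mod_cast this
    positivity
  have h2 : ∑ i ∈ Finset.range n, Real.exp (-x) ^ (i + 1) ≤ 1 / x := by
    have h3 : ∑ i ∈ Finset.range n, Real.exp (-x) ^ (i + 1) =
        Real.exp (-x) * ∑ i ∈ Finset.range n, Real.exp (-x) ^ i := by
      rw [Finset.mul_sum]; exact Finset.sum_congr rfl fun i _ => by ring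
    have h4 : ∑ i ∈ Finset.range n, Real.exp (-x) ^ i ≤ (1 - Real.exp (-x))⁻¹ := by
      rw [← tsum_geometric_of_lt_one hr0 hr1]
      exact (summable_geometric_of_lt_one hr0 hr1).sum_le_tsum _ fun i _ => pow_nonneg hr0 i
    rw [h3]
    calc Real.exp (-x) * ∑ i ∈ Finset.range n, Real.exp (-x) ^ i
        ≤ Real.exp (-x) * (1 - Real.exp (-x))⁻¹ := by gcongr
      _ = 1 / (Real.exp x - 1) := by
        have h5 : Real.exp x * Real.exp (-x) = 1 := by rw [← Real.exp_add]; simp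
        have h6 : 1 - Real.exp (-x) ≠ 0 := by linarith
        have h7 : Real.exp x - 1 ≠ 0 := by
          have := Real.add_one_lt_exp hx.ne'
          linarith
        field_simp
        linear_combination h5
      _ ≤ 1 / x := by
        have := Real.add_one_le_exp x
        gcongr
        linarith
  rw [coeff_distinctGF_eq le_rfl]
  have h3 := (h1.trans h).trans (Real.exp_le_exp.2 h2)
  rw [Real.exp_add, mul_comm (Real.exp _)]
  rw [← Real.exp_nat_mul, mul_neg, Real.exp_neg, ← div_eq_mul_inv,
    div_le_iff₀ (Real.exp_pos _)] at h3
  exact h3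

/-- The two counts differ for positive m only at m = 1, where the difference is the number of
partitions of N into distinct parts. -/
theorem abs_muPlus_sub_literal_le (r N : ℕ) :
    |muPlus r (N + 1) - muPlusLiteral r (N + 1)| ≤
      (1 + (r - 1) / 2).choose r * Real.exp (2 * Real.sqrt N) := by
  have h : muPlus r (N + 1) - muPlusLiteral r (N + 1) =
      ((1 + (r - 1) / 2).choose r : ℝ) * ((PowerSeries.coeff N distinctGF : ℤ) : ℝ) := by
    rw [muPlus, muPlusLiteral, posSymMoment, posSymMoment, ← Finset.sum_sub_distrib,
      Finset.sum_eq_single 1]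
    · have := crankCountConv_sub_crankCount 0 N
      simp only [zero_add, if_true] at this
      rw [← mul_sub, ← this]
      push_cast; rfl
    · intro m hm hm1
      rw [Finset.mem_Icc] at hm
      obtain ⟨m, rfl⟩ : ∃ l, m = l + 1 := ⟨m - 1, by omega⟩
      have := crankCountConv_sub_crankCount m N
      rw [if_neg (by omega)] at this
      rw [← mul_sub]
      have h2 : (crankCountConv ((m + 1 : ℕ) : ℤ) (N + 1) : ℝ) -
          (crankCount ((m + 1 : ℕ) : ℤ) (N + 1) : ℝ) = 0 := by exact_mod_cast this
      rw [h2, mul_zero]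
    · intro h; simp at h
  have h0 : (0 : ℝ) ≤ ((PowerSeries.coeff N distinctGF : ℤ) : ℝ) := by
    rw [distinctGF, PowerSeries.coeff_mk]; positivity
  rw [h, abs_of_nonneg (by positivity)]
  gcongr
  rcases Nat.eq_zero_or_pos N with rfl | hN
  · have := coeff_distinctGF_eq (le_refl 0)
    rw [this, coeff_distinctLeGF]
    simp only [Nat.cast_zero, Real.sqrt_zero, mul_zero, Real.exp_zero]
    have : (Finset.univ.filter fun p : Nat.Partition 0 =>
      ∀ x ∈ p.parts, p.parts.count x = 1 ∧ x ≤ 0).card ≤ 1 :=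
      Finset.card_le_one.2 fun a _ b _ => Subsingleton.elim a b
    exact_mod_cast this
  · have hs : 0 < Real.sqrt N := Real.sqrt_pos.2 (by exact_mod_cast hN)
    have := coeff_distinctGF_le N (x := 1 / Real.sqrt N) (by positivity)
    refine this.trans (Real.exp_le_exp.2 (le_of_eq ?_))
    have h2 : Real.sqrt N * Real.sqrt N = N := Real.mul_self_sqrt (Nat.cast_nonneg N)
    field_simp
    linarith

end Overpart

/-! ### Behaviour of P(exp(-t)) as t → 0 -/

namespace Overpart

open Filter Topology Complex

/-- The argument 1/2 of the theta function produces the signs (-1)^n, and τ = it/π turns the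
Gaussian factor into exp(-n²t). The terms n and -n are paired. -/
theorem hasSum_theta_sq {t : ℂ} (ht : 0 < t.re) :
    1 + ∑' n : ℕ, 2 * (-1) ^ (n + 1) * cexp (-t) ^ ((n + 1) ^ 2) =
      jacobiTheta₂ (1 / 2) (I * t / Real.pi) := by
  have him : 0 < (I * t / (Real.pi : ℂ)).im := by
    rw [Complex.div_ofReal_im]
    simpa using div_pos ht Real.pi_pos
  have hpi : (Real.pi : ℂ) ≠ 0 := by exact_mod_cast Real.pi_ne_zero
  have hterm : ∀ n : ℤ, jacobiTheta₂_term n (1 / 2) (I * t / Real.pi) =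
      (-1) ^ n * cexp (-((n : ℂ) ^ 2 * t)) := by
    intro n
    rw [jacobiTheta₂_term, Complex.exp_add]
    congr 1
    · rw [← Complex.exp_pi_mul_I, ← Complex.exp_int_mul]
      congr 1; ring
    · congr 1
      have h : (Real.pi : ℂ) * I * (n : ℂ) ^ 2 * (I * t / Real.pi) = I * I * ((n : ℂ) ^ 2 * t) := by
        field_simp
      rw [h, I_mul_I]; ring
  have h := hasSum_jacobiTheta₂_term (1 / 2) him
  simp_rw [hterm] at h
  have h2 := h.nat_add_neg
  rw [← hasSum_nat_add_iff' 1] at h2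
  have h3 : HasSum (fun n : ℕ => 2 * (-1) ^ (n + 1) * cexp (-t) ^ ((n + 1) ^ 2))
      (jacobiTheta₂ (1 / 2) (I * t / Real.pi) - 1) := by
    convert! h2 using 1
    · funext n
      have e1 : ((-1 : ℂ)) ^ (-((n + 1 : ℕ) : ℤ)) = (-1) ^ (n + 1) := by
        rw [zpow_neg, zpow_natCast, ← inv_pow]; norm_num
      rw [e1, zpow_natCast, ← Complex.exp_nat_mul]
      push_cast
      rw [show ((n : ℂ) + 1) ^ 2 * -t = -(((n : ℂ) + 1) ^ 2 * t) by ring,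
        show (-((n : ℂ) + 1)) ^ 2 = ((n : ℂ) + 1) ^ 2 by ring]
      ring
    · simp
  rw [h3.tsum_eq]; ring

/-- Gauss's identity combined with the theta inversion τ ↦ -1/τ. The transformed exponents are -π²(n
- 1/2)²/t; the common -π²/(4t) is taken out and leaves -π²n(n - 1)/t. -/
theorem overFun_exp_mul {t : ℂ} (ht : 0 < t.re) :
    overFun (cexp (-t)) * (1 / (t / Real.pi) ^ (1 / 2 : ℂ) * cexp (-(Real.pi ^ 2 / 4 / t)) *
      (2 * (1 + ∑' n : ℕ, cexp (-(Real.pi ^ 2 * ((n + 1) * (n + 2)) / t))))) = 1 := by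
  have hq : ‖cexp (-t)‖ < 1 := by
    rw [Complex.norm_exp]; simpa using ht
  have ht0 : t ≠ 0 := by rintro rfl; simp at ht
  have hpi : (Real.pi : ℂ) ≠ 0 := by exact_mod_cast Real.pi_ne_zero
  have him : 0 < (-1 / (I * t / (Real.pi : ℂ))).im := by
    have : -1 / (I * t / (Real.pi : ℂ)) = (Real.pi : ℂ) * (I * t⁻¹) := by
      field_simp; rw [I_sq]
    rw [this, Complex.im_ofReal_mul]
    have h : 0 < (t⁻¹).re := by
      rw [Complex.inv_re]; exact div_pos ht (Complex.normSq_pos.2 ht0)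
    simpa using mul_pos Real.pi_pos h
  refine Eq.trans ?_ (overFun_mul_theta hq)
  rw [hasSum_theta_sq ht, jacobiTheta₂_functional_equation]
  congr 1
  have e1 : -I * (I * t / (Real.pi : ℂ)) = t / Real.pi := by
    rw [show -I * (I * t / (Real.pi : ℂ)) = -(I * I) * (t / Real.pi) by ring, I_mul_I]; ring
  have e2 : -(Real.pi : ℂ) * I * (1 / 2) ^ 2 / (I * t / Real.pi) = -(Real.pi ^ 2 / 4 / t) := by
    field_simp; norm_num
  rw [e1, e2]
  congr 1
  have hs := hasSum_jacobiTheta₂_term (1 / 2 / (I * t / Real.pi)) him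
  have hterm : ∀ n : ℤ, jacobiTheta₂_term n (1 / 2 / (I * t / Real.pi)) (-1 / (I * t / Real.pi)) =
      cexp (-(Real.pi ^ 2 * ((n : ℂ) * (n - 1)) / t)) := by
    intro n
    rw [jacobiTheta₂_term]
    congr 1
    field_simp
    ring
  simp_rw [hterm] at hs
  -- The terms are symmetric under n ↦ 1 - n, whence the factor 2; n = 0 and n = 1 both give 1.
  rw [← hs.tsum_eq, tsum_of_nat_of_neg_add_one]
  · have hs2 : Summable fun n : ℕ => cexp (-(Real.pi ^ 2 * ((n : ℂ) * (n - 1)) / t)) := by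
      have := hs.summable.comp_injective (Nat.cast_injective (R := ℤ))
      simpa [Function.comp_def] using this
    have e0 : ∑' n : ℕ, cexp (-(Real.pi ^ 2 * ((((n : ℤ) : ℂ)) * (((n : ℤ) : ℂ) - 1)) / t)) =
        ∑' n : ℕ, cexp (-(Real.pi ^ 2 * ((n : ℂ) * (n - 1)) / t)) := by simp
    rw [e0, ← hs2.sum_add_tsum_nat_add 2]
    have hs3 := (summable_nat_add_iff 2).2 hs2
    have e3 : (fun n : ℕ => cexp (-(Real.pi ^ 2 * (((n + 2 : ℕ) : ℂ) * ((n + 2 : ℕ) - 1)) / t))) =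
        fun n : ℕ => cexp (-(Real.pi ^ 2 * ((n + 1) * (n + 2)) / t)) := by
      funext n; congr 1; push_cast; ring
    have e4 : (fun n : ℕ => cexp (-(Real.pi ^ 2 * (((-((n : ℤ) + 1) : ℤ) : ℂ) *
        (((-((n : ℤ) + 1) : ℤ) : ℂ) - 1)) / t))) =
        fun n : ℕ => cexp (-(Real.pi ^ 2 * ((n + 1) * (n + 2)) / t)) := by
      funext n; congr 1; push_cast; ring
    rw [e3, e4]
    simp [Finset.sum_range_succ]
    ring
  · have := hs.summable.comp_injective (Nat.cast_injective (R := ℤ))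
    simpa [Function.comp_def] using this
  · have := hs.summable.comp_injective
      (i := fun n : ℕ => -((n : ℤ) + 1)) (fun a b h => by simpa using h)
    simpa [Function.comp_def] using this

/-- The sum is exponentially small, since Re(1/t) ≥ 1/(2|t|) in the cone. Only a quadratic bound is
needed, and it follows from e^a - 1 ≥ a²/2 with a ≥ 9/|t|. -/
theorem norm_tsum_exp_le {t : ℂ} (ht : 0 < t.re) (him : |t.im| ≤ t.re / 4) :
    ‖∑' n : ℕ, cexp (-(Real.pi ^ 2 * ((n + 1) * (n + 2)) / t))‖ ≤ ‖t‖ ^ 2 / 2 := by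
  have ht0 : t ≠ 0 := by rintro rfl; simp at ht
  have htn : 0 < ‖t‖ := norm_pos_iff.2 ht0
  have hnle : ‖t‖ ≤ 2 * t.re := by
    refine (Complex.norm_le_abs_re_add_abs_im t).trans ?_
    rw [abs_of_pos ht]; linarith
  set b := (t⁻¹).re with hb
  have hb1 : 1 / (2 * ‖t‖) ≤ b := by
    rw [hb, Complex.inv_re, Complex.normSq_eq_norm_sq, div_le_div_iff₀ (by positivity) (by positivity)]
    nlinarith
  have hb0 : 0 < b := lt_of_lt_of_le (by positivity) hb1
  have hpi2 : (9 : ℝ) ≤ Real.pi ^ 2 := by nlinarith [Real.pi_gt_three]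
  set a := 2 * Real.pi ^ 2 * b with ha
  have ha1 : 9 / ‖t‖ ≤ a := by
    calc 9 / ‖t‖ = 2 * 9 * (1 / (2 * ‖t‖)) := by field_simp
      _ ≤ 2 * Real.pi ^ 2 * b := by gcongr
  have ha0 : 0 < a := lt_of_lt_of_le (by positivity) ha1
  have hbound : ∀ n : ℕ, ‖cexp (-(Real.pi ^ 2 * ((n + 1) * (n + 2)) / t))‖ ≤
      Real.exp (-a) * Real.exp (-a) ^ n := by
    intro n
    rw [Complex.norm_exp, ← pow_succ', ← Real.exp_nat_mul]
    apply Real.exp_le_exp.2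
    have : (-((Real.pi : ℂ) ^ 2 * ((n + 1) * (n + 2)) / t)) =
        ((-(Real.pi ^ 2 * ((n + 1) * (n + 2))) : ℝ) : ℂ) * t⁻¹ := by push_cast; ring
    rw [this, Complex.re_ofReal_mul, ← hb]
    push_cast
    have : (0 : ℝ) ≤ Real.pi ^ 2 * b * ((n + 1) * n) := by positivity
    rw [ha]; nlinarith
  have hlt : Real.exp (-a) < 1 := by rw [Real.exp_lt_one_iff]; linarith
  refine (tsum_of_norm_bounded ((hasSum_geometric_of_lt_one (Real.exp_pos _).le hlt).mul_left _)
    hbound).trans ?_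
  have hq := Real.quadratic_le_exp_of_nonneg ha0.le
  rw [Real.exp_neg]
  have hE : 1 < Real.exp a := by rw [Real.one_lt_exp_iff]; exact ha0
  have : (Real.exp a)⁻¹ * (1 - (Real.exp a)⁻¹)⁻¹ = 1 / (Real.exp a - 1) := by
    have : Real.exp a - 1 ≠ 0 := by linarith
    field_simp
  rw [this, div_le_iff₀ (by linarith)]
  have h9 : 9 ≤ a * ‖t‖ := (div_le_iff₀ htn).1 ha1
  have : 81 ≤ a ^ 2 * ‖t‖ ^ 2 := by nlinarith
  have : a ^ 2 / 2 ≤ Real.exp a - 1 := by linarith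
  nlinarith [mul_le_mul_of_nonneg_left this (sq_nonneg ‖t‖)]

/-- The main term of the overpartition generating function at `exp (-t)` as `t → 0`. -/
noncomputable def overMain (t : ℂ) : ℂ :=
  (t / Real.pi) ^ (1 / 2 : ℂ) / 2 * cexp (Real.pi ^ 2 / 4 / t)

theorem norm_overFun_sub_overMain_le {t : ℂ} (ht : 0 < t.re) (him : |t.im| ≤ t.re / 4)
    (h1 : ‖t‖ ≤ 1) :
    ‖overFun (cexp (-t)) - overMain t‖ ≤ ‖t‖ ^ 2 * ‖overMain t‖ := by
  have h := overFun_exp_mul ht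
  have hε := norm_tsum_exp_le ht him
  set ε := ∑' n : ℕ, cexp (-(Real.pi ^ 2 * ((n + 1) * (n + 2)) / t)) with hεd
  have ht0 : t ≠ 0 := by rintro rfl; simp at ht
  have hpi : (Real.pi : ℂ) ≠ 0 := by exact_mod_cast Real.pi_ne_zero
  have hc : (t / Real.pi) ^ (1 / 2 : ℂ) ≠ 0 := by
    rw [Ne, Complex.cpow_eq_zero_iff]; simp [ht0, hpi]
  have hε2 : ‖ε‖ ≤ 1 / 2 := by nlinarith [norm_nonneg t]
  have h1e : (1 : ℝ) / 2 ≤ ‖1 + ε‖ := by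
    have := norm_sub_le (1 + ε) ε
    rw [add_sub_cancel_right, norm_one] at this
    linarith
  have hne : 1 + ε ≠ 0 := by
    intro h0; rw [h0, norm_zero] at h1e; norm_num at h1e
  have e1 : overFun (cexp (-t)) * (1 + ε) = overMain t := by
    rw [overMain]
    have hx : cexp (-(Real.pi ^ 2 / 4 / t)) * cexp (Real.pi ^ 2 / 4 / t) = 1 := by
      rw [← Complex.exp_add]; simp
    calc overFun (cexp (-t)) * (1 + ε) = (overFun (cexp (-t)) *
        (1 / (t / Real.pi) ^ (1 / 2 : ℂ) * cexp (-(Real.pi ^ 2 / 4 / t)) * (2 * (1 + ε)))) *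
        ((t / Real.pi) ^ (1 / 2 : ℂ) / 2 * cexp (Real.pi ^ 2 / 4 / t)) := by
          rw [show overFun (cexp (-t)) *
            (1 / (t / Real.pi) ^ (1 / 2 : ℂ) * cexp (-(Real.pi ^ 2 / 4 / t)) * (2 * (1 + ε))) *
            ((t / Real.pi) ^ (1 / 2 : ℂ) / 2 * cexp (Real.pi ^ 2 / 4 / t)) =
            overFun (cexp (-t)) * (1 + ε) * (1 / (t / Real.pi) ^ (1 / 2 : ℂ) *
            (t / Real.pi) ^ (1 / 2 : ℂ)) * (cexp (-(Real.pi ^ 2 / 4 / t)) *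
            cexp (Real.pi ^ 2 / 4 / t)) by ring, hx, one_div_mul_cancel hc]
          ring
      _ = _ := by rw [h, one_mul]
  have e2 : overFun (cexp (-t)) - overMain t = -ε * (overMain t / (1 + ε)) := by
    rw [← e1]; field_simp; ring
  rw [e2, norm_mul, norm_neg, norm_div]
  have : ‖overMain t‖ / ‖1 + ε‖ ≤ ‖overMain t‖ * 2 := by
    rw [div_le_iff₀ (by linarith)]; nlinarith [norm_nonneg (overMain t)]
  calc ‖ε‖ * (‖overMain t‖ / ‖1 + ε‖) ≤ (‖t‖ ^ 2 / 2) * (‖overMain t‖ * 2) := by gcongr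
    _ = _ := by ring

end Overpart

/-! ### The minor arc -/

namespace Overpart

open Filter Topology Complex

/-- The numerator carries the gain: |1 + x|² = (1 + |x|)² - 2(|x| - Re x), and (1 + |x|)² ≤ 4
converts this into an exponential factor. -/
theorem norm_one_add_div_one_sub_le {x : ℂ} (hx : ‖x‖ < 1) :
    ‖(1 + x) / (1 - x)‖ ≤ (1 + ‖x‖) / (1 - ‖x‖) * Real.exp (-((‖x‖ - x.re) / 4)) := by
  have h1 : 1 - ‖x‖ ≤ ‖1 - x‖ := by
    have := norm_sub_norm_le (1 : ℂ) x
    rwa [norm_one] at this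
  have hd : 0 ≤ ‖x‖ - x.re := sub_nonneg.2 (Complex.re_le_norm x)
  have h2 : ‖1 + x‖ ≤ (1 + ‖x‖) * Real.exp (-((‖x‖ - x.re) / 4)) := by
    refine (abs_le_of_sq_le_sq' ?_ (by positivity)).2
    have e : ‖1 + x‖ ^ 2 = (1 + ‖x‖) ^ 2 - 2 * (‖x‖ - x.re) := by
      have a1 := Complex.sq_norm (1 + x)
      have a2 := Complex.sq_norm x
      rw [Complex.normSq_apply] at a1 a2
      simp only [add_re, one_re, add_im, one_im, zero_add] at a1
      nlinarith
    rw [e, mul_pow, ← Real.exp_nat_mul]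
    have h3 := Real.add_one_le_exp (((2 : ℕ) : ℝ) * -((‖x‖ - x.re) / 4))
    push_cast at h3 ⊢
    have h4 : (1 + ‖x‖) ^ 2 ≤ 4 := by nlinarith [norm_nonneg x]
    nlinarith [mul_le_mul_of_nonneg_left h3 (sq_nonneg (1 + ‖x‖)),
      mul_le_mul_of_nonneg_right h4 hd]
  rw [norm_div, div_mul_eq_mul_div]
  gcongr

/-- The factorwise gains multiply, and Σ (|q|^i - Re q^i) over i ≥ 1 is a difference of two
geometric series. -/
theorem norm_overFun_le_of_norm {q : ℂ} (hq : ‖q‖ < 1) :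
    ‖overFun q‖ ≤ ‖overFun (‖q‖ : ℂ)‖ *
      Real.exp (-((‖q‖ / (1 - ‖q‖) - (q / (1 - q)).re) / 4)) := by
  have hρ : ‖((‖q‖ : ℝ) : ℂ)‖ < 1 := by simpa using hq
  have t1 := (tendsto_prod_overFun hq).norm
  have t2 := (tendsto_prod_overFun hρ).norm
  have s1 : HasSum (fun i : ℕ => ‖q‖ ^ (i + 1)) (‖q‖ / (1 - ‖q‖)) := by
    have := (hasSum_geometric_of_lt_one (norm_nonneg q) hq).mul_left ‖q‖
    simpa [pow_succ', div_eq_mul_inv] using this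
  have s2 : HasSum (fun i : ℕ => (q ^ (i + 1)).re) ((q / (1 - q)).re) := by
    have := (hasSum_geometric_of_norm_lt_one hq).mul_left q
    have := Complex.hasSum_re this
    simpa [pow_succ', div_eq_mul_inv] using this
  have t3 := ((Real.continuous_exp.tendsto _).comp ((s1.sub s2).tendsto_sum_nat.div_const 4).neg)
  refine le_of_tendsto_of_tendsto t1 (t2.mul t3) (Eventually.of_forall fun L => ?_)
  simp only [Function.comp_def, norm_prod]
  rw [Finset.sum_div, ← Finset.sum_neg_distrib, Real.exp_sum, ← Finset.prod_mul_distrib]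
  refine Finset.prod_le_prod (fun _ _ => norm_nonneg _) fun i _ => ?_
  have hx : ‖q ^ (i + 1)‖ < 1 := by
    rw [norm_pow]; exact pow_lt_one₀ (norm_nonneg _) hq (by omega)
  refine (norm_one_add_div_one_sub_le hx).trans (le_of_eq ?_)
  rw [norm_pow] at hx ⊢
  congr 1
  rw [show (1 + ((‖q‖ : ℝ) : ℂ) ^ (i + 1)) / (1 - ((‖q‖ : ℝ) : ℂ) ^ (i + 1)) =
    (((1 + ‖q‖ ^ (i + 1)) / (1 - ‖q‖ ^ (i + 1)) : ℝ) : ℂ) by push_cast; rfl, Complex.norm_real,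
    Real.norm_of_nonneg]
  have : 0 ≤ 1 - ‖q‖ ^ (i + 1) := by linarith
  positivity

theorem norm_overFun_minor_le {c y : ℝ} (hc : 0 < c) (hc1 : c ≤ 1) (hy : c / 4 ≤ |y|)
    (hyπ : |y| ≤ Real.pi) :
    ‖overFun (cexp (-(c + y * I)))‖ ≤ Real.exp ((Real.pi ^ 2 / 4 - 1 / 4000) / c) := by
  set q := cexp (-(c + y * I)) with hqd
  set ρ := Real.exp (-c) with hρ
  have hqn : ‖q‖ = ρ := by rw [hqd, Complex.norm_exp]; simp [hρ]
  have hρ0 : 0 < ρ := Real.exp_pos _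
  have hρ1 : ρ < 1 := by rw [hρ, Real.exp_lt_one_iff]; linarith
  have hρc : 1 - ρ ≤ c := by have := Real.add_one_le_exp (-c); linarith
  have hρe : (0.36 : ℝ) ≤ ρ := by
    have h1 : Real.exp (-1) ≤ ρ := Real.exp_le_exp.2 (by linarith)
    have h2 := Real.exp_neg_one_gt_d9
    linarith
  have hq1 : ‖q‖ < 1 := by rw [hqn]; exact hρ1
  have hre : q.re = ρ * Real.cos y := by
    rw [hqd, Complex.exp_re]; simp [hρ]
  have him : q.im ^ 2 + q.re ^ 2 = ρ ^ 2 := by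
    rw [← hqn, Complex.sq_norm, Complex.normSq_apply]; ring
  have hsq : ‖1 - q‖ ^ 2 = (1 - ρ) ^ 2 + 2 * ρ * (1 - Real.cos y) := by
    rw [Complex.sq_norm, Complex.normSq_apply]
    simp only [sub_re, one_re, sub_im, one_im]
    nlinarith
  have hcos := Real.cos_le_one_sub_mul_cos_sq hyπ
  have hpi : Real.pi ^ 2 ≤ 10 := by nlinarith [Real.pi_lt_d2, Real.pi_gt_three]
  have h02 : (0.2 : ℝ) ≤ 2 / Real.pi ^ 2 := by
    rw [le_div_iff₀ (by positivity)]; linarith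
  have hy2 : c ^ 2 / 16 ≤ y ^ 2 := by
    rw [← sq_abs y]; nlinarith
  have h1c : 0.2 * (c ^ 2 / 16) ≤ 1 - Real.cos y := by
    have : 0.2 * (c ^ 2 / 16) ≤ 2 / Real.pi ^ 2 * y ^ 2 := by gcongr
    linarith
  -- With 1 - cos y ≥ 0.2 · c²/16 and ρ ≥ 0.36, the square |1 - q|² exceeds (1 - ρ)² by at least
  -- 0.009c² ≥ 0.009(1 - ρ)², while (301/300)² < 1.007.
  have hlow : (1 - ρ) * (301 / 300) ≤ ‖1 - q‖ := by
    refine (abs_le_of_sq_le_sq' ?_ (norm_nonneg _)).2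
    rw [hsq]
    have h3 : (1 - ρ) ^ 2 ≤ c ^ 2 := by
      have : 0 ≤ 1 - ρ := by linarith
      gcongr
    have h4 : 2 * 0.36 * (0.2 * (c ^ 2 / 16)) ≤ 2 * ρ * (1 - Real.cos y) := by gcongr
    nlinarith
  have h1ρ : 0 < 1 - ρ := by linarith
  -- The difference is at least ρ/(301(1 - ρ)) ≥ 0.36/(301c). A quarter of the resulting 1/(1000c)
  -- is the saving 1/(4000c).
  have hdiff : 1 / (1000 * c) ≤ ‖q‖ / (1 - ‖q‖) - (q / (1 - q)).re := by
    have h5 : (q / (1 - q)).re ≤ ρ / ((1 - ρ) * (301 / 300)) := by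
      refine (Complex.re_le_norm _).trans ?_
      rw [norm_div, hqn]
      gcongr
    rw [hqn]
    have h6 : ρ / (1 - ρ) - ρ / ((1 - ρ) * (301 / 300)) = ρ / (301 * (1 - ρ)) := by
      field_simp; norm_num
    have h7 : 1 / (1000 * c) ≤ ρ / (301 * (1 - ρ)) := by
      rw [div_le_div_iff₀ (by positivity) (by positivity)]
      nlinarith
    linarith
  have hbase : ‖overFun (ρ : ℂ)‖ ≤ Real.exp (Real.pi ^ 2 / 4 / c) := by
    have hn : ‖((c : ℝ) : ℂ)‖ = c := by rw [Complex.norm_real, Real.norm_of_nonneg hc.le]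
    have h8 := norm_overFun_sub_overMain_le (t := (c : ℂ)) (by simpa using hc)
      (by simp; positivity) (by rw [hn]; exact hc1)
    have hE : ‖overMain (c : ℂ)‖ ≤ Real.exp (Real.pi ^ 2 / 4 / c) / 2 := by
      rw [overMain, norm_mul, norm_div, Complex.norm_two]
      have e1 : ‖((c : ℂ) / Real.pi) ^ (1 / 2 : ℂ)‖ ≤ 1 := by
        rw [← Complex.ofReal_div, Complex.norm_cpow_eq_rpow_re_of_pos (by positivity)]
        apply Real.rpow_le_one (by positivity)
        · rw [div_le_one Real.pi_pos]; linarith [Real.pi_gt_three]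
        · norm_num
      have e2 : ‖cexp ((Real.pi : ℂ) ^ 2 / 4 / c)‖ = Real.exp (Real.pi ^ 2 / 4 / c) := by
        rw [show ((Real.pi : ℂ) ^ 2 / 4 / c) = ((Real.pi ^ 2 / 4 / c : ℝ) : ℂ) by push_cast; rfl,
          ← Complex.ofReal_exp, Complex.norm_real, Real.norm_of_nonneg (Real.exp_pos _).le]
      rw [e2]
      have := Real.exp_pos (Real.pi ^ 2 / 4 / c)
      nlinarith
    have e3 : cexp (-(c : ℂ)) = (ρ : ℂ) := by rw [hρ]; push_cast; rfl
    rw [e3, hn] at h8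
    have h9 := norm_sub_norm_le (overFun (ρ : ℂ)) (overMain c)
    have h10 : c ^ 2 * ‖overMain (c : ℂ)‖ ≤ 1 * ‖overMain (c : ℂ)‖ := by
      gcongr; nlinarith
    linarith
  refine (norm_overFun_le_of_norm hq1).trans ?_
  rw [hqn] at hdiff ⊢
  have h11 : Real.exp (-((ρ / (1 - ρ) - (q / (1 - q)).re) / 4)) ≤ Real.exp (-(1 / 4000 / c)) := by
    apply Real.exp_le_exp.2
    have : 1 / 4000 / c = 1 / (1000 * c) / 4 := by field_simp; norm_num
    linarith
  refine (mul_le_mul hbase h11 (Real.exp_pos _).le (Real.exp_pos _).le).trans (le_of_eq ?_)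
  rw [← Real.exp_add]
  congr 1; ring

end Overpart

/-! ### Finite differences and the Euler transformation -/

namespace Overpart

open Filter Topology Complex Metric

/-- The mean value inequality bounds f(z + 1) - f(z) by the derivative on a ball enlarged by 1, and
Cauchy's estimate on circles of radius h bounds the derivative by B/h. Iterated, each difference
costs 1 + h of the radius and gains 1/h. -/
theorem norm_fwdDiff_le {f : ℂ → ℂ} {c : ℂ} {R h B : ℝ} (hh : 0 < h)
    (hf : DifferentiableOn ℂ f (ball c (R + (1 + h))))
    (hB : ∀ z ∈ ball c (R + (1 + h)), ‖f z‖ ≤ B) :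
    DifferentiableOn ℂ (fwdDiff 1 f) (ball c R) ∧ ∀ z ∈ ball c R, ‖fwdDiff 1 f z‖ ≤ B / h := by
  have hsub : ∀ z ∈ ball c R, z ∈ ball c (R + 1) ∧ z + 1 ∈ ball c (R + 1) := by
    intro z hz
    rw [mem_ball, dist_eq_norm] at hz
    refine ⟨by rw [mem_ball, dist_eq_norm]; linarith, ?_⟩
    rw [mem_ball, dist_eq_norm, show z + 1 - c = (z - c) + 1 by ring]
    refine (norm_add_le _ _).trans_lt ?_
    rw [norm_one]; linarith
  have hR : ball c (R + 1) ⊆ ball c (R + (1 + h)) := ball_subset_ball (by linarith)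
  constructor
  · have h1 : DifferentiableOn ℂ (fun z => f (z + 1)) (ball c R) :=
      hf.comp (differentiableOn_id.add_const 1) fun z hz => hR (hsub z hz).2
    exact h1.sub (hf.mono fun z hz => hR (hsub z hz).1)
  · intro z hz
    have hd : ∀ w ∈ ball c (R + 1), ‖deriv f w‖ ≤ B / h := by
      intro w hw
      have hcl : closedBall w h ⊆ ball c (R + (1 + h)) := by
        intro v hv
        rw [mem_closedBall] at hv
        rw [mem_ball] at hw ⊢
        linarith [dist_triangle v w c]
      exact Complex.norm_deriv_le_of_forall_mem_sphere_norm_le hh (hf.diffContOnCl_ball hcl)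
        fun v hv => hB v (hcl (sphere_subset_closedBall hv))
    have := (convex_ball c (R + 1)).norm_image_sub_le_of_norm_deriv_le (𝕜 := ℂ) (f := f)
      (fun w hw => hf.differentiableAt (isOpen_ball.mem_nhds (hR hw))) hd (hsub z hz).1 (hsub z hz).2
    simpa [fwdDiff] using this

theorem norm_fwdDiff_iter_le {c : ℂ} {R h : ℝ} (hh : 0 < h) (K : ℕ) :
    ∀ {f : ℂ → ℂ} {B : ℝ}, DifferentiableOn ℂ f (ball c (R + K * (1 + h))) →
    (∀ z ∈ ball c (R + K * (1 + h)), ‖f z‖ ≤ B) →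
    ∀ z ∈ ball c R, ‖(fwdDiff 1)^[K] f z‖ ≤ B / h ^ K := by
  induction K with
  | zero => intro f B _ hB z hz; simpa using hB z (by simpa using hz)
  | succ K ih =>
    intro f B hf hB z hz
    have e : R + ((K + 1 : ℕ) : ℝ) * (1 + h) = (R + K * (1 + h)) + (1 + h) := by push_cast; ring
    rw [e] at hf hB
    have h2 := norm_fwdDiff_le hh hf hB
    rw [Function.iterate_succ_apply, pow_succ', ← div_div]
    exact ih h2.1 h2.2 z hz

theorem fwdDiff_iter_nat (f : ℂ → ℂ) (K n : ℕ) :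
    (fwdDiff 1)^[K] (fun m : ℕ => f (m + 1)) n = (fwdDiff 1)^[K] f (n + 1) := by
  induction K generalizing f with
  | zero => simp
  | succ K ih =>
    have e : fwdDiff 1 (fun m : ℕ => f (m + 1)) = fun m : ℕ => fwdDiff 1 f (m + 1) := by
      funext m; simp [fwdDiff]
    rw [Function.iterate_succ_apply, Function.iterate_succ_apply, ← ih, e]

/-- The alternating sum of `g` after `K` steps of the Euler transformation. -/
noncomputable def eulerAlt : ℕ → (ℕ → ℂ) → ℂ
  | 0, g => ∑' n, (-1) ^ n * g n
  | K + 1, g => (g 0 - eulerAlt K (fwdDiff 1 g)) / 2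

theorem summable_alt {g : ℕ → ℂ} (hg : Summable g) : Summable fun n => (-1 : ℂ) ^ n * g n := by
  refine Summable.of_norm ?_
  simpa using hg.norm

theorem summable_fwdDiff {g : ℕ → ℂ} (hg : Summable g) : Summable (fwdDiff 1 g) :=
  ((summable_nat_add_iff 1).2 hg).sub hg

/-- Shifting the index gives Σ (-1)^n g(n+1) = g(0) - Σ (-1)^n g(n), so one more step does not
change a convergent sum. Thus `eulerAlt K` extends the alternating sum to sequences of which only
the K-th difference is summable. -/
theorem eulerAlt_succ {g : ℕ → ℂ} (K : ℕ) (hg : Summable ((fwdDiff 1)^[K] g)) :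
    eulerAlt (K + 1) g = eulerAlt K g := by
  induction K generalizing g with
  | zero =>
    simp only [Function.iterate_zero, id] at hg
    have h1 := summable_alt hg
    have h2 := summable_alt ((summable_nat_add_iff 1).2 hg)
    simp only [eulerAlt]
    have e : ∀ n, (-1 : ℂ) ^ n * fwdDiff 1 g n = (-1) ^ n * g (n + 1) - (-1) ^ n * g n := by
      intro n; simp [fwdDiff, mul_sub]
    simp_rw [e]
    rw [h2.tsum_sub h1, h1.tsum_eq_zero_add]
    have e2 : ∀ n, (-1 : ℂ) ^ (n + 1) * g (n + 1) = -((-1) ^ n * g (n + 1)) := by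
      intro n; ring
    simp_rw [e2]
    rw [tsum_neg]; ring
  | succ K ih =>
    rw [eulerAlt, ih (by rwa [← Function.iterate_succ_apply]), ← eulerAlt]

theorem summable_fwdDiff_iter {g : ℕ → ℂ} (hg : Summable g) (K : ℕ) :
    Summable ((fwdDiff 1)^[K] g) := by
  induction K generalizing g with
  | zero => simpa
  | succ K ih => rw [Function.iterate_succ_apply]; exact ih (summable_fwdDiff hg)

theorem summable_fwdDiff_iter_of_le {g : ℕ → ℂ} {J K : ℕ} (hJK : J ≤ K)
    (hg : Summable ((fwdDiff 1)^[J] g)) : Summable ((fwdDiff 1)^[K] g) := by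
  obtain ⟨d, rfl⟩ := Nat.exists_eq_add_of_le hJK
  rw [add_comm, Function.iterate_add_apply]
  exact summable_fwdDiff_iter hg d

theorem eulerAlt_eq_of_le {g : ℕ → ℂ} {J K : ℕ} (hJK : J ≤ K)
    (hg : Summable ((fwdDiff 1)^[J] g)) : eulerAlt K g = eulerAlt J g := by
  induction K, hJK using Nat.le_induction with
  | base => rfl
  | succ K hK ih => rw [eulerAlt_succ K (summable_fwdDiff_iter_of_le hK hg), ih]

theorem fwdDiff_iter_add' (f g : ℕ → ℂ) (K : ℕ) :
    (fwdDiff 1)^[K] (fun n => f n + g n) =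
      fun n => (fwdDiff 1)^[K] f n + (fwdDiff 1)^[K] g n := by
  induction K generalizing f g with
  | zero => rfl
  | succ K ih =>
    simp only [Function.iterate_succ_apply]
    rw [← ih]
    congr 1; funext n; simp [fwdDiff]; ring

theorem fwdDiff_iter_smul' (c : ℂ) (g : ℕ → ℂ) (K : ℕ) :
    (fwdDiff 1)^[K] (fun n => c * g n) = fun n => c * (fwdDiff 1)^[K] g n := by
  induction K generalizing g with
  | zero => rfl
  | succ K ih =>
    simp only [Function.iterate_succ_apply]
    rw [← ih]
    congr 1; funext n; simp [fwdDiff]; ring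

theorem eulerAlt_add {f g : ℕ → ℂ} {K : ℕ} (hf : Summable ((fwdDiff 1)^[K] f))
    (hg : Summable ((fwdDiff 1)^[K] g)) :
    eulerAlt K (fun n => f n + g n) = eulerAlt K f + eulerAlt K g := by
  induction K generalizing f g with
  | zero =>
    simp only [eulerAlt, mul_add]
    exact (summable_alt hf).tsum_add (summable_alt hg)
  | succ K ih =>
    rw [Function.iterate_succ_apply] at hf hg
    simp only [eulerAlt]
    have e : fwdDiff 1 (fun n => f n + g n) = fun n => fwdDiff 1 f n + fwdDiff 1 g n := by
      funext n; simp [fwdDiff]; ring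
    rw [e, ih hf hg]; ring

theorem eulerAlt_const_mul (c : ℂ) (g : ℕ → ℂ) (K : ℕ) :
    eulerAlt K (fun n => c * g n) = c * eulerAlt K g := by
  induction K generalizing g with
  | zero =>
    simp only [eulerAlt]
    rw [← tsum_mul_left]
    congr 1; funext n; ring
  | succ K ih =>
    simp only [eulerAlt]
    have e : fwdDiff 1 (fun n => c * g n) = fun n => c * fwdDiff 1 g n := by
      funext n; simp [fwdDiff]; ring
    rw [e, ih]; ring

/-- Unfolding the K steps leaves the initial values of the differences of order below K and the
alternating sum of the K-th difference; the powers of 1/2 are discarded. -/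
theorem norm_eulerAlt_le {g : ℕ → ℂ} {B S : ℝ} {b : ℕ → ℝ} {K : ℕ} (hb : HasSum b S)
    (h0 : ∀ j < K, ‖(fwdDiff 1)^[j] g 0‖ ≤ B) (hK : ∀ n, ‖(fwdDiff 1)^[K] g n‖ ≤ b n) :
    ‖eulerAlt K g‖ ≤ K * B + S := by
  induction K generalizing g with
  | zero =>
    simp only [eulerAlt, Nat.cast_zero, zero_mul, zero_add]
    refine tsum_of_norm_bounded hb fun n => ?_
    simpa using hK n
  | succ K ih =>
    have h1 := ih (g := fwdDiff 1 g)
      (fun j hj => by rw [← Function.iterate_succ_apply]; exact h0 (j + 1) (by omega))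
      (fun n => by rw [← Function.iterate_succ_apply]; exact hK n)
    have h2 : ‖g 0‖ ≤ B := by simpa using h0 0 (by omega)
    have h3 := norm_sub_le (g 0) (eulerAlt K (fwdDiff 1 g))
    rw [eulerAlt, norm_div, Complex.norm_two]
    have h4 : 0 ≤ ‖g 0‖ := norm_nonneg _
    have h5 : 0 ≤ ‖eulerAlt K (fwdDiff 1 g)‖ := norm_nonneg _
    push_cast
    linarith

theorem norm_fwdDiff_iter_le_of_bound {g : ℕ → ℂ} {B : ℝ} {K n : ℕ}
    (h : ∀ m, m ≤ n + K → ‖g m‖ ≤ B) : ‖(fwdDiff 1)^[K] g n‖ ≤ 2 ^ K * B := by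
  induction K generalizing g B with
  | zero => simpa using h n (by omega)
  | succ K ih =>
    rw [Function.iterate_succ_apply, pow_succ, mul_assoc]
    refine ih fun m hm => ?_
    have := norm_sub_le (g (m + 1)) (g m)
    have h1 := h (m + 1) (by omega)
    have h2 := h m (by omega)
    simp only [fwdDiff]
    linarith

end Overpart

/-! ### The alternating zeta values as Euler sums -/

namespace Overpart

open Filter Topology Complex

theorem altZeta_one : altZeta 1 = Real.log 2 := by simp [altZeta]

theorem altZeta_zero : altZeta 0 = 1 / 2 := by
  rw [altZeta, if_neg (by norm_num)]
  norm_num [riemannZeta_zero]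

theorem altZeta_neg_one : altZeta (-1) = 1 / 4 := by
  have h := riemannZeta_neg_nat_eq_bernoulli' 1
  rw [altZeta, if_neg (by norm_num)]
  norm_num [bernoulli'_two] at h
  have e : ((-1 : ℤ) : ℂ) = -1 := by norm_num
  rw [e, h]
  have : (-(1 / 6) / 2 : ℂ) = ((-(1 / 12) : ℝ) : ℂ) := by push_cast; norm_num
  norm_num

/-- Splitting by parity, the even integers carry 2^{-s}ζ(s), which enters with the opposite sign and
so is subtracted twice. -/
theorem altZeta_of_two_le {s : ℕ} (hs : 2 ≤ s) :
    (altZeta s : ℂ) = ∑' n : ℕ, (-1) ^ n * (1 / (n + 1 : ℂ) ^ s) ∧ 0 < altZeta s := by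
  have hsum : Summable fun n : ℕ => 1 / (n : ℝ) ^ s := Real.summable_one_div_nat_pow.2 (by omega)
  have hsum1 : Summable fun n : ℕ => 1 / (n + 1 : ℝ) ^ s := by
    simpa using (summable_nat_add_iff 1).2 hsum
  set Z := ∑' n : ℕ, 1 / (n + 1 : ℝ) ^ s with hZ
  have hz : riemannZeta ((s : ℤ) : ℂ) = (Z : ℂ) := by
    rw [Int.cast_natCast, zeta_nat_eq_tsum_of_gt_one (by omega), hZ, ofReal_tsum]
    have : Summable fun n : ℕ => 1 / (n : ℂ) ^ s := by
      have := (ofRealCLM.summable hsum)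
      simpa using this
    rw [this.tsum_eq_zero_add]
    simp [show s ≠ 0 by omega]
  have h2s : (2 : ℝ) ^ (1 - (s : ℤ)) = 2 * (1 / 2 ^ s) := by
    rw [zpow_sub₀ (by norm_num)]; simp; ring
  have haz : altZeta s = (1 - 2 * (1 / 2 ^ s)) * Z := by
    rw [altZeta, if_neg (by exact_mod_cast (by omega : s ≠ 1)), hz, h2s, ofReal_re]
  have hreal : altZeta s = ∑' n : ℕ, (-1) ^ n * (1 / (n + 1 : ℝ) ^ s) := by
    have he : Summable fun k : ℕ => 1 / (((2 * k : ℕ) : ℝ) + 1) ^ s :=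
      hsum1.comp_injective (i := fun k : ℕ => 2 * k) fun a b h => by simpa using h
    have ho : Summable fun k : ℕ => 1 / (((2 * k + 1 : ℕ) : ℝ) + 1) ^ s :=
      hsum1.comp_injective (i := fun k : ℕ => 2 * k + 1) fun a b h => by simpa using h
    have e1 := tsum_even_add_odd (f := fun n : ℕ => 1 / ((n : ℝ) + 1) ^ s) he ho
    have e2 := tsum_even_add_odd (f := fun n : ℕ => (-1) ^ n * (1 / ((n : ℝ) + 1) ^ s))
      (by simpa using he) (by simpa [pow_succ] using ho.neg)
    rw [← e2, haz]
    have e3 : ∑' k : ℕ, 1 / (((2 * k + 1 : ℕ) : ℝ) + 1) ^ s = 1 / 2 ^ s * Z := by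
      rw [hZ, ← tsum_mul_left]
      congr 1; funext k
      rw [one_div_mul_one_div, ← mul_pow]
      push_cast; ring_nf
    rw [e3] at e1
    have e4 : ∑' k : ℕ, (-1) ^ (2 * k + 1) * (1 / (((2 * k + 1 : ℕ) : ℝ) + 1) ^ s) =
        -(1 / 2 ^ s * Z) := by
      rw [← e3, ← tsum_neg]
      congr 1; funext k; simp [pow_succ]
    have e5 : ∑' k : ℕ, (-1 : ℝ) ^ (2 * k) * (1 / (((2 * k : ℕ) : ℝ) + 1) ^ s) =
        ∑' k : ℕ, 1 / (((2 * k : ℕ) : ℝ) + 1) ^ s := by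
      congr 1; funext k; simp
    rw [e4, e5]
    rw [← hZ] at e1
    linarith
  constructor
  · rw [hreal, ofReal_tsum]
    push_cast; rfl
  · rw [haz]
    apply mul_pos
    · have : (2 : ℝ) ^ 2 ≤ 2 ^ s := pow_le_pow_right₀ (by norm_num) hs
      have : 1 / (2 : ℝ) ^ s ≤ 1 / 2 ^ 2 := by gcongr
      linarith
    · exact hsum1.tsum_pos (fun n => by positivity) 0 (by norm_num)

theorem altZeta_pos {s : ℤ} (hs : -1 ≤ s) : 0 < altZeta s := by
  rcases (by omega : s = -1 ∨ s = 0 ∨ s = 1 ∨ 2 ≤ s) with rfl | rfl | rfl | h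
  · rw [altZeta_neg_one]; norm_num
  · rw [altZeta_zero]; norm_num
  · rw [altZeta_one]; exact Real.log_pos (by norm_num)
  · lift s to ℕ using by omega
    exact (altZeta_of_two_le (by exact_mod_cast h)).2

theorem sum_alternating_harmonic (M : ℕ) :
    ∑ n ∈ Finset.range (2 * M), (-1 : ℝ) ^ n * (1 / (n + 1)) =
      (harmonic (2 * M) : ℝ) - harmonic M := by
  induction M with
  | zero => simp
  | succ M ih =>
    rw [show 2 * (M + 1) = 2 * M + 1 + 1 by ring, Finset.sum_range_succ, Finset.sum_range_succ, ih,
      harmonic_succ, harmonic_succ, harmonic_succ]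
    push_cast
    have h1 : (M : ℝ) + 1 ≠ 0 := by positivity
    have h2 : 2 * (M : ℝ) + 1 ≠ 0 := by positivity
    have h3 : 2 * (M : ℝ) + 1 + 1 ≠ 0 := by positivity
    rw [pow_succ, pow_mul]
    norm_num
    field_simp
    ring

theorem tendsto_alternating_harmonic :
    Tendsto (fun M : ℕ => ∑ n ∈ Finset.range (2 * M), (-1 : ℝ) ^ n * (1 / (n + 1))) atTop
      (𝓝 (Real.log 2)) := by
  have h1 := Real.tendsto_harmonic_sub_log
  have h2 := h1.comp (tendsto_id.const_mul_atTop' (show 0 < 2 by norm_num))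
  have h3 := (h2.sub h1).add_const (Real.log 2)
  rw [sub_self, zero_add] at h3
  refine h3.congr' ?_
  filter_upwards [eventually_ge_atTop 1] with M hM
  have hM0 : (M : ℝ) ≠ 0 := by positivity
  rw [sum_alternating_harmonic]
  simp only [Function.comp_apply, id]
  push_cast
  rw [Real.log_mul (by norm_num) hM0]
  ring

theorem fwdDiff_one_div : (fwdDiff 1 fun n : ℕ => (1 / (n + 1) : ℂ)) =
    fun n : ℕ => -(1 / (((n : ℂ) + 1) * (n + 2))) := by
  funext n
  have h1 : (n : ℂ) + 1 ≠ 0 := by exact_mod_cast n.succ_ne_zero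
  have h2 : (n : ℂ) + 2 ≠ 0 := by exact_mod_cast (n + 1).succ_ne_zero
  simp only [fwdDiff]
  push_cast
  rw [show (n : ℂ) + 1 + 1 = n + 2 by ring]
  field_simp
  ring

theorem summable_fwdDiff_one_div : Summable (fwdDiff 1 fun n : ℕ => (1 / (n + 1) : ℂ)) := by
  rw [fwdDiff_one_div]
  refine Summable.neg ?_
  have hsum1 : Summable fun n : ℕ => 1 / (n + 1 : ℝ) ^ 2 := by
    simpa using (summable_nat_add_iff 1).2 (Real.summable_one_div_nat_pow.2 (by norm_num : 1 < 2))
  refine Summable.of_norm_bounded hsum1 fun n => ?_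
  have e : (1 / (((n : ℂ) + 1) * (n + 2))) = ((1 / (((n : ℝ) + 1) * (n + 2)) : ℝ) : ℂ) := by
    push_cast; rfl
  rw [e, Complex.norm_real, Real.norm_of_nonneg (by positivity)]
  gcongr
  nlinarith [Nat.cast_nonneg (α := ℝ) n]

/-- The series converges only conditionally, so its first difference is summed instead. Partial sums
of even length are identified through H_{2M} - H_M → log 2. -/
theorem eulerAlt_one_div : eulerAlt 1 (fun n : ℕ => (1 / (n + 1) : ℂ)) = (Real.log 2 : ℂ) := by
  set g : ℕ → ℂ := fun n => 1 / (n + 1) with hg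
  have hs : HasSum (fun n => (-1 : ℂ) ^ n * fwdDiff 1 g n) (∑' n, (-1 : ℂ) ^ n * fwdDiff 1 g n) :=
    (summable_alt summable_fwdDiff_one_div).hasSum
  have h1 := hs.tendsto_sum_nat.comp (tendsto_id.const_mul_atTop' (show 0 < 2 by norm_num))
  -- Summation by parts, with the boundary term kept because the series of g is not absolutely
  -- convergent.
  have hp : ∀ N, ∑ n ∈ Finset.range N, (-1 : ℂ) ^ n * fwdDiff 1 g n =
      g 0 - (-1) ^ N * g N - 2 * ∑ n ∈ Finset.range N, (-1 : ℂ) ^ n * g n := by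
    intro N
    induction N with
    | zero => simp
    | succ N ih =>
      rw [Finset.sum_range_succ, ih, Finset.sum_range_succ]
      simp only [fwdDiff]; ring
  have h2 : Tendsto (fun M : ℕ => ∑ n ∈ Finset.range (2 * M), (-1 : ℂ) ^ n * g n) atTop
      (𝓝 (Real.log 2 : ℂ)) := by
    have := (Complex.continuous_ofReal.tendsto _).comp tendsto_alternating_harmonic
    refine this.congr fun M => ?_
    simp [hg]
  have h3 : Tendsto (fun M : ℕ => g (2 * M)) atTop (𝓝 0) := by
    have := (tendsto_one_div_add_atTop_nhds_zero_nat (𝕜 := ℂ)).comp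
      (tendsto_id.const_mul_atTop' (show 0 < 2 by norm_num))
    simpa [Function.comp_def, hg] using this
  have h4 := ((tendsto_const_nhds (x := g 0)).sub h3).sub (h2.const_mul 2)
  have h5 := tendsto_nhds_unique h1 (h4.congr fun M => by simp [hp, pow_mul])
  have e : eulerAlt 1 g = (g 0 - ∑' n, (-1 : ℂ) ^ n * fwdDiff 1 g n) / 2 := by
    simp only [eulerAlt]
  rw [e, h5]; ring

/-- Two differences always suffice: they annihilate n + 1, one annihilates the constant, one makes
1/(n + 1) summable, and for s ≥ 2 none is needed. The range s ≥ -1 covers r, r - 1 and r - 2 for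
every r ≥ 1. -/
theorem eulerAlt_zpow {s : ℤ} (hs : -1 ≤ s) {K : ℕ} (hK : 2 ≤ K) :
    Summable ((fwdDiff 1)^[K] fun n : ℕ => ((n : ℂ) + 1) ^ (-s)) ∧
      eulerAlt K (fun n : ℕ => ((n : ℂ) + 1) ^ (-s)) = altZeta s := by
  rcases (by omega : s = -1 ∨ s = 0 ∨ s = 1 ∨ 2 ≤ s) with rfl | rfl | rfl | h
  · have e1 : (fwdDiff 1 fun n : ℕ => ((n : ℂ) + 1) ^ (-(-1) : ℤ)) = fun _ => 1 := by
      funext n; simp [fwdDiff]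
    have e2 : (fwdDiff 1 fun _ : ℕ => (1 : ℂ)) = fun _ => 0 := by
      funext n; simp [fwdDiff]
    have e3 : (fwdDiff 1)^[2] (fun n : ℕ => ((n : ℂ) + 1) ^ (-(-1) : ℤ)) = fun _ => 0 := by
      rw [Function.iterate_succ_apply, e1, Function.iterate_succ_apply, e2, Function.iterate_zero, id]
    have hs2 : Summable ((fwdDiff 1)^[2] fun n : ℕ => ((n : ℂ) + 1) ^ (-(-1) : ℤ)) := by
      rw [e3]; exact summable_zero
    refine ⟨summable_fwdDiff_iter_of_le hK hs2, ?_⟩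
    rw [eulerAlt_eq_of_le hK hs2, altZeta_neg_one]
    simp only [eulerAlt, e1, e2]
    simp; norm_num
  · have e1 : (fwdDiff 1 fun n : ℕ => ((n : ℂ) + 1) ^ (-0 : ℤ)) = fun _ => 0 := by
      funext n; simp [fwdDiff]
    have hs2 : Summable ((fwdDiff 1)^[1] fun n : ℕ => ((n : ℂ) + 1) ^ (-0 : ℤ)) := by
      rw [Function.iterate_one, e1]; exact summable_zero
    refine ⟨summable_fwdDiff_iter_of_le (by omega) hs2, ?_⟩
    rw [eulerAlt_eq_of_le (by omega : 1 ≤ K) hs2, altZeta_zero]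
    simp only [eulerAlt, e1]
    simp
  · have e1 : (fun n : ℕ => ((n : ℂ) + 1) ^ (-1 : ℤ)) = fun n : ℕ => (1 / (n + 1) : ℂ) := by
      funext n; simp
    rw [e1]
    have hs2 : Summable ((fwdDiff 1)^[1] fun n : ℕ => (1 / (n + 1) : ℂ)) := by
      rw [Function.iterate_one]; exact summable_fwdDiff_one_div
    refine ⟨summable_fwdDiff_iter_of_le (by omega) hs2, ?_⟩
    rw [eulerAlt_eq_of_le (by omega : 1 ≤ K) hs2, altZeta_one, eulerAlt_one_div]
  · lift s to ℕ using by omega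
    have h2 : 2 ≤ s := by exact_mod_cast h
    have e1 : (fun n : ℕ => ((n : ℂ) + 1) ^ (-(s : ℤ))) = fun n : ℕ => (1 / (n + 1 : ℂ) ^ s) := by
      funext n; rw [zpow_neg, zpow_natCast, one_div]
    rw [e1]
    have hs2 : Summable ((fwdDiff 1)^[0] fun n : ℕ => (1 / (n + 1 : ℂ) ^ s)) := by
      have hsum1 : Summable fun n : ℕ => 1 / (n + 1 : ℝ) ^ s := by
        simpa using (summable_nat_add_iff 1).2 (Real.summable_one_div_nat_pow.2 (by omega : 1 < s))
      simpa using ofRealCLM.summable hsum1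
    refine ⟨summable_fwdDiff_iter_of_le (by omega) hs2, ?_⟩
    rw [eulerAlt_eq_of_le (by omega : 0 ≤ K) hs2, (altZeta_of_two_le h2).1]
    rfl

/-- The constants differ by a nonzero multiple of η(r - 2), which is positive as r - 2 ≥ -1. -/
theorem dTildeCrank_ne_dTildeRank {r : ℕ} (hr : 1 ≤ r) : dTildeCrank r ≠ dTildeRank r := by
  have h := altZeta_pos (s := (r : ℤ) - 2) (by omega)
  have h2 : 0 < Real.pi ^ (2 - (r : ℝ)) * 2 ^ ((r : ℝ) - 7 / 2) := by positivity
  rw [dTildeCrank, dTildeRank]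
  intro he
  have := mul_left_cancel₀ h2.ne' (neg_injective he)
  linarith

end Overpart

/-! ### Expansion of a single term of the cofactor series -/

namespace Overpart

open Filter Topology Complex Metric

theorem norm_le_two_mul_re {w : ℂ} (hw : 0 < w.re) (him : |w.im| ≤ w.re) : ‖w‖ ≤ 2 * w.re := by
  refine (Complex.norm_le_abs_re_add_abs_im w).trans ?_
  rw [abs_of_pos hw]; linarith

theorem re_le_norm_two_sinh {w : ℂ} (hw : 0 < w.re) : w.re ≤ ‖2 * Complex.sinh (w / 2)‖ := by
  rw [Complex.sinh, mul_div_cancel₀ _ (two_ne_zero)]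
  have h1 := norm_sub_norm_le (cexp (w / 2)) (cexp (-(w / 2)))
  rw [Complex.norm_exp, Complex.norm_exp] at h1
  have e1 : (w / 2).re = w.re / 2 := by
    rw [show (2 : ℂ) = ((2 : ℝ) : ℂ) by norm_num, Complex.div_ofReal_re]
  rw [Complex.neg_re, e1] at h1
  have h2 := Real.self_le_sinh_iff.2 (by linarith : 0 ≤ w.re / 2)
  rw [Real.sinh_eq] at h2
  linarith

/-- With w/2 = a + ib, |cosh(w/2)|² = sinh²a + cos²b, and sin²b ≤ b² ≤ a² ≤ sinh²a. -/
theorem one_le_norm_cosh {w : ℂ} (hw : 0 < w.re) (him : |w.im| ≤ w.re) :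
    1 ≤ ‖Complex.cosh (w / 2)‖ := by
  set a := w.re / 2 with ha
  set b := w.im / 2 with hb
  have e : w / 2 = a + b * I := by
    rw [ha, hb]; push_cast
    conv_lhs => rw [← Complex.re_add_im w]
    ring
  have h1 : ‖Complex.cosh (w / 2)‖ ^ 2 = Real.sinh a ^ 2 + Real.cos b ^ 2 := by
    rw [e, Complex.cosh_add, Complex.cosh_mul_I, Complex.sinh_mul_I, Complex.sq_norm]
    rw [← Complex.ofReal_cosh, ← Complex.ofReal_sinh, ← Complex.ofReal_cos, ← Complex.ofReal_sin]
    have : (Real.cosh a : ℂ) * (Real.cos b : ℂ) + (Real.sinh a : ℂ) * ((Real.sin b : ℂ) * I) =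
      ((Real.cosh a * Real.cos b : ℝ) : ℂ) + ((Real.sinh a * Real.sin b : ℝ) : ℂ) * I := by
      push_cast; ring
    rw [this, Complex.normSq_add_mul_I]
    have h2 := Real.cosh_sq a
    have h3 := Real.sin_sq_add_cos_sq b
    rw [mul_pow, mul_pow, h2]
    linear_combination (Real.sinh a ^ 2) * h3
  have h2 : |Real.sin b| ≤ Real.sinh a := by
    refine (Real.abs_sin_le_abs).trans ?_
    have : |b| ≤ a := by
      rw [hb, abs_div, abs_two]; linarith
    exact this.trans (Real.self_le_sinh_iff.2 (by linarith))
  have h3 : Real.sin b ^ 2 ≤ Real.sinh a ^ 2 := sq_le_sq' (by linarith [neg_abs_le (Real.sin b)])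
    ((le_abs_self _).trans h2)
  have h4 := Real.sin_sq_add_cos_sq b
  nlinarith [norm_nonneg (Complex.cosh (w / 2))]

/-- The function is even in w, so its expansion at 0 has no linear term. For |w| > 1 the quadratic
bound follows from the uniform bound 2. -/
theorem norm_div_two_sinh_sub_one_le {w : ℂ} (hw : 0 < w.re) (him : |w.im| ≤ w.re) :
    ‖w / (2 * Complex.sinh (w / 2))‖ ≤ 2 ∧ ‖w / (2 * Complex.sinh (w / 2)) - 1‖ ≤ 3 * ‖w‖ ^ 2 := by
  have h1 := re_le_norm_two_sinh hw
  have h2 := norm_le_two_mul_re hw him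
  have hpos : 0 < ‖2 * Complex.sinh (w / 2)‖ := hw.trans_le h1
  have h3 : ‖w / (2 * Complex.sinh (w / 2))‖ ≤ 2 := by
    rw [norm_div, div_le_iff₀ hpos]; linarith
  refine ⟨h3, ?_⟩
  rcases le_or_gt ‖w‖ 1 with h | h
  · have hne : 2 * Complex.sinh (w / 2) ≠ 0 := norm_pos_iff.1 hpos
    have e : w / (2 * Complex.sinh (w / 2)) - 1 =
        (w - 2 * Complex.sinh (w / 2)) / (2 * Complex.sinh (w / 2)) := by
      rw [sub_div, div_self hne]
    have hx : ‖w / 2‖ = ‖w‖ / 2 := by rw [norm_div, Complex.norm_two]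
    have b1 := Complex.exp_bound (x := w / 2) (by rw [hx]; linarith) (n := 3) (by norm_num)
    have b2 := Complex.exp_bound (x := -(w / 2)) (by rw [norm_neg, hx]; linarith) (n := 3)
      (by norm_num)
    rw [norm_neg] at b2
    rw [hx] at b1 b2
    have e2 : w - 2 * Complex.sinh (w / 2) =
        (cexp (-(w / 2)) - ∑ m ∈ Finset.range 3, (-(w / 2)) ^ m / (m.factorial : ℂ)) -
        (cexp (w / 2) - ∑ m ∈ Finset.range 3, (w / 2) ^ m / (m.factorial : ℂ)) := by
      rw [Complex.sinh]
      simp [Finset.sum_range_succ]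
      ring
    have h4 : ‖w - 2 * Complex.sinh (w / 2)‖ ≤ ‖w‖ ^ 3 := by
      rw [e2]
      refine (norm_sub_le _ _).trans ((add_le_add b2 b1).trans ?_)
      norm_num [Nat.factorial]
      have := norm_nonneg w
      nlinarith [pow_nonneg this 3]
    rw [e, norm_div, div_le_iff₀ hpos]
    nlinarith [pow_nonneg (norm_nonneg w) 2, norm_nonneg w,
      mul_le_mul_of_nonneg_left h2 (pow_nonneg (norm_nonneg w) 2),
      mul_le_mul_of_nonneg_left h1 (pow_nonneg (norm_nonneg w) 2)]
  · refine (norm_sub_le _ _).trans ?_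
    rw [norm_one]; nlinarith

theorem norm_inv_cosh_sub_one_le {w : ℂ} (hw : 0 < w.re) (him : |w.im| ≤ w.re) :
    ‖(Complex.cosh (w / 2))⁻¹‖ ≤ 1 ∧ ‖(Complex.cosh (w / 2))⁻¹ - 1‖ ≤ 2 * ‖w‖ ^ 2 := by
  have h1 := one_le_norm_cosh hw him
  have h2 : ‖(Complex.cosh (w / 2))⁻¹‖ ≤ 1 := by rw [norm_inv]; exact inv_le_one_of_one_le₀ h1
  refine ⟨h2, ?_⟩
  rcases le_or_gt ‖w‖ 1 with h | h
  · have hne : Complex.cosh (w / 2) ≠ 0 := norm_pos_iff.1 (by linarith)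
    have e : (Complex.cosh (w / 2))⁻¹ - 1 = -(Complex.cosh (w / 2))⁻¹ * (Complex.cosh (w / 2) - 1) := by
      field_simp; ring
    have hx : ‖w / 2‖ = ‖w‖ / 2 := by rw [norm_div, Complex.norm_two]
    have b1 := Complex.norm_exp_sub_one_sub_id_le (x := w / 2) (by rw [hx]; linarith)
    have b2 := Complex.norm_exp_sub_one_sub_id_le (x := -(w / 2)) (by rw [norm_neg, hx]; linarith)
    rw [norm_neg] at b2
    rw [hx] at b1 b2
    have e2 : Complex.cosh (w / 2) - 1 = ((cexp (w / 2) - 1 - w / 2) +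
        (cexp (-(w / 2)) - 1 - -(w / 2))) / 2 := by
      rw [Complex.cosh]; ring
    have h4 : ‖Complex.cosh (w / 2) - 1‖ ≤ ‖w‖ ^ 2 := by
      rw [e2, norm_div, Complex.norm_two]
      have := norm_add_le (cexp (w / 2) - 1 - w / 2) (cexp (-(w / 2)) - 1 - -(w / 2))
      nlinarith [sq_nonneg ‖w‖]
    rw [e, norm_mul, norm_neg]
    nlinarith [norm_nonneg (Complex.cosh (w / 2))⁻¹, norm_nonneg (Complex.cosh (w / 2) - 1)]
  · refine (norm_sub_le _ _).trans ?_
    rw [norm_one]; nlinarith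

theorem exists_norm_pow_sub_one_le (r : ℕ) :
    ∃ C : ℝ, 0 ≤ C ∧ ∀ x : ℂ, ‖x‖ ≤ 2 → ‖x ^ r - 1‖ ≤ C * ‖x - 1‖ := by
  induction r with
  | zero => exact ⟨0, le_rfl, fun x _ => by simp⟩
  | succ r ih =>
    obtain ⟨C, hC, h⟩ := ih
    refine ⟨C * 2 + 1, by positivity, fun x hx => ?_⟩
    have e : x ^ (r + 1) - 1 = (x ^ r - 1) * x + (x - 1) := by ring
    rw [e]
    refine (norm_add_le _ _).trans ?_
    rw [norm_mul]
    have h1 := h x hx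
    have : ‖x ^ r - 1‖ * ‖x‖ ≤ (C * ‖x - 1‖) * 2 := by gcongr
    linarith

/-- The general term, as a function of a complex variable `z`, of the series defining the
cofactors at `exp (-t)`. -/
noncomputable def cofactorTerm (ψ : ℂ → ℂ) (κ ρ : ℝ) (r : ℕ) (t z : ℂ) : ℂ :=
  cexp (-(κ * t * z ^ 2 + ρ * t * z)) * ((2 * Complex.sinh (t * z / 2)) ^ r)⁻¹ * ψ (t * z)

/-- The conditions on the factor `ψ` under which the cofactor series are analysed. -/
structure NearOne (ψ : ℂ → ℂ) : Prop where
  differentiableAt : ∀ w : ℂ, 0 < w.re → |w.im| ≤ w.re → DifferentiableAt ℂ ψ w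
  norm_le : ∀ w : ℂ, 0 < w.re → |w.im| ≤ w.re → ‖ψ w‖ ≤ 1
  norm_sub_le : ∀ w : ℂ, 0 < w.re → |w.im| ≤ w.re → ‖ψ w - 1‖ ≤ 2 * ‖w‖ ^ 2

theorem nearOne_one : NearOne fun _ => 1 :=
  ⟨fun _ _ _ => by fun_prop, fun _ _ _ => by simp, fun _ _ _ => by simp⟩

theorem nearOne_inv_cosh : NearOne fun w => (Complex.cosh (w / 2))⁻¹ := by
  refine ⟨fun w h1 h2 => ?_, fun w h1 h2 => (norm_inv_cosh_sub_one_le h1 h2).1,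
    fun w h1 h2 => (norm_inv_cosh_sub_one_le h1 h2).2⟩
  have hne : Complex.cosh (w / 2) ≠ 0 := norm_pos_iff.1 (by linarith [one_le_norm_cosh h1 h2])
  exact DifferentiableAt.inv (by fun_prop) hne

/-- Relative to Re t · Re z, the real part of the product is at least 15/16 and the imaginary part
at most 1/2, so the product stays where sinh and cosh have been bounded. -/
theorem mul_mem_cone {t z : ℂ} (ht : 0 < t.re) (htim : |t.im| ≤ t.re / 4) (hz : 0 < z.re)
    (hzim : |z.im| ≤ z.re / 4) : 0 < (t * z).re ∧ |(t * z).im| ≤ (t * z).re ∧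
      |(t * z).im| ≤ 2 * (t * z).re / 3 := by
  have h1 := abs_le.1 htim
  have h2 := abs_le.1 hzim
  have hp := mul_pos ht hz
  have a1 : |t.im * z.im| ≤ t.re * z.re / 16 := by
    rw [abs_mul]
    calc |t.im| * |z.im| ≤ (t.re / 4) * (z.re / 4) := by gcongr
      _ = _ := by ring
  have a2 : |t.re * z.im + t.im * z.re| ≤ t.re * z.re / 2 := by
    refine (abs_add_le _ _).trans ?_
    rw [abs_mul, abs_mul, abs_of_pos ht, abs_of_pos hz]
    have b1 : t.re * |z.im| ≤ t.re * (z.re / 4) := by gcongr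
    have b2 : |t.im| * z.re ≤ (t.re / 4) * z.re := by gcongr
    linarith
  rw [Complex.mul_re, Complex.mul_im]
  have a3 := (abs_le.1 a1).2
  refine ⟨by linarith, by linarith, by linarith⟩

/-- With w = tz and u = κtz² + ρtz, multiplication by t^r turns the term into z^{-r} e^{-u} (w/(2
sinh(w/2)))^r ψ(w). The factors other than e^{-u} are 1 + O(w²), and e^{-u} = 1 - u + O(u²)
uniformly because Re u ≥ 0. As |z| ≥ 1/2, both errors are O(t²z⁴). -/
theorem exists_norm_cofactorTerm_sub_le {ψ : ℂ → ℂ} (hψ : NearOne ψ) {κ ρ : ℝ} (hκ : 0 ≤ κ)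
    (hκ1 : κ ≤ 1) (hρ : 0 ≤ ρ) (hρ1 : ρ ≤ 1) (r : ℕ) :
    ∃ C : ℝ, 0 ≤ C ∧ ∀ t z : ℂ, 0 < t.re → |t.im| ≤ t.re / 4 → 1 / 2 ≤ z.re → |z.im| ≤ z.re / 4 →
      ‖t ^ r * cofactorTerm ψ κ ρ r t z - (z ^ r)⁻¹ * (1 - κ * t * z ^ 2 - ρ * t * z)‖ ≤
        C * ‖t‖ ^ 2 * (‖z‖ ^ 4 / ‖z‖ ^ r) := by
  obtain ⟨C, hC, hpow⟩ := exists_norm_pow_sub_one_le r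
  refine ⟨4 * (2 ^ r * 2 + C * 3) + 27, by positivity, fun t z ht htim hz hzim => ?_⟩
  have hz0 : 0 < z.re := by linarith
  obtain ⟨hw, hwim, hwim'⟩ := mul_mem_cone ht htim hz0 hzim
  set w := t * z with hwd
  have hzne : z ≠ 0 := by rintro rfl; simp at hz0
  have htne : t ≠ 0 := by rintro rfl; simp at ht
  have hsne : 2 * Complex.sinh (w / 2) ≠ 0 :=
    norm_pos_iff.1 (hw.trans_le (re_le_norm_two_sinh hw))
  obtain ⟨x1, x2⟩ := norm_div_two_sinh_sub_one_le hw hwim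
  set x := w / (2 * Complex.sinh (w / 2)) with hx
  have y1 := hψ.norm_le w hw hwim
  have y2 := hψ.norm_sub_le w hw hwim
  set u : ℂ := κ * t * z ^ 2 + ρ * t * z with hu
  have hzn : 1 / 2 ≤ ‖z‖ := hz.trans (Complex.re_le_norm z)
  have hure : 0 ≤ u.re := by
    have e1 : u = (κ : ℂ) * (w * z) + (ρ : ℂ) * w := by rw [hu, hwd]; ring
    have e2 : 0 ≤ (w * z).re := by
      rw [Complex.mul_re]
      have : |w.im * z.im| ≤ w.re * (z.re / 4) := by rw [abs_mul]; gcongr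
      have := (abs_le.1 this).2
      nlinarith [mul_pos hw hz0]
    rw [e1, Complex.add_re, Complex.re_ofReal_mul, Complex.re_ofReal_mul]
    positivity
  have hun : ‖u‖ ≤ 3 * (‖t‖ * ‖z‖ ^ 2) := by
    rw [hu]
    refine (norm_add_le _ _).trans ?_
    simp only [norm_mul, norm_pow, Complex.norm_real, Real.norm_of_nonneg hκ, Real.norm_of_nonneg hρ]
    have a0 := mul_nonneg (norm_nonneg t) (norm_nonneg z)
    have a1 : κ * ‖t‖ * ‖z‖ ^ 2 ≤ 1 * ‖t‖ * ‖z‖ ^ 2 := by gcongr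
    have a2 : ρ * ‖t‖ * ‖z‖ ≤ 1 * ‖t‖ * ‖z‖ := by gcongr
    nlinarith
  have hexp1 : ‖cexp (-u)‖ ≤ 1 := by
    rw [Complex.norm_exp, Real.exp_le_one_iff, Complex.neg_re]; linarith
  -- Taylor's bound for |u| ≤ 1; for larger u the left side is at most 2 + |u|, because |e^{-u}| ≤
  -- 1.
  have hexp2 : ‖cexp (-u) - 1 + u‖ ≤ 3 * ‖u‖ ^ 2 := by
    rcases le_or_gt ‖u‖ 1 with h | h
    · have := Complex.norm_exp_sub_one_sub_id_le (x := -u) (by rwa [norm_neg])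
      rw [norm_neg, sub_neg_eq_add] at this
      nlinarith [sq_nonneg ‖u‖]
    · have h1 := norm_add_le (cexp (-u) - 1) u
      have h2 := norm_sub_le (cexp (-u)) 1
      rw [norm_one] at h2
      nlinarith
  have hΦ : ‖x ^ r * ψ w - 1‖ ≤ (2 ^ r * 2 + C * 3) * ‖w‖ ^ 2 := by
    have e : x ^ r * ψ w - 1 = x ^ r * (ψ w - 1) + (x ^ r - 1) := by ring
    rw [e]
    refine (norm_add_le _ _).trans ?_
    rw [norm_mul, norm_pow]
    have b1 : ‖x‖ ^ r * ‖ψ w - 1‖ ≤ 2 ^ r * (2 * ‖w‖ ^ 2) := by gcongr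
    have b2 : ‖x ^ r - 1‖ ≤ C * (3 * ‖w‖ ^ 2) := (hpow x x1).trans (by gcongr)
    linarith
  have key : t ^ r * cofactorTerm ψ κ ρ r t z - (z ^ r)⁻¹ * (1 - κ * t * z ^ 2 - ρ * t * z) =
      (z ^ r)⁻¹ * (cexp (-u) * (x ^ r * ψ w - 1) + (cexp (-u) - 1 + u)) := by
    rw [cofactorTerm, ← hwd, ← hu, hx, div_pow, hwd, mul_pow, hu]
    have hsr := pow_ne_zero r hsne
    rw [hwd] at hsr
    have hzr := pow_ne_zero r hzne
    field_simp
    ring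
  rw [key, norm_mul, norm_inv, norm_pow, ← div_eq_inv_mul, ← mul_div_assoc]
  apply div_le_div_of_nonneg_right _ (by positivity)
  have hwn : ‖w‖ = ‖t‖ * ‖z‖ := by rw [hwd, norm_mul]
  have c1 : ‖cexp (-u) * (x ^ r * ψ w - 1)‖ ≤ 1 * ((2 ^ r * 2 + C * 3) * ‖w‖ ^ 2) := by
    rw [norm_mul]; gcongr
  have c2 : 3 * ‖u‖ ^ 2 ≤ 3 * (3 * (‖t‖ * ‖z‖ ^ 2)) ^ 2 := by gcongr
  have c3 : ‖z‖ ^ 2 ≤ 4 * ‖z‖ ^ 4 := by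
    have : 1 ≤ 4 * ‖z‖ ^ 2 := by nlinarith
    nlinarith [mul_le_mul_of_nonneg_left this (sq_nonneg ‖z‖)]
  have c4 : (2 ^ r * 2 + C * 3) * ‖w‖ ^ 2 ≤ (2 ^ r * 2 + C * 3) * (‖t‖ ^ 2 * (4 * ‖z‖ ^ 4)) := by
    rw [hwn, mul_pow]; gcongr
  refine (norm_add_le _ _).trans ?_
  nlinarith

end Overpart

/-! ### Second order expansion of the cofactor series -/

namespace Overpart

open Filter Topology Complex Metric

theorem ball_subset_sector {c : ℝ} (hc : 1 ≤ c) {z : ℂ} (hz : z ∈ ball (c : ℂ) (c / 8)) :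
    1 / 2 ≤ z.re ∧ |z.im| ≤ z.re / 4 ∧ c / 2 ≤ ‖z‖ ∧ ‖z‖ ≤ 2 * c := by
  rw [mem_ball, dist_eq_norm] at hz
  have h1 := (Complex.abs_re_le_norm (z - c)).trans hz.le
  have h2 := (Complex.abs_im_le_norm (z - c)).trans hz.le
  simp only [sub_re, ofReal_re, sub_im, ofReal_im, sub_zero] at h1 h2
  have h3 := abs_le.1 h1
  have h4 := Complex.re_le_norm z
  have h5 := norm_add_le (z - c) (c : ℂ)
  rw [sub_add_cancel, Complex.norm_real, Real.norm_of_nonneg (by linarith)] at h5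
  refine ⟨by linarith, by linarith, by linarith, by linarith⟩

theorem differentiableAt_cofactorTerm {ψ : ℂ → ℂ} (hψ : NearOne ψ) (κ ρ : ℝ) (r : ℕ) {t z : ℂ}
    (ht : 0 < t.re) (htim : |t.im| ≤ t.re / 4) (hz : 1 / 2 ≤ z.re) (hzim : |z.im| ≤ z.re / 4) :
    DifferentiableAt ℂ (cofactorTerm ψ κ ρ r t) z := by
  obtain ⟨hw, hwim, -⟩ := mul_mem_cone ht htim (by linarith) hzim
  have hsne : 2 * Complex.sinh (t * z / 2) ≠ 0 :=
    norm_pos_iff.1 (hw.trans_le (re_le_norm_two_sinh hw))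
  have h1 := hψ.differentiableAt _ hw hwim
  have h2 : DifferentiableAt ℂ (fun z => ψ (t * z)) z :=
    DifferentiableAt.comp (f := fun z => t * z) z h1 (by fun_prop)
  unfold cofactorTerm
  refine DifferentiableAt.mul (DifferentiableAt.mul (by fun_prop) ?_) h2
  exact DifferentiableAt.inv (by fun_prop) (pow_ne_zero _ hsne)

/-- The remainder of the term of a cofactor series after its three leading terms. -/
noncomputable def cofactorRem (ψ : ℂ → ℂ) (κ ρ : ℝ) (r : ℕ) (t z : ℂ) : ℂ :=
  t ^ r * cofactorTerm ψ κ ρ r t z - (z ^ r)⁻¹ * (1 - κ * t * z ^ 2 - ρ * t * z)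

/-- The remainder is analytic and O(t² |z|^{4-r}) in a sector, so five differences reduce it to O(t²
n^{-1-r}), which is summable for r ≥ 1. Small n are bounded trivially. -/
theorem exists_norm_fwdDiff_cofactorRem_le {ψ : ℂ → ℂ} (hψ : NearOne ψ) {κ ρ : ℝ} (hκ : 0 ≤ κ)
    (hκ1 : κ ≤ 1) (hρ : 0 ≤ ρ) (hρ1 : ρ ≤ 1) {r : ℕ} (hr : 1 ≤ r) :
    ∃ C : ℝ, 0 ≤ C ∧ ∀ t : ℂ, 0 < t.re → |t.im| ≤ t.re / 4 →
      (∀ j < 5, ‖(fwdDiff 1)^[j] (fun n : ℕ => cofactorRem ψ κ ρ r t (n + 1)) 0‖ ≤ C * ‖t‖ ^ 2) ∧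
      ∀ n : ℕ, ‖(fwdDiff 1)^[5] (fun n : ℕ => cofactorRem ψ κ ρ r t (n + 1)) n‖ ≤
        C * ‖t‖ ^ 2 * (1 / ((n : ℝ) + 1) ^ 2) := by
  obtain ⟨C, hC, hmain⟩ := exists_norm_cofactorTerm_sub_le hψ hκ hκ1 hρ hρ1 r
  -- Five differences at an index n ≤ 79 reach indices up to 84, that is, arguments up to 85.
  have hsmall : ∀ t : ℂ, 0 < t.re → |t.im| ≤ t.re / 4 → ∀ m : ℕ, m ≤ 84 →
      ‖cofactorRem ψ κ ρ r t (m + 1)‖ ≤ C * ‖t‖ ^ 2 * 85 ^ 4 := by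
    intro t ht htim m hm
    have h := hmain t (m + 1) ht htim (by simp; linarith [Nat.cast_nonneg (α := ℝ) m])
      (by simp; positivity)
    refine h.trans ?_
    have hn : ‖(m : ℂ) + 1‖ = m + 1 := by
      rw [← Nat.cast_add_one, Complex.norm_natCast]; push_cast; rfl
    rw [hn]
    gcongr
    have h1 : (1 : ℝ) ≤ (m : ℝ) + 1 := by linarith [Nat.cast_nonneg (α := ℝ) m]
    have h2 : (m : ℝ) + 1 ≤ 85 := by
      have : (m : ℝ) ≤ 84 := by exact_mod_cast hm
      linarith
    refine (div_le_self (by positivity) (one_le_pow₀ h1)).trans ?_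
    gcongr
  set D : ℝ := C * (16 * 2 ^ r * 80 ^ 5) + C * (32 * 85 ^ 4 * 81 ^ 2) with hD
  have hD0 : 0 ≤ D := by positivity
  refine ⟨D, hD0, fun t ht htim => ⟨fun j hj => ?_, fun n => ?_⟩⟩
  · have h1 := norm_fwdDiff_iter_le_of_bound (g := fun n : ℕ => cofactorRem ψ κ ρ r t (n + 1))
      (K := j) (n := 0) (B := C * ‖t‖ ^ 2 * 85 ^ 4) (fun m hm => hsmall t ht htim m (by omega))
    refine h1.trans ?_
    have h2 : (2 : ℝ) ^ j ≤ 2 ^ 5 := pow_le_pow_right₀ (by norm_num) hj.le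
    calc (2 : ℝ) ^ j * (C * ‖t‖ ^ 2 * 85 ^ 4) ≤ 2 ^ 5 * (C * ‖t‖ ^ 2 * 85 ^ 4) := by gcongr
      _ ≤ D * ‖t‖ ^ 2 := by
        have : (2 : ℝ) ^ 5 * (C * 85 ^ 4) ≤ D := by
          have : 0 ≤ C * (16 * 2 ^ r * 80 ^ 5) := by positivity
          rw [hD]; nlinarith
        nlinarith [mul_le_mul_of_nonneg_right this (sq_nonneg ‖t‖)]
  · rcases lt_or_ge n 80 with hn | hn
    · have h1 := norm_fwdDiff_iter_le_of_bound (g := fun n : ℕ => cofactorRem ψ κ ρ r t (n + 1))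
        (K := 5) (n := n) (B := C * ‖t‖ ^ 2 * 85 ^ 4) (fun m hm => hsmall t ht htim m (by omega))
      refine h1.trans ?_
      rw [mul_one_div, le_div_iff₀ (by positivity)]
      have h2 : ((n : ℝ) + 1) ^ 2 ≤ 81 ^ 2 := by
        have : (n : ℝ) + 1 ≤ 81 := by
          have : (n : ℝ) ≤ 80 := by exact_mod_cast hn.le
          linarith
        gcongr
      calc (2 : ℝ) ^ 5 * (C * ‖t‖ ^ 2 * 85 ^ 4) * ((n : ℝ) + 1) ^ 2
          ≤ (2 : ℝ) ^ 5 * (C * ‖t‖ ^ 2 * 85 ^ 4) * 81 ^ 2 := by gcongr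
        _ = C * (32 * 85 ^ 4 * 81 ^ 2) * ‖t‖ ^ 2 := by ring
        _ ≤ D * ‖t‖ ^ 2 := by
          gcongr
          rw [hD]
          linarith [show 0 ≤ C * (16 * 2 ^ r * 80 ^ 5) by positivity]
    · rw [fwdDiff_iter_nat (cofactorRem ψ κ ρ r t)]
      set c : ℝ := n + 1 with hc
      have hc81 : 81 ≤ c := by
        have : (80 : ℝ) ≤ n := by exact_mod_cast hn
        linarith
      have hcc : (n : ℂ) + 1 = (c : ℂ) := by rw [hc]; push_cast; rfl
      -- Within distance c/8 of c the sector conditions hold. Five steps with h = c/80 use up 5 +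
      -- c/16 of this radius, and the remaining c/16 - 5 is positive since c ≥ 81.
      have hR : c / 16 - 5 + ((5 : ℕ) : ℝ) * (1 + c / 80) = c / 8 := by push_cast; ring
      have hB : ∀ z ∈ ball (c : ℂ) (c / 16 - 5 + ((5 : ℕ) : ℝ) * (1 + c / 80)),
          ‖cofactorRem ψ κ ρ r t z‖ ≤ C * ‖t‖ ^ 2 * (16 * 2 ^ r * (c ^ 4 / c ^ r)) := by
        intro z hz
        rw [hR] at hz
        obtain ⟨h1, h2, h3, h4⟩ := ball_subset_sector (by linarith) hz
        refine (hmain t z ht htim h1 h2).trans ?_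
        gcongr
        calc ‖z‖ ^ 4 / ‖z‖ ^ r ≤ (2 * c) ^ 4 / (c / 2) ^ r := by gcongr
          _ = 16 * 2 ^ r * (c ^ 4 / c ^ r) := by rw [div_pow]; field_simp; norm_num
      have hdiff : DifferentiableOn ℂ (cofactorRem ψ κ ρ r t)
          (ball (c : ℂ) (c / 16 - 5 + ((5 : ℕ) : ℝ) * (1 + c / 80))) := by
        intro z hz
        rw [hR] at hz
        obtain ⟨h1, h2, h3, h4⟩ := ball_subset_sector (by linarith) hz
        have hzne : z ≠ 0 := norm_pos_iff.1 (by linarith)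
        have d1 := differentiableAt_cofactorTerm hψ κ ρ r ht htim h1 h2
        apply DifferentiableAt.differentiableWithinAt
        unfold cofactorRem
        refine DifferentiableAt.sub (d1.const_mul _) (DifferentiableAt.mul ?_ (by fun_prop))
        exact DifferentiableAt.inv (by fun_prop) (pow_ne_zero _ hzne)
      have h := norm_fwdDiff_iter_le (c := (c : ℂ)) (R := c / 16 - 5) (h := c / 80) (by positivity) 5
        hdiff hB (c : ℂ) (mem_ball_self (by linarith))
      rw [hcc]
      refine h.trans ?_
      have hc0 : 0 < c := by linarith
      have hcr : c ^ 1 ≤ c ^ r := pow_le_pow_right₀ (by linarith) hr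
      -- Five is the number of differences that brings c^{4-r} down to c^{-1-r}, at most c^{-2} for
      -- r ≥ 1.
      have e : C * ‖t‖ ^ 2 * (16 * 2 ^ r * (c ^ 4 / c ^ r)) / (c / 80) ^ 5 =
          C * (16 * 2 ^ r * 80 ^ 5) * ‖t‖ ^ 2 * (1 / (c * c ^ r)) := by
        field_simp
      rw [e]
      have h5 : 1 / (c * c ^ r) ≤ 1 / c ^ 2 := by
        apply one_div_le_one_div_of_le (by positivity)
        nlinarith
      have h6 : C * (16 * 2 ^ r * 80 ^ 5) ≤ D := by
        rw [hD]; linarith [show 0 ≤ C * (32 * 85 ^ 4 * 81 ^ 2) by positivity]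
      gcongr

/-- The Euler transform of order five is applied to the decomposition of the term into its three
leading powers and the remainder. For the full term it is the ordinary alternating sum, for the
powers it gives alternating zeta values, and for the remainder it is O(t²). -/
theorem exists_norm_tsum_cofactorTerm_sub_le {ψ : ℂ → ℂ} (hψ : NearOne ψ) {κ ρ : ℝ} (hκ : 0 ≤ κ)
    (hκ1 : κ ≤ 1) (hρ : 0 ≤ ρ) (hρ1 : ρ ≤ 1) {r : ℕ} (hr : 1 ≤ r) :
    ∃ C : ℝ, 0 ≤ C ∧ ∀ t : ℂ, 0 < t.re → |t.im| ≤ t.re / 4 →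
      Summable (fun n : ℕ => cofactorTerm ψ κ ρ r t (n + 1)) →
      ‖t ^ r * ∑' n : ℕ, (-1) ^ n * cofactorTerm ψ κ ρ r t (n + 1) -
        (altZeta r - t * (κ * altZeta (r - 2) + ρ * altZeta (r - 1)))‖ ≤ C * ‖t‖ ^ 2 := by
  obtain ⟨C, hC, h⟩ := exists_norm_fwdDiff_cofactorRem_le hψ hκ hκ1 hρ hρ1 hr
  have hsum1 : Summable fun n : ℕ => 1 / (n + 1 : ℝ) ^ 2 := by
    simpa using (summable_nat_add_iff 1).2 (Real.summable_one_div_nat_pow.2 (by norm_num : 1 < 2))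
  set Z := ∑' n : ℕ, 1 / (n + 1 : ℝ) ^ 2 with hZ
  have hZ0 : 0 ≤ Z := tsum_nonneg fun n => by positivity
  refine ⟨5 * C + C * Z, by positivity, fun t ht htim hs => ?_⟩
  obtain ⟨h0, h5⟩ := h t ht htim
  have z0 := eulerAlt_zpow (s := r) (by omega) (K := 5) (by norm_num)
  have z1 := eulerAlt_zpow (s := (r : ℤ) - 1) (by omega) (K := 5) (by norm_num)
  have z2 := eulerAlt_zpow (s := (r : ℤ) - 2) (by omega) (K := 5) (by norm_num)
  have s5 : Summable ((fwdDiff 1)^[5] fun n : ℕ => cofactorRem ψ κ ρ r t (n + 1)) :=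
    Summable.of_norm_bounded (hsum1.mul_left (C * ‖t‖ ^ 2)) h5
  have hbound := norm_eulerAlt_le (hsum1.hasSum.mul_left (C * ‖t‖ ^ 2)) h0 h5
  have m1 : Summable ((fwdDiff 1)^[5] fun n : ℕ => (-(ρ * t)) * ((n : ℂ) + 1) ^ (-((r : ℤ) - 1))) := by
    rw [fwdDiff_iter_smul']; exact z1.1.mul_left _
  have m2 : Summable ((fwdDiff 1)^[5] fun n : ℕ => (-(κ * t)) * ((n : ℂ) + 1) ^ (-((r : ℤ) - 2))) := by
    rw [fwdDiff_iter_smul']; exact z2.1.mul_left _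
  have a1 := eulerAlt_add z0.1 m1
  have b1 : Summable ((fwdDiff 1)^[5] fun n : ℕ => ((n : ℂ) + 1) ^ (-(r : ℤ)) +
      (-(ρ * t)) * ((n : ℂ) + 1) ^ (-((r : ℤ) - 1))) := by
    rw [fwdDiff_iter_add']; exact z0.1.add m1
  have a2 := eulerAlt_add b1 m2
  have b2 : Summable ((fwdDiff 1)^[5] fun n : ℕ => (((n : ℂ) + 1) ^ (-(r : ℤ)) +
      (-(ρ * t)) * ((n : ℂ) + 1) ^ (-((r : ℤ) - 1))) +
      (-(κ * t)) * ((n : ℂ) + 1) ^ (-((r : ℤ) - 2))) := by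
    rw [fwdDiff_iter_add']; exact b1.add m2
  have a3 := eulerAlt_add s5 b2
  have e : (fun n : ℕ => cofactorRem ψ κ ρ r t (n + 1) + ((((n : ℂ) + 1) ^ (-(r : ℤ)) +
      (-(ρ * t)) * ((n : ℂ) + 1) ^ (-((r : ℤ) - 1))) +
      (-(κ * t)) * ((n : ℂ) + 1) ^ (-((r : ℤ) - 2)))) =
      fun n : ℕ => t ^ r * cofactorTerm ψ κ ρ r t (n + 1) := by
    funext n
    have hn : (n : ℂ) + 1 ≠ 0 := by exact_mod_cast n.succ_ne_zero
    have e1 : ((n : ℂ) + 1) ^ (-((r : ℤ) - 1)) = (((n : ℂ) + 1) ^ r)⁻¹ * (n + 1) := by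
      rw [neg_sub, sub_eq_neg_add, zpow_add₀ hn, zpow_neg, zpow_natCast, zpow_one]
    have e2 : ((n : ℂ) + 1) ^ (-((r : ℤ) - 2)) = (((n : ℂ) + 1) ^ r)⁻¹ * (n + 1) ^ 2 := by
      rw [neg_sub, sub_eq_neg_add, zpow_add₀ hn, zpow_neg, zpow_natCast]; norm_cast
    rw [e1, e2, zpow_neg, zpow_natCast, cofactorRem]
    ring
  rw [e, eulerAlt_const_mul, a2, a1, eulerAlt_const_mul, eulerAlt_const_mul, z0.2, z1.2, z2.2,
    eulerAlt_eq_of_le (Nat.zero_le 5) (by simpa using hs)] at a3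
  have e3 : t ^ r * ∑' n : ℕ, (-1) ^ n * cofactorTerm ψ κ ρ r t (n + 1) -
        (altZeta r - t * (κ * altZeta (r - 2) + ρ * altZeta (r - 1))) =
      eulerAlt 5 (fun n : ℕ => cofactorRem ψ κ ρ r t (n + 1)) := by
    simp only [eulerAlt] at a3 ⊢
    rw [a3]; ring
  rw [e3]
  refine hbound.trans (le_of_eq ?_)
  push_cast; ring

theorem one_sub_exp_neg (w : ℂ) :
    1 - cexp (-w) = 2 * Complex.sinh (w / 2) * cexp (-(w / 2)) := by
  rw [Complex.sinh, mul_div_cancel₀ _ two_ne_zero, sub_mul, ← Complex.exp_add, ← Complex.exp_add,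
    show w / 2 + -(w / 2) = 0 by ring, show -(w / 2) + -(w / 2) = -w by ring, Complex.exp_zero]

theorem one_add_exp_neg (w : ℂ) :
    1 + cexp (-w) = 2 * Complex.cosh (w / 2) * cexp (-(w / 2)) := by
  rw [Complex.cosh, mul_div_cancel₀ _ two_ne_zero, add_mul, ← Complex.exp_add, ← Complex.exp_add,
    show w / 2 + -(w / 2) = 0 by ring, show -(w / 2) + -(w / 2) = -w by ring, Complex.exp_zero]

/-- This is how the parity constant arises: it is the linear coefficient left over when the exponent
r/2 from (1 - q^n)^{-r} is combined with the floor in the binomial coefficient. -/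
theorem half_sub_eq_rho {r : ℕ} (hr : 1 ≤ r) :
    ((r - 1 - (r - 1) / 2 : ℕ) : ℝ) = r / 2 + rho r - 1 / 2 := by
  rw [rho]
  split_ifs with h
  · obtain ⟨k, rfl⟩ := h
    rw [show 2 * k + 1 - 1 - (2 * k + 1 - 1) / 2 = k by omega]
    push_cast; ring
  · obtain ⟨k, rfl⟩ := Nat.not_odd_iff_even.1 h
    rw [show k + k - 1 - (k + k - 1) / 2 = k by omega]
    push_cast; ring

theorem rho_nonneg (r : ℕ) : 0 ≤ rho r := by rw [rho]; split_ifs <;> norm_num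

theorem rho_le_one (r : ℕ) : rho r ≤ 1 := by rw [rho]; split_ifs <;> norm_num

/-- With z = n + 1, writing 1 - e^{-tz} as 2 sinh(tz/2)e^{-tz/2} changes the exponent of e^{-t} from
z(z+1)/2 + sz to z²/2 + ρz. -/
theorem crank_term_eq {r : ℕ} (hr : 1 ≤ r) (t : ℂ) (n : ℕ) :
    cexp (-t) ^ ((n + 2).choose 2) * (cexp (-t) ^ (n + 1)) ^ (r - 1 - (r - 1) / 2) /
      (1 - cexp (-t) ^ (n + 1)) ^ r = cofactorTerm (fun _ => 1) (1 / 2 : ℝ) (rho r) r t (n + 1) := by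
  have e1 : cexp (-t) ^ (n + 1) = cexp (-(t * (n + 1))) := by
    rw [← Complex.exp_nat_mul]; push_cast; congr 1; ring
  have hs : ((r - 1 - (r - 1) / 2 : ℕ) : ℂ) = r / 2 + rho r - 1 / 2 := by
    rw [← Complex.ofReal_natCast, half_sub_eq_rho hr]; push_cast; rfl
  rw [e1, one_sub_exp_neg, cofactorTerm, mul_pow, ← div_div, mul_one, div_eq_mul_inv _ (cexp _ ^ r),
    ← Complex.exp_nat_mul, ← Complex.exp_nat_mul, ← Complex.exp_nat_mul, ← Complex.exp_neg,
    div_mul_eq_mul_div, div_eq_mul_inv, ← Complex.exp_add, ← Complex.exp_add, Nat.cast_choose_two, hs]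
  congr 2
  push_cast
  ring

/-- As for the crank, with 1 + e^{-tz} = 2 cosh(tz/2)e^{-tz/2} in addition: the 2 cancels the factor
2 of the numerator, and the exponent z(z+1) + sz becomes z² + ρz. -/
theorem rank_term_eq {r : ℕ} (hr : 1 ≤ r) (t : ℂ) (n : ℕ) :
    2 * cexp (-t) ^ ((n + 1) * (n + 2)) * (cexp (-t) ^ (n + 1)) ^ (r - 1 - (r - 1) / 2) /
      ((1 + cexp (-t) ^ (n + 1)) * (1 - cexp (-t) ^ (n + 1)) ^ r) =
      cofactorTerm (fun w => (Complex.cosh (w / 2))⁻¹) (1 : ℝ) (rho r) r t (n + 1) := by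
  have e1 : cexp (-t) ^ (n + 1) = cexp (-(t * (n + 1))) := by
    rw [← Complex.exp_nat_mul]; push_cast; congr 1; ring
  have hs : ((r - 1 - (r - 1) / 2 : ℕ) : ℂ) = r / 2 + rho r - 1 / 2 := by
    rw [← Complex.ofReal_natCast, half_sub_eq_rho hr]; push_cast; rfl
  have e2 : cexp (-t) ^ ((n + 1) * (n + 2)) * cexp (-(t * (n + 1))) ^ (r - 1 - (r - 1) / 2) =
      cexp (-(((1 : ℝ) : ℂ) * t * (n + 1) ^ 2 + rho r * t * (n + 1))) *
        (cexp (-(t * (n + 1) / 2)) * cexp (-(t * (n + 1) / 2)) ^ r) := by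
    rw [← Complex.exp_nat_mul, ← Complex.exp_nat_mul, ← Complex.exp_nat_mul, hs,
      ← Complex.exp_add, ← Complex.exp_add, ← Complex.exp_add]
    congr 1
    push_cast
    ring
  rw [e1, one_sub_exp_neg, one_add_exp_neg, cofactorTerm, mul_assoc 2, e2, mul_pow]
  have h1 := Complex.exp_ne_zero (-(t * (n + 1) / 2))
  have h2 := pow_ne_zero r h1
  rw [div_eq_mul_inv]
  simp only [mul_inv]
  field_simp

end Overpart

/-! ### Major and minor arc estimates for both generating functions -/

namespace Overpart

open Filter Topology Complex Metric

theorem norm_crank_term_le (r : ℕ) {q : ℂ} (hq : ‖q‖ < 1) (n : ℕ) :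
    ‖q ^ (n + 2).choose 2 * (q ^ (n + 1)) ^ (r - 1 - (r - 1) / 2) / (1 - q ^ (n + 1)) ^ r‖ ≤
      2 / (1 - ‖q‖) ^ (r + 1) * ‖q‖ ^ n := by
  have h0 := norm_nonneg q
  have h1 : 0 < 1 - ‖q‖ := by linarith
  have h2 := (one_sub_le_norm_one_add_pow hq n).2
  have hch : n ≤ (n + 2).choose 2 := by
    rw [Nat.choose_two_right, Nat.le_div_iff_mul_le (by norm_num)]
    simp; nlinarith
  rw [norm_div, norm_mul, norm_pow, norm_pow, norm_pow, norm_pow]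
  have h3 : ‖q‖ ^ (n + 2).choose 2 ≤ ‖q‖ ^ n := pow_le_pow_of_le_one h0 hq.le hch
  have h4 : (‖q‖ ^ (n + 1)) ^ (r - 1 - (r - 1) / 2) ≤ 1 :=
    pow_le_one₀ (by positivity) (pow_le_one₀ h0 hq.le)
  calc ‖q‖ ^ (n + 2).choose 2 * (‖q‖ ^ (n + 1)) ^ (r - 1 - (r - 1) / 2) / ‖1 - q ^ (n + 1)‖ ^ r
      ≤ ‖q‖ ^ n * 1 / (1 - ‖q‖) ^ r := by gcongr
    _ = 1 / (1 - ‖q‖) ^ r * ‖q‖ ^ n := by ring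
    _ ≤ 2 / (1 - ‖q‖) ^ (r + 1) * ‖q‖ ^ n := by
      gcongr ?_ / ?_ * _
      · norm_num
      · exact pow_le_pow_of_le_one h1.le (by linarith) (by omega)

theorem norm_rank_term_le (r : ℕ) {q : ℂ} (hq : ‖q‖ < 1) (n : ℕ) :
    ‖2 * q ^ ((n + 1) * (n + 2)) * (q ^ (n + 1)) ^ (r - 1 - (r - 1) / 2) /
      ((1 + q ^ (n + 1)) * (1 - q ^ (n + 1)) ^ r)‖ ≤ 2 / (1 - ‖q‖) ^ (r + 1) * ‖q‖ ^ n := by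
  have h0 := norm_nonneg q
  have h1 : 0 < 1 - ‖q‖ := by linarith
  obtain ⟨h2, h2'⟩ := one_sub_le_norm_one_add_pow hq n
  rw [norm_div, norm_mul, norm_mul, norm_mul, norm_pow, norm_pow, norm_pow, norm_pow,
    Complex.norm_two]
  have h3 : ‖q‖ ^ ((n + 1) * (n + 2)) ≤ ‖q‖ ^ n := pow_le_pow_of_le_one h0 hq.le (by nlinarith)
  have h4 : (‖q‖ ^ (n + 1)) ^ (r - 1 - (r - 1) / 2) ≤ 1 :=
    pow_le_one₀ (by positivity) (pow_le_one₀ h0 hq.le)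
  calc 2 * ‖q‖ ^ ((n + 1) * (n + 2)) * (‖q‖ ^ (n + 1)) ^ (r - 1 - (r - 1) / 2) /
      (‖1 + q ^ (n + 1)‖ * ‖1 - q ^ (n + 1)‖ ^ r)
      ≤ 2 * ‖q‖ ^ n * 1 / ((1 - ‖q‖) * (1 - ‖q‖) ^ r) := by gcongr
    _ = _ := by rw [pow_succ']; ring

theorem norm_tsum_alt_le {b : ℕ → ℂ} {K ρ : ℝ} (h0 : 0 ≤ ρ) (h1 : ρ < 1)
    (hb : ∀ n, ‖b n‖ ≤ K * ρ ^ n) :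
    Summable b ∧ ‖∑' n, (-1) ^ n * b n‖ ≤ K / (1 - ρ) := by
  have hs := (hasSum_geometric_of_lt_one h0 h1).mul_left K
  refine ⟨Summable.of_norm_bounded hs.summable hb, ?_⟩
  rw [div_eq_mul_inv]
  exact tsum_of_norm_bounded hs fun n => by simpa using hb n

/-- The analytic properties of a generating function that determine the asymptotic behaviour of its
coefficients up to the second order. -/
structure CircleData (r : ℕ) (α β : ℝ) (F : ℂ → ℂ) : Prop where
  major : ∃ C : ℝ, 0 ≤ C ∧ ∀ t : ℂ, 0 < t.re → |t.im| ≤ t.re / 4 → ‖t‖ ≤ 1 →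
    ‖t ^ r * F (cexp (-t)) - overMain t * (α + β * t)‖ ≤ C * ‖t‖ ^ 2 * ‖overMain t‖
  minor : ∃ C : ℝ, 0 ≤ C ∧ ∀ c y : ℝ, 0 < c → c ≤ 1 → c / 4 ≤ |y| → |y| ≤ Real.pi →
    ‖F (cexp (-(c + y * I)))‖ ≤
      C * (1 / c ^ (r + 2)) * Real.exp ((Real.pi ^ 2 / 4 - 1 / 4000) / c)

theorem circleData_overFun_mul {r : ℕ} (hr : 1 ≤ r) {ψ : ℂ → ℂ} (hψ : NearOne ψ) {κ : ℝ}
    (hκ : 0 ≤ κ) (hκ1 : κ ≤ 1) {b : ℂ → ℕ → ℂ} {f : ℂ → ℂ}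
    (hf : ∀ q, f q = ∑' n : ℕ, (-1) ^ n * b q n)
    (hb : ∀ q : ℂ, ‖q‖ < 1 → ∀ n, ‖b q n‖ ≤ 2 / (1 - ‖q‖) ^ (r + 1) * ‖q‖ ^ n)
    (hbt : ∀ t n, b (cexp (-t)) n = cofactorTerm ψ κ (rho r) r t (n + 1)) :
    CircleData r (altZeta r) (-(κ * altZeta (r - 2) + rho r * altZeta (r - 1)))
      (fun q => overFun q * f q) := by
  constructor
  · obtain ⟨C, hC, h⟩ := exists_norm_tsum_cofactorTerm_sub_le hψ hκ hκ1 (rho_nonneg r)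
      (rho_le_one r) hr
    set α : ℂ := ((altZeta r : ℝ) : ℂ) with hα
    set β : ℂ := ((-(κ * altZeta (r - 2) + rho r * altZeta (r - 1)) : ℝ) : ℂ) with hβ
    refine ⟨C + (‖α‖ + ‖β‖ + C), by positivity, fun t ht htim ht1 => ?_⟩
    have hq : ‖cexp (-t)‖ < 1 := by rw [Complex.norm_exp]; simpa using ht
    have hE := norm_overFun_sub_overMain_le ht htim ht1
    have hs : Summable fun n : ℕ => cofactorTerm ψ κ (rho r) r t (n + 1) := by
      exact (norm_tsum_alt_le (norm_nonneg _) hq (hb _ hq)).1.congr fun n => hbt t n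
    have hS := h t ht htim hs
    have e1 : f (cexp (-t)) = ∑' n : ℕ, (-1) ^ n * cofactorTerm ψ κ (rho r) r t (n + 1) := by
      rw [hf]; simp only [hbt]
    rw [← e1] at hS
    set S := f (cexp (-t))
    set V := overFun (cexp (-t))
    set E := overMain t
    have e2 : (altZeta r : ℂ) - t * (κ * altZeta (r - 2) + rho r * altZeta (r - 1)) =
        α + β * t := by rw [hα, hβ]; push_cast; ring
    rw [e2] at hS
    -- The error of the cofactor is weighted by the main term of P, and the relative error O(t²) of
    -- P by the bounded cofactor.
    have e3 : t ^ r * (V * S) - E * (α + β * t) =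
        E * (t ^ r * S - (α + β * t)) + (V - E) * ((α + β * t) + (t ^ r * S - (α + β * t))) := by
      ring
    have h1 : ‖α + β * t‖ ≤ ‖α‖ + ‖β‖ := by
      refine (norm_add_le _ _).trans ?_
      rw [norm_mul]
      nlinarith [norm_nonneg β]
    have h2 : C * ‖t‖ ^ 2 ≤ C * 1 ^ 2 := by gcongr
    have h3 : ‖(α + β * t) + (t ^ r * S - (α + β * t))‖ ≤ ‖α‖ + ‖β‖ + C :=
      (norm_add_le _ _).trans (by linarith)
    rw [e3]
    refine (norm_add_le _ _).trans ?_
    rw [norm_mul, norm_mul]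
    calc ‖E‖ * ‖t ^ r * S - (α + β * t)‖ +
        ‖V - E‖ * ‖(α + β * t) + (t ^ r * S - (α + β * t))‖
        ≤ ‖E‖ * (C * ‖t‖ ^ 2) + (‖t‖ ^ 2 * ‖E‖) * (‖α‖ + ‖β‖ + C) := by gcongr
      _ = _ := by ring
  · refine ⟨2 * 3 ^ (r + 2), by positivity, fun c y hc hc1 hy hyπ => ?_⟩
    have hE := norm_overFun_minor_le hc hc1 hy hyπ
    set q := cexp (-(c + y * I)) with hqd
    have hqn : ‖q‖ = Real.exp (-c) := by rw [hqd, Complex.norm_exp]; simp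
    have hq : ‖q‖ < 1 := by rw [hqn, Real.exp_lt_one_iff]; linarith
    -- From 1 - e^{-c} ≥ ce^{-c} ≥ c/e for c ≤ 1.
    have hlow : c / 3 ≤ 1 - ‖q‖ := by
      rw [hqn]
      have h1 : Real.exp (-1) ≤ Real.exp (-c) := Real.exp_le_exp.2 (by linarith)
      have h2 := Real.exp_neg_one_gt_d9
      have h3 := Real.add_one_le_exp c
      have h4 : Real.exp (-c) * Real.exp c = 1 := by rw [← Real.exp_add]; simp
      have h5 := mul_le_mul_of_nonneg_left h3 (Real.exp_pos (-c)).le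
      nlinarith
    have h1 := (norm_tsum_alt_le (norm_nonneg _) hq (hb _ hq)).2
    rw [← hf, div_div, ← pow_succ] at h1
    have h2 : 2 / (1 - ‖q‖) ^ (r + 1 + 1) ≤ 2 / (c / 3) ^ (r + 1 + 1) := by
      gcongr
    have h3 : 2 / (c / 3) ^ (r + 1 + 1) = 2 * 3 ^ (r + 2) * (1 / c ^ (r + 2)) := by
      rw [div_pow]; field_simp
    rw [norm_mul, mul_comm]
    exact mul_le_mul (h1.trans (h2.trans h3.le)) hE (norm_nonneg _) (by positivity)

theorem circleData_crank {r : ℕ} (hr : 1 ≤ r) :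
    CircleData r (altZeta r) (-((1 / 2 : ℝ) * altZeta (r - 2) + rho r * altZeta (r - 1)))
      (fun q => overFun q * crankCofactor r q) :=
  circleData_overFun_mul hr nearOne_one (by norm_num) (by norm_num) (fun _ => rfl)
    (fun _ hq n => norm_crank_term_le r hq n) (fun t n => crank_term_eq hr t n)

theorem circleData_rank {r : ℕ} (hr : 1 ≤ r) :
    CircleData r (altZeta r) (-((1 : ℝ) * altZeta (r - 2) + rho r * altZeta (r - 1)))
      (fun q => overFun q * rankCofactor r q) :=
  circleData_overFun_mul hr nearOne_inv_cosh (by norm_num) (by norm_num) (fun _ => rfl)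
    (fun _ hq n => norm_rank_term_le r hq n) (fun t n => rank_term_eq hr t n)

end Overpart

/-! ### Laplace transforms of powers and their inversion -/

namespace Overpart

open Filter Topology Complex MeasureTheory Set

theorem integrableOn_rpow_mul_exp_neg {s b : ℝ} (hs : -1 < s) (hb : 0 < b) :
    IntegrableOn (fun x : ℝ => x ^ s * Real.exp (-b * x)) (Ioi 0) := by
  simpa using integrableOn_rpow_mul_exp_neg_mul_rpow hs zero_lt_one hb

theorem measurable_rpow_mul_cexp (s : ℝ) (z : ℂ) :
    Measurable fun x : ℝ => ((x ^ s : ℝ) : ℂ) * cexp (-(z * x)) :=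
  (Complex.measurable_ofReal.comp (measurable_id.pow_const s)).mul (by fun_prop)

theorem norm_rpow_mul_cexp (s : ℝ) (z : ℂ) {x : ℝ} (hx : 0 < x) :
    ‖((x ^ s : ℝ) : ℂ) * cexp (-(z * x))‖ = x ^ s * Real.exp (-z.re * x) := by
  rw [norm_mul, Complex.norm_real, Real.norm_of_nonneg (Real.rpow_nonneg hx.le _),
    Complex.norm_exp]
  simp

theorem integrableOn_rpow_mul_cexp {s : ℝ} (hs : -1 < s) {z : ℂ} (hz : 0 < z.re) :
    IntegrableOn (fun x : ℝ => ((x ^ s : ℝ) : ℂ) * cexp (-(z * x))) (Ioi 0) := by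
  refine Integrable.mono' (integrableOn_rpow_mul_exp_neg hs hz)
    (measurable_rpow_mul_cexp s z).aestronglyMeasurable ?_
  filter_upwards [ae_restrict_mem measurableSet_Ioi] with x hx
  exact (norm_rpow_mul_cexp s z hx).le

theorem differentiableAt_laplace_rpow {s : ℝ} (hs : -1 < s) {z : ℂ} (hz : 0 < z.re) :
    DifferentiableAt ℂ (fun z : ℂ => ∫ x in Ioi (0 : ℝ), ((x ^ s : ℝ) : ℂ) * cexp (-(z * x))) z := by
  set U : Set ℂ := {w | z.re / 2 < w.re} with hU
  have hUo : IsOpen U := isOpen_lt continuous_const Complex.continuous_re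
  have hUn : U ∈ 𝓝 z := hUo.mem_nhds (by simp only [hU, mem_ofPred_eq]; linarith)
  refine (hasDerivAt_integral_of_dominated_loc_of_deriv_le (μ := volume.restrict (Ioi (0 : ℝ)))
    (F := fun (z : ℂ) (x : ℝ) => ((x ^ s : ℝ) : ℂ) * cexp (-(z * x)))
    (F' := fun (z : ℂ) (x : ℝ) => ((x ^ s : ℝ) : ℂ) * (cexp (-(z * x)) * (-(x : ℂ))))
    (bound := fun x => x ^ (s + 1) * Real.exp (-(z.re / 2) * x)) hUn
    (Eventually.of_forall fun w => (measurable_rpow_mul_cexp s w).aestronglyMeasurable)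
    (integrableOn_rpow_mul_cexp hs hz) ?_ ?_ (integrableOn_rpow_mul_exp_neg (by linarith)
    (by linarith)) ?_).2.differentiableAt
  · refine Measurable.aestronglyMeasurable ?_
    exact (Complex.measurable_ofReal.comp (measurable_id.pow_const s)).mul (by fun_prop)
  · filter_upwards [ae_restrict_mem measurableSet_Ioi] with x hx w hw
    have hx0 : (0 : ℝ) < x := hx
    rw [← mul_assoc, norm_mul, norm_rpow_mul_cexp s w hx, norm_neg, Complex.norm_real,
      Real.norm_of_nonneg hx0.le, Real.rpow_add_one hx0.ne']
    have h1 : Real.exp (-w.re * x) ≤ Real.exp (-(z.re / 2) * x) := by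
      apply Real.exp_le_exp.2
      have : z.re / 2 < w.re := hw
      nlinarith
    have h2 : 0 ≤ x ^ s := Real.rpow_nonneg hx0.le _
    calc x ^ s * Real.exp (-w.re * x) * x ≤ x ^ s * Real.exp (-(z.re / 2) * x) * x := by gcongr
      _ = _ := by ring
  · filter_upwards with x w hw
    have h1 : HasDerivAt (fun w : ℂ => -(w * x)) (-(x : ℂ)) w := by
      simpa using ((hasDerivAt_id' w).mul_const (x : ℂ)).fun_neg
    exact h1.cexp.const_mul _

theorem mem_slitPlane_of_re_pos {z : ℂ} (hz : 0 < z.re) : z ∈ slitPlane := Or.inl hz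

/-- Both sides are analytic in the right half-plane and agree on the positive reals by Euler's
integral, so the identity theorem applies; the points 1 + 1/(n + 1) accumulate at 1. -/
theorem laplace_rpow {s : ℝ} (hs : 0 < s) {z : ℂ} (hz : 0 < z.re) :
    ∫ x in Ioi (0 : ℝ), ((x ^ (s - 1) : ℝ) : ℂ) * cexp (-(z * x)) =
      z ^ (-s : ℂ) * (Real.Gamma s : ℂ) := by
  set U : Set ℂ := {w | 0 < w.re} with hU
  have hUo : IsOpen U := isOpen_lt continuous_const Complex.continuous_re
  have hUc : IsPreconnected U := (convex_halfSpace_re_gt 0).isPreconnected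
  have hf : AnalyticOnNhd ℂ
      (fun z : ℂ => ∫ x in Ioi (0 : ℝ), ((x ^ (s - 1) : ℝ) : ℂ) * cexp (-(z * x))) U :=
    DifferentiableOn.analyticOnNhd (fun w hw =>
      (differentiableAt_laplace_rpow (by linarith) hw).differentiableWithinAt) hUo
  have hg : AnalyticOnNhd ℂ (fun z : ℂ => z ^ (-s : ℂ) * (Real.Gamma s : ℂ)) U :=
    DifferentiableOn.analyticOnNhd (fun w hw =>
      ((differentiableAt_id.cpow_const (mem_slitPlane_of_re_pos hw)).mul_const
        _).differentiableWithinAt) hUo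
  have hreal : ∀ b : ℝ, 0 < b →
      ∫ x in Ioi (0 : ℝ), ((x ^ (s - 1) : ℝ) : ℂ) * cexp (-((b : ℂ) * x)) =
        (b : ℂ) ^ (-s : ℂ) * (Real.Gamma s : ℂ) := by
    intro b hb
    have h1 := Real.integral_rpow_mul_exp_neg_mul_Ioi hs hb
    have h2 : ∫ x in Ioi (0 : ℝ), ((x ^ (s - 1) : ℝ) : ℂ) * cexp (-((b : ℂ) * x)) =
        ((∫ x in Ioi (0 : ℝ), x ^ (s - 1) * Real.exp (-(b * x)) : ℝ) : ℂ) := by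
      rw [← integral_complex_ofReal]
      congr 1; funext x; push_cast; rfl
    rw [h2, h1, one_div, Real.inv_rpow hb.le, ← Real.rpow_neg hb.le]
    push_cast
    rw [Complex.ofReal_cpow hb.le]
    push_cast; rfl
  refine hf.eqOn_of_preconnected_of_frequently_eq hg hUc (z₀ := 1) (by simp [hU]) ?_ hz
  have ht : Tendsto (fun n : ℕ => ((1 + 1 / ((n : ℝ) + 1) : ℝ) : ℂ)) atTop (𝓝[≠] (1 : ℂ)) := by
    rw [tendsto_nhdsWithin_iff]
    constructor
    · have h1 : Tendsto (fun n : ℕ => (1 + 1 / ((n : ℝ) + 1) : ℝ)) atTop (𝓝 (1 + 0)) :=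
        tendsto_const_nhds.add tendsto_one_div_add_atTop_nhds_zero_nat
      rw [add_zero] at h1
      have h2 := (Complex.continuous_ofReal.tendsto (1 : ℝ)).comp h1
      rw [Complex.ofReal_one] at h2
      exact h2
    · refine Eventually.of_forall fun n => ?_
      have : (1 : ℝ) / ((n : ℝ) + 1) ≠ 0 := by positivity
      simp only [mem_compl_iff, mem_singleton_iff]
      rw [← Complex.ofReal_one, Complex.ofReal_inj]
      intro h
      exact this (by linarith)
  refine ht.frequently (Frequently.of_forall fun n => ?_)
  exact hreal _ (by positivity)

theorem line_re (c y : ℝ) : ((c : ℂ) + y * I).re = c := by simp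

theorem line_ne_zero {c : ℝ} (hc : 0 < c) (y : ℝ) : (c : ℂ) + y * I ≠ 0 := fun h => by
  have := congrArg Complex.re h
  rw [line_re] at this
  exact hc.ne' this

theorem norm_line_ge {c : ℝ} (hc : 0 < c) (y : ℝ) :
    c ≤ ‖(c : ℂ) + y * I‖ ∧ min c 1 / 2 * (1 + ‖y‖) ≤ ‖(c : ℂ) + y * I‖ := by
  have h1 := Complex.abs_re_le_norm ((c : ℂ) + y * I)
  have h2 := Complex.abs_im_le_norm ((c : ℂ) + y * I)
  simp at h1 h2
  rw [abs_of_pos hc] at h1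
  refine ⟨h1, ?_⟩
  rw [Real.norm_eq_abs]
  have h3 := min_le_left c 1
  have h4 := min_le_right c 1
  have h5 : 0 < min c 1 := lt_min hc one_pos
  nlinarith [abs_nonneg y]

theorem continuous_line_cpow {c : ℝ} (hc : 0 < c) (s : ℝ) :
    Continuous fun y : ℝ => ((c : ℂ) + y * I) ^ (-s : ℂ) := by
  refine Continuous.cpow (by fun_prop) continuous_const fun y => mem_slitPlane_of_re_pos ?_
  rw [line_re]; exact hc

theorem norm_line_cpow_le {c : ℝ} (hc : 0 < c) {s : ℝ} (hs : 0 ≤ s) (y : ℝ) :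
    ‖((c : ℂ) + y * I) ^ (-s : ℂ)‖ ≤ (min c 1 / 2) ^ (-s) * (1 + ‖y‖) ^ (-s) := by
  have h := (norm_line_ge hc y).2
  have h5 : 0 < min c 1 := lt_min hc one_pos
  rw [← Complex.ofReal_neg, Complex.norm_cpow_real, ← Real.mul_rpow (by positivity) (by positivity)]
  exact Real.rpow_le_rpow_of_nonpos (by positivity) h (by linarith)

theorem integrable_one_add_norm_rpow {s : ℝ} (hs : 1 < s) :
    Integrable fun y : ℝ => (1 + ‖y‖) ^ (-s) :=
  integrable_one_add_norm (by simpa using hs)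

theorem integrable_line_cpow {c : ℝ} (hc : 0 < c) {s : ℝ} (hs : 1 < s) :
    Integrable fun y : ℝ => ((c : ℂ) + y * I) ^ (-s : ℂ) :=
  Integrable.mono' ((integrable_one_add_norm_rpow hs).const_mul ((min c 1 / 2) ^ (-s)))
    (continuous_line_cpow hc s).aestronglyMeasurable
    (Eventually.of_forall fun y => norm_line_cpow_le hc (by linarith) y)

-- By `laplace_rpow`, t^{-s}Γ(s) on the vertical line is the Fourier transform of x^{s-1}e^{-cx} on
-- x > 0. For s > 1 it is integrable, so Fourier inversion applies at each x > 0.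
open FourierTransform in
theorem integral_line_cpow_mul_exp {c x s : ℝ} (hc : 0 < c) (hx : 0 < x) (hs : 1 < s) :
    ∫ y : ℝ, ((c : ℂ) + y * I) ^ (-s : ℂ) * cexp (x * ((c : ℂ) + y * I)) =
      2 * Real.pi * ((x ^ (s - 1) / Real.Gamma s : ℝ) : ℂ) := by
  set f : ℝ → ℂ := indicator (Ioi 0) fun x => ((x ^ (s - 1) : ℝ) : ℂ) * cexp (-((c : ℂ) * x)) with hf
  have hG : (0 : ℝ) < Real.Gamma s := Real.Gamma_pos_of_pos (by linarith)
  have hfi : Integrable f := by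
    rw [hf, integrable_indicator_iff measurableSet_Ioi]
    exact integrableOn_rpow_mul_cexp (by linarith) (by simpa using hc)
  have hF : ∀ w : ℝ, 𝓕 f w = ((c : ℂ) + ((2 * Real.pi) * w : ℝ) * I) ^ (-s : ℂ) * (Real.Gamma s : ℂ) := by
    intro w
    rw [Real.fourier_real_eq_integral_exp_smul, ← laplace_rpow (by linarith) (by simpa using hc),
      ← integral_indicator measurableSet_Ioi]
    congr 1
    funext v
    by_cases hv : v ∈ Ioi (0 : ℝ)
    · rw [hf, indicator_of_mem hv, indicator_of_mem hv, smul_eq_mul, mul_left_comm, ← Complex.exp_add]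
      congr 2
      push_cast; ring
    · rw [hf, indicator_of_notMem hv, indicator_of_notMem hv, smul_zero]
  have hFi : Integrable (𝓕 f) := by
    have h1 := ((integrable_line_cpow hc hs).comp_mul_left' (R := 2 * Real.pi)
      (by positivity)).mul_const (Real.Gamma s : ℂ)
    exact h1.congr (Eventually.of_forall fun w => (hF w).symm)
  have hfc : ContinuousAt f x := by
    have h1 : f =ᶠ[𝓝 x] fun x => ((x ^ (s - 1) : ℝ) : ℂ) * cexp (-((c : ℂ) * x)) := by
      filter_upwards [Ioi_mem_nhds hx] with v hv
      rw [hf, indicator_of_mem hv]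
    refine ContinuousAt.congr ?_ h1.symm
    refine ContinuousAt.mul ?_ (by fun_prop)
    exact Complex.continuous_ofReal.continuousAt.comp
      (Real.continuousAt_rpow_const _ _ (Or.inl hx.ne'))
  have hinv := hfi.fourierInv_fourier_eq hFi hfc
  rw [Real.fourierInv_eq'] at hinv
  have h2 : ∀ w : ℝ, cexp (((2 * Real.pi * inner ℝ w x : ℝ) : ℂ) * I) • 𝓕 f w =
      (fun y : ℝ => cexp (x * (y * I)) * (((c : ℂ) + y * I) ^ (-s : ℂ) * (Real.Gamma s : ℂ)))
        ((2 * Real.pi) * w) := by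
    intro w
    rw [hF, smul_eq_mul]
    simp only [RCLike.inner_apply, conj_trivial]
    congr 2
    push_cast; ring
  simp_rw [h2] at hinv
  rw [Measure.integral_comp_mul_left (fun y : ℝ => cexp (x * (y * I)) *
    (((c : ℂ) + y * I) ^ (-s : ℂ) * (Real.Gamma s : ℂ))) (2 * Real.pi), hf,
    indicator_of_mem (show x ∈ Ioi (0 : ℝ) from hx)] at hinv
  have h3 : ∀ y : ℝ, ((c : ℂ) + y * I) ^ (-s : ℂ) * cexp (x * ((c : ℂ) + y * I)) =
      (cexp (c * x) * (Real.Gamma s : ℂ)⁻¹) *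
        (cexp (x * (y * I)) * (((c : ℂ) + y * I) ^ (-s : ℂ) * (Real.Gamma s : ℂ))) := by
    intro y
    have : (Real.Gamma s : ℂ) ≠ 0 := by exact_mod_cast hG.ne'
    rw [show (x : ℂ) * ((c : ℂ) + y * I) = c * x + x * (y * I) by ring, Complex.exp_add]
    field_simp
  simp_rw [h3]
  rw [integral_const_mul]
  have hpi : (0 : ℝ) < 2 * Real.pi := by positivity
  rw [abs_of_pos (by positivity), Complex.real_smul] at hinv
  have h4 : ∫ y : ℝ, cexp (x * (y * I)) * (((c : ℂ) + y * I) ^ (-s : ℂ) * (Real.Gamma s : ℂ)) =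
      (2 * Real.pi : ℝ) * (((x ^ (s - 1) : ℝ) : ℂ) * cexp (-((c : ℂ) * x))) := by
    rw [← hinv, ← mul_assoc, ← Complex.ofReal_mul, mul_inv_cancel₀ hpi.ne', Complex.ofReal_one,
      one_mul]
  rw [h4]
  have h5 : cexp (c * x) * cexp (-((c : ℂ) * x)) = 1 := by rw [← Complex.exp_add]; simp
  push_cast
  linear_combination (2 * Real.pi * ((x ^ (s - 1) : ℝ) : ℂ) * (Real.Gamma s : ℂ)⁻¹) * h5

end Overpart

/-! ### Bessel integrals on the line and on the arc -/

namespace Overpart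

open Filter Topology Complex MeasureTheory Set

/-- The terms of the series for `(x / A) ^ (ν / 2) * I_ν(2 * √(A * x))`. -/
noncomputable def besselTerm (A ν x : ℝ) (k : ℕ) : ℝ :=
  A ^ k * x ^ (ν + k) / ((k.factorial : ℝ) * Real.Gamma ((k : ℝ) + ν + 1))

/-- The integrand of the Bessel integral on the vertical line of abscissa `c`. -/
noncomputable def besselKernel (A ν x c y : ℝ) : ℂ :=
  ((c : ℂ) + y * I) ^ (-(ν + 1) : ℂ) * cexp (A / ((c : ℂ) + y * I) + x * ((c : ℂ) + y * I))

theorem continuous_besselKernel (A ν x : ℝ) {c : ℝ} (hc : 0 < c) :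
    Continuous (besselKernel A ν x c) := by
  have h1 : Continuous fun y : ℝ => ((c : ℂ) + y * I) ^ (-(ν + 1) : ℂ) := by
    have := continuous_line_cpow hc (ν + 1)
    push_cast at this; exact this
  have h2 : Continuous fun y : ℝ => (A : ℂ) / ((c : ℂ) + y * I) :=
    Continuous.div continuous_const (by fun_prop) (line_ne_zero hc)
  unfold besselKernel
  exact h1.mul (Complex.continuous_exp.comp (h2.add (by fun_prop)))

theorem re_div_line (A c y : ℝ) : ((A : ℂ) / ((c : ℂ) + y * I)).re = A * c / (c ^ 2 + y ^ 2) := by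
  rw [Complex.div_re, Complex.normSq_add_mul_I]; simp

theorem norm_besselKernel_le {A ν x c : ℝ} (hc : 0 < c) (hν : 0 ≤ ν + 1) (y : ℝ) {E : ℝ}
    (hE : A * c / (c ^ 2 + y ^ 2) ≤ E) :
    ‖besselKernel A ν x c y‖ ≤
      (min c 1 / 2) ^ (-(ν + 1)) * (1 + ‖y‖) ^ (-(ν + 1)) * Real.exp (E + x * c) := by
  rw [besselKernel, norm_mul, Complex.norm_exp, Complex.add_re, re_div_line, Complex.re_ofReal_mul,
    line_re]
  have h := norm_line_cpow_le hc hν y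
  push_cast at h
  gcongr

theorem div_add_sq_le {A c : ℝ} (hA : 0 ≤ A) (hc : 0 < c) (y : ℝ) :
    A * c / (c ^ 2 + y ^ 2) ≤ A / c := by
  rw [div_le_div_iff₀ (by positivity) hc]
  nlinarith [mul_nonneg hA (sq_nonneg y)]

theorem div_add_sq_le_of_le {A c y : ℝ} (hA : 0 ≤ A) (hc : 0 < c) (hy : c / 4 ≤ |y|) :
    A * c / (c ^ 2 + y ^ 2) ≤ 16 / 17 * (A / c) := by
  have h1 : c ^ 2 / 16 ≤ y ^ 2 := by rw [← sq_abs y]; nlinarith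
  rw [← mul_div_assoc, div_le_div_iff₀ (by positivity) hc]
  nlinarith [mul_le_mul_of_nonneg_left h1 hA]

theorem integrable_besselKernel {A ν x c : ℝ} (hA : 0 ≤ A) (hc : 0 < c) (hν : 0 < ν) :
    Integrable (besselKernel A ν x c) :=
  Integrable.mono' (((integrable_one_add_norm_rpow (by linarith : 1 < ν + 1)).const_mul
    ((min c 1 / 2) ^ (-(ν + 1)))).mul_const (Real.exp (A / c + x * c)))
    (continuous_besselKernel A ν x hc).aestronglyMeasurable
    (Eventually.of_forall fun y => norm_besselKernel_le hc (by linarith) y (div_add_sq_le hA hc y))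

/-- The factor exp(A/t) is expanded and integrated term by term. Since |t| ≥ c, the terms are
dominated by (A/c)^k/k! times a function integrable for ν > 0. -/
theorem hasSum_besselTerm {A ν x c : ℝ} (hA : 0 ≤ A) (hν : 0 < ν) (hx : 0 < x) (hc : 0 < c) :
    HasSum (fun k => 2 * Real.pi * (besselTerm A ν x k : ℂ)) (∫ y, besselKernel A ν x c y) := by
  set G : ℕ → ℝ → ℂ := fun k y => (A ^ k / k.factorial : ℂ) *
    (((c : ℂ) + y * I) ^ (-((ν + 1 + k : ℝ)) : ℂ) * cexp (x * ((c : ℂ) + y * I))) with hG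
  have hint : ∀ k, ∫ y, G k y = 2 * Real.pi * (besselTerm A ν x k : ℂ) := by
    intro k
    rw [hG]
    simp only
    rw [integral_const_mul, integral_line_cpow_mul_exp hc hx
      (by have := Nat.cast_nonneg (α := ℝ) k; linarith), besselTerm,
      show ν + 1 + (k : ℝ) - 1 = ν + k by ring, show ν + 1 + (k : ℝ) = k + ν + 1 by ring]
    push_cast
    ring
  have hpow : ∀ (k : ℕ) (y : ℝ), ((c : ℂ) + y * I) ^ (-((ν + 1 + k : ℝ)) : ℂ) =
      ((c : ℂ) + y * I) ^ (-(ν + 1) : ℂ) * (((c : ℂ) + y * I) ^ k)⁻¹ := by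
    intro k y
    rw [← Complex.cpow_natCast, ← Complex.cpow_neg, ← Complex.cpow_add _ _ (line_ne_zero hc y)]
    congr 1
    push_cast; ring
  set b : ℝ → ℝ := fun y => (min c 1 / 2) ^ (-(ν + 1)) * (1 + ‖y‖) ^ (-(ν + 1)) * Real.exp (x * c)
    with hb
  have hbi : Integrable b := (((integrable_one_add_norm_rpow (by linarith : 1 < ν + 1)).const_mul
    ((min c 1 / 2) ^ (-(ν + 1)))).mul_const (Real.exp (x * c)))
  have hnorm : ∀ k y, ‖G k y‖ ≤ (A / c) ^ k / k.factorial * b y := by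
    intro k y
    have h1 := norm_line_cpow_le hc (by linarith : 0 ≤ ν + 1) y
    push_cast at h1
    have h2 := (norm_line_ge hc y).1
    simp only [hG, hb]
    rw [hpow, norm_mul, norm_mul, norm_mul, norm_div, norm_pow, norm_inv, norm_pow,
      Complex.norm_exp, Complex.re_ofReal_mul, line_re, Complex.norm_real, Real.norm_of_nonneg hA,
      Complex.norm_natCast]
    have h3 : (‖(c : ℂ) + y * I‖ ^ k)⁻¹ ≤ (c ^ k)⁻¹ := by gcongr
    calc A ^ k / (k.factorial : ℝ) * (‖((c : ℂ) + y * I) ^ (-(ν + 1) : ℂ)‖ *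
          (‖(c : ℂ) + y * I‖ ^ k)⁻¹ * Real.exp (x * c))
        ≤ A ^ k / (k.factorial : ℝ) * ((min c 1 / 2) ^ (-(ν + 1)) * (1 + ‖y‖) ^ (-(ν + 1)) *
          (c ^ k)⁻¹ * Real.exp (x * c)) := by gcongr
      _ = _ := by rw [div_pow]; field_simp
  have hcont : ∀ k, Continuous (G k) := by
    intro k
    simp only [hG]
    have := continuous_line_cpow hc (ν + 1 + k)
    exact continuous_const.mul (this.mul (by fun_prop))
  have hGi : ∀ k, Integrable (G k) := fun k =>
    Integrable.mono' (hbi.const_mul _) (hcont k).aestronglyMeasurable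
      (Eventually.of_forall (hnorm k))
  have hsum : Summable fun k => ∫ y, ‖G k y‖ := by
    refine Summable.of_nonneg_of_le (fun k => integral_nonneg fun y => norm_nonneg _) (fun k => ?_)
      ((Real.summable_pow_div_factorial (A / c)).mul_right (∫ y, b y))
    rw [← integral_const_mul]
    exact integral_mono (hGi k).norm (hbi.const_mul _) (hnorm k)
  have h := hasSum_integral_of_summable_integral_norm hGi hsum
  simp_rw [hint] at h
  convert! h using 1
  congr 1
  funext y
  have hexp : HasSum (fun k : ℕ => ((A : ℂ) / ((c : ℂ) + y * I)) ^ k / k.factorial)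
      (cexp (A / ((c : ℂ) + y * I))) := by
    rw [Complex.exp_eq_exp_ℂ]
    exact NormedSpace.expSeries_div_hasSum_exp _
  rw [besselKernel, Complex.exp_add, ← hexp.tsum_eq, ← mul_assoc, ← tsum_mul_left, ← tsum_mul_right]
  congr 1
  funext k
  simp only [hG]
  rw [hpow, div_pow]
  field_simp

/-- The part of the Bessel integral over the major arc. -/
noncomputable def arcIntegral (A ν x c : ℝ) : ℂ := ∫ y in (-(c / 4))..(c / 4), besselKernel A ν x c y

/-- For |y| ≥ c/4 the real part of A/t is Ac/(c² + y²) ≤ (16/17)A/c. -/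
theorem norm_integral_sub_arcIntegral_le {A ν x c : ℝ} (hA : 0 ≤ A) (hν : 0 < ν) (hc : 0 < c) :
    ‖(∫ y, besselKernel A ν x c y) - arcIntegral A ν x c‖ ≤
      (min c 1 / 2) ^ (-(ν + 1)) * (∫ y : ℝ, (1 + ‖y‖) ^ (-(ν + 1))) *
        Real.exp (16 / 17 * (A / c) + x * c) := by
  have hi := integrable_besselKernel (x := x) hA hc hν
  have hb := (((integrable_one_add_norm_rpow (by linarith : 1 < ν + 1)).const_mul
    ((min c 1 / 2) ^ (-(ν + 1)))).mul_const (Real.exp (16 / 17 * (A / c) + x * c)))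
  rw [arcIntegral, intervalIntegral.integral_of_le (by linarith),
    ← integral_add_compl (measurableSet_Ioc (a := -(c / 4)) (b := c / 4)) hi, add_sub_cancel_left]
  have h1 : ‖∫ y in (Ioc (-(c / 4)) (c / 4))ᶜ, besselKernel A ν x c y‖ ≤
      ∫ y in (Ioc (-(c / 4)) (c / 4))ᶜ, (min c 1 / 2) ^ (-(ν + 1)) * (1 + ‖y‖) ^ (-(ν + 1)) *
        Real.exp (16 / 17 * (A / c) + x * c) := by
    refine norm_integral_le_of_norm_le hb.integrableOn ?_
    filter_upwards [ae_restrict_mem measurableSet_Ioc.compl] with y hy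
    refine norm_besselKernel_le hc (by linarith) y (div_add_sq_le_of_le hA hc ?_)
    by_contra hlt
    rw [not_le, abs_lt] at hlt
    exact hy ⟨hlt.1, hlt.2.le⟩
  refine h1.trans ((setIntegral_le_integral hb (Eventually.of_forall fun y => ?_)).trans
    (le_of_eq ?_))
  · have : 0 ≤ min c 1 := le_min hc.le zero_le_one
    simp only [Pi.zero_apply]; positivity
  · rw [integral_mul_const, integral_const_mul]

/-- The recurrence xB_{ν-1} = νB_ν + AB_{ν+1} for the series. Since Γ(k + ν + 1) = (k + ν)Γ(k + ν),
the combination xB_{ν-1} - νB_ν has terms with a factor k, and shifting the index gives AB_{ν+1}. -/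
theorem hasSum_besselTerm_pred {A ν x a b : ℝ} (hν : ∀ k : ℕ, (k : ℝ) + ν ≠ 0) (hx : 0 < x)
    (ha : HasSum (besselTerm A ν x) a) (hb : HasSum (besselTerm A (ν + 1) x) b) :
    HasSum (besselTerm A (ν - 1) x) ((ν * a + A * b) / x) := by
  set f : ℕ → ℝ := fun k => x * besselTerm A (ν - 1) x k - ν * besselTerm A ν x k with hf
  have hterm : ∀ k : ℕ, f k = k * (A ^ k * x ^ (ν + k) /
      ((k.factorial : ℝ) * Real.Gamma ((k : ℝ) + ν + 1))) := by
    intro k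
    simp only [hf, besselTerm]
    rw [show (k : ℝ) + (ν - 1) + 1 = k + ν by ring, Real.Gamma_add_one (hν k),
      show ν + (k : ℝ) = (ν - 1 + k) + 1 by ring, Real.rpow_add_one hx.ne']
    by_cases hG : Real.Gamma (k + ν) = 0
    · rw [hG]; simp
    have := hν k
    have hfac : (k.factorial : ℝ) ≠ 0 := by positivity
    field_simp
    ring
  have h0 : f 0 = 0 := by rw [hterm]; simp
  have hs : ∀ k : ℕ, f (k + 1) = A * besselTerm A (ν + 1) x k := by
    intro k
    rw [hterm, besselTerm, Nat.factorial_succ]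
    push_cast
    rw [show ν + ((k : ℝ) + 1) = ν + 1 + k by ring, show (k : ℝ) + 1 + ν + 1 = k + (ν + 1) + 1 by ring,
      pow_succ]
    have h1 : (k : ℝ) + 1 ≠ 0 := by positivity
    by_cases hG : Real.Gamma (k + (ν + 1) + 1) = 0
    · rw [hG]; simp
    have hfac : (k.factorial : ℝ) ≠ 0 := by positivity
    field_simp
  have h1 : HasSum f (A * b) := by
    rw [← hasSum_nat_add_iff' 1]
    simp only [hs, Finset.sum_range_one, h0, sub_zero]
    exact hb.mul_left A
  have h2 := (h1.add (ha.mul_left ν)).div_const x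
  convert! h2 using 1
  · funext k
    simp only [hf]
    field_simp
    ring
  · ring

/-- The same recurrence for the arc integrals, obtained by integrating the derivative of t^{-ν}
exp(A/t + xt). The boundary values at y = ±c/4 form the error, with the saving 16/17 there. No sign
of ν is required, so orders for which the line integral need not converge absolutely are covered. -/
theorem arcIntegral_pred (A ν x : ℝ) {c : ℝ} (hc : 0 < c) :
    ∃ z : ℂ, (x : ℂ) * arcIntegral A (ν - 1) x c =
      ν * arcIntegral A ν x c + A * arcIntegral A (ν + 1) x c + z ∧
      (0 ≤ A → ‖z‖ ≤ 2 * ((c ^ (-ν) + (2 * c) ^ (-ν)) * Real.exp (16 / 17 * (A / c) + x * c))) := by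
  set h : ℝ → ℂ := fun y => ((c : ℂ) + y * I) ^ (-ν : ℂ) *
    cexp (A / ((c : ℂ) + y * I) + x * ((c : ℂ) + y * I)) with hh
  have hderiv : ∀ y : ℝ, HasDerivAt h (I * (x * besselKernel A (ν - 1) x c y -
      ν * besselKernel A ν x c y - A * besselKernel A (ν + 1) x c y)) y := by
    intro y
    have ht0 := line_ne_zero hc y
    have d0 : HasDerivAt (fun y : ℝ => (c : ℂ) + y * I) I y := by
      simpa using ((Complex.ofRealCLM.hasDerivAt (x := y)).mul_const I).const_add (c : ℂ)
    have d1 : HasDerivAt (fun y : ℝ => ((c : ℂ) + y * I) ^ (-ν : ℂ))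
        ((-ν : ℂ) * ((c : ℂ) + y * I) ^ (-ν - 1 : ℂ) * 1 * I) y :=
      HasDerivAt.comp (h₂ := fun z : ℂ => z ^ (-ν : ℂ)) y
        ((hasDerivAt_id' ((c : ℂ) + y * I)).cpow_const (c := (-ν : ℂ))
          (mem_slitPlane_of_re_pos ((line_re c y).symm ▸ hc))) d0
    have d2 : HasDerivAt (fun y : ℝ => (A : ℂ) / ((c : ℂ) + y * I))
        (-(A * I) / ((c : ℂ) + y * I) ^ 2) y := by
      simpa using (hasDerivAt_const y (A : ℂ)).fun_div d0 ht0
    have d3 := d1.mul ((d2.add (d0.const_mul (x : ℂ))).cexp)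
    convert! d3 using 1
    simp only [besselKernel]
    set t := (c : ℂ) + y * I
    have e1 : t ^ (-((ν - 1 : ℝ) + 1) : ℂ) = t ^ (-ν : ℂ) := by congr 1; push_cast; ring
    have e2 : t ^ (-(ν + 1) : ℂ) = t ^ (-ν : ℂ) * t⁻¹ := by
      rw [show (-(ν + 1) : ℂ) = -ν - 1 by ring, Complex.cpow_sub _ _ ht0, Complex.cpow_one,
        div_eq_mul_inv]
    have e3 : t ^ (-((ν + 1 : ℝ) + 1) : ℂ) = t ^ (-ν : ℂ) * (t ^ 2)⁻¹ := by
      rw [show (-((ν + 1 : ℝ) + 1) : ℂ) = -ν - (2 : ℕ) by push_cast; ring,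
        Complex.cpow_sub _ _ ht0, Complex.cpow_natCast, div_eq_mul_inv]
    have e4 : t ^ (-ν - 1 : ℂ) = t ^ (-ν : ℂ) * t⁻¹ := by
      rw [Complex.cpow_sub _ _ ht0, Complex.cpow_one, div_eq_mul_inv]
    rw [e1, e2, e3, e4]
    simp only [Pi.add_apply]
    ring
  have hcont := fun μ => (continuous_besselKernel A μ x hc)
  have hii := fun μ => (hcont μ).intervalIntegrable (μ := volume) (-(c / 4)) (c / 4)
  have hint := intervalIntegral.integral_eq_sub_of_hasDerivAt (a := -(c / 4)) (b := c / 4)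
    (fun y _ => hderiv y) (Continuous.intervalIntegrable
      (continuous_const.mul (((continuous_const.mul (hcont (ν - 1))).sub
        (continuous_const.mul (hcont ν))).sub (continuous_const.mul (hcont (ν + 1))))) _ _)
  rw [intervalIntegral.integral_const_mul, intervalIntegral.integral_sub
    (((hii _).const_mul _).sub ((hii _).const_mul _)) ((hii _).const_mul _),
    intervalIntegral.integral_sub ((hii _).const_mul _) ((hii _).const_mul _),
    intervalIntegral.integral_const_mul, intervalIntegral.integral_const_mul,
    intervalIntegral.integral_const_mul] at hint
  refine ⟨-I * (h (c / 4) - h (-(c / 4))), ?_, fun hA => ?_⟩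
  · rw [← hint]
    simp only [arcIntegral]
    linear_combination ((x * ∫ y in (-(c / 4))..(c / 4), besselKernel A (ν - 1) x c y) -
      ν * (∫ y in (-(c / 4))..(c / 4), besselKernel A ν x c y) -
      A * (∫ y in (-(c / 4))..(c / 4), besselKernel A (ν + 1) x c y)) * I_mul_I
  · have hbd : ∀ y : ℝ, |y| = c / 4 →
        ‖h y‖ ≤ (c ^ (-ν) + (2 * c) ^ (-ν)) * Real.exp (16 / 17 * (A / c) + x * c) := by
      intro y hy
      simp only [hh]
      rw [norm_mul, Complex.norm_exp, Complex.add_re, re_div_line, Complex.re_ofReal_mul, line_re,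
        ← Complex.ofReal_neg, Complex.norm_cpow_real]
      have h1 := (norm_line_ge hc y).1
      have h2 : ‖(c : ℂ) + y * I‖ ≤ 2 * c := by
        refine (norm_add_le _ _).trans ?_
        rw [norm_mul, Complex.norm_I, Complex.norm_real, Complex.norm_real, Real.norm_eq_abs,
          Real.norm_eq_abs, hy, abs_of_pos hc]
        linarith
      -- As c ≤ |t| ≤ 2c, one of the two powers bounds the left side, whichever the sign of the
      -- exponent.
      have h3 : ‖(c : ℂ) + y * I‖ ^ (-ν) ≤ c ^ (-ν) + (2 * c) ^ (-ν) := by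
        have p1 : 0 ≤ c ^ (-ν) := Real.rpow_nonneg hc.le _
        have p2 : 0 ≤ (2 * c) ^ (-ν) := Real.rpow_nonneg (by linarith) _
        rcases le_total 0 (-ν) with hv | hv
        · linarith [Real.rpow_le_rpow (norm_nonneg _) h2 hv]
        · linarith [Real.rpow_le_rpow_of_nonpos hc h1 hv]
      have h4 := div_add_sq_le_of_le hA hc hy.ge
      gcongr
    have h1 := hbd (c / 4) (abs_of_pos (by linarith))
    have h2 := hbd (-(c / 4)) (by rw [abs_neg]; exact abs_of_pos (by linarith))
    rw [norm_mul, norm_neg, Complex.norm_I, one_mul]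
    have := norm_sub_le (h (c / 4)) (h (-(c / 4)))
    linarith

end Overpart

/-! ### The saddle point and Bessel functions of all orders needed -/

namespace Overpart

open Filter Topology Complex MeasureTheory Set

theorem tendsto_sqrt_natCast_atTop : Tendsto (fun N : ℕ => Real.sqrt N) atTop atTop :=
  Real.tendsto_sqrt_atTop.comp tendsto_natCast_atTop_atTop

theorem isBigO_rpow_mul_exp_sqrt (K : ℝ) {a b : ℝ} (hab : a < b) :
    (fun N : ℕ => (N : ℝ) ^ K * Real.exp (a * Real.sqrt N)) =O[atTop]
      fun N : ℕ => Real.exp (b * Real.sqrt N) := by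
  have h1 := ((isLittleO_rpow_exp_pos_mul_atTop (2 * K) (sub_pos.2 hab)).comp_tendsto
    tendsto_sqrt_natCast_atTop).isBigO
  have h2 := h1.mul (Asymptotics.isBigO_refl (fun N : ℕ => Real.exp (a * Real.sqrt N)) atTop)
  refine h2.congr (fun N => ?_) fun N => ?_
  · simp only [Function.comp_apply]
    rw [Real.rpow_mul (Real.sqrt_nonneg _), Real.rpow_two, Real.sq_sqrt (Nat.cast_nonneg N)]
  · simp only [Function.comp_apply]
    rw [← Real.exp_add]; congr 1; ring

/-- The abscissa of the saddle point. -/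
noncomputable def saddle (N : ℕ) : ℝ := Real.pi / (2 * Real.sqrt N)

theorem saddle_pos {N : ℕ} (hN : 0 < N) : 0 < saddle N := by
  have : 0 < Real.sqrt N := Real.sqrt_pos.2 (by exact_mod_cast hN)
  have := Real.pi_pos
  unfold saddle; positivity

/-- At the saddle point the two terms π²/(4c) and Nc of the exponent are equal, and together they
give π√N. -/
theorem div_saddle (N : ℕ) : Real.pi ^ 2 / 4 / saddle N = Real.pi / 2 * Real.sqrt N := by
  unfold saddle
  have := Real.pi_pos.ne'
  rcases eq_or_ne (Real.sqrt N) 0 with h | h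
  · rw [h]; simp
  · field_simp; norm_num

theorem mul_saddle (N : ℕ) : (N : ℝ) * saddle N = Real.pi / 2 * Real.sqrt N := by
  unfold saddle
  rcases eq_or_ne (Real.sqrt N) 0 with h | h
  · rw [h]; simp
  · have h2 : (N : ℝ) = Real.sqrt N ^ 2 := (Real.sq_sqrt (Nat.cast_nonneg N)).symm
    nth_rewrite 1 [h2]
    field_simp

theorem saddle_le_one {N : ℕ} (hN : 4 ≤ N) : saddle N ≤ 1 := by
  have h : (2 : ℝ) ≤ Real.sqrt N := by
    rw [Real.le_sqrt (by norm_num) (Nat.cast_nonneg N)]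
    norm_num; exact_mod_cast hN
  unfold saddle
  rw [div_le_one (by linarith)]
  linarith [Real.pi_le_four]

theorem sqrt_natCast_rpow (N : ℕ) (p : ℝ) : Real.sqrt N ^ p = (N : ℝ) ^ (p / 2) := by
  rw [Real.sqrt_eq_rpow, ← Real.rpow_mul (Nat.cast_nonneg N)]
  congr 1; ring

theorem mul_saddle_rpow {a : ℝ} (ha : 0 ≤ a) (N : ℕ) (p : ℝ) :
    (a * saddle N) ^ p = (a * (Real.pi / 2)) ^ p * (N : ℝ) ^ (-p / 2) := by
  have h1 : a * saddle N = a * (Real.pi / 2) * (Real.sqrt N)⁻¹ := by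
    unfold saddle; rw [← div_div]; ring
  have := Real.pi_pos
  rw [h1, Real.mul_rpow (by positivity) (by positivity), Real.inv_rpow (Real.sqrt_nonneg _),
    ← Real.rpow_neg (Real.sqrt_nonneg _), sqrt_natCast_rpow]

/-- The exponent is (16/17 + 1)(π/2)√N = (33/34)π√N; the gap π/34 exceeds 1/10000 and absorbs any
power of N. The value 1/10000 is small enough to serve the minor arc as well. -/
theorem isBigO_mul_saddle_rpow_mul_exp {a : ℝ} (ha : 0 ≤ a) (p : ℝ) :
    (fun N : ℕ => (a * saddle N) ^ p *
      Real.exp (16 / 17 * (Real.pi ^ 2 / 4 / saddle N) + N * saddle N)) =O[atTop]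
      fun N : ℕ => Real.exp ((Real.pi - 1 / 10000) * Real.sqrt N) := by
  have h := (isBigO_rpow_mul_exp_sqrt (-p / 2) (a := 33 / 34 * Real.pi)
    (b := Real.pi - 1 / 10000) (by linarith [Real.pi_gt_three])).const_mul_left
      ((a * (Real.pi / 2)) ^ p)
  refine h.congr_left fun N => ?_
  rw [mul_saddle_rpow ha, div_saddle, mul_saddle, ← mul_assoc]
  congr 2; ring

/-- The Bessel integral over the major arc approximates the Bessel series of order `ν` up to an
exponentially smaller error. -/
def BesselArc (ν : ℝ) : Prop :=
  ∃ B : ℕ → ℝ, (∀ N : ℕ, 0 < N → HasSum (besselTerm (Real.pi ^ 2 / 4) ν N) (B N)) ∧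
    (fun N : ℕ => arcIntegral (Real.pi ^ 2 / 4) ν N (saddle N) - 2 * Real.pi * (B N : ℂ)) =O[atTop]
      fun N : ℕ => Real.exp ((Real.pi - 1 / 10000) * Real.sqrt N)

theorem besselArc_of_pos {ν : ℝ} (hν : 0 < ν) : BesselArc ν := by
  have hA : 0 ≤ Real.pi ^ 2 / 4 := by positivity
  have hs : ∀ N : ℕ, 0 < N → HasSum (fun k => 2 * Real.pi *
      (besselTerm (Real.pi ^ 2 / 4) ν N k : ℂ))
      (∫ y, besselKernel (Real.pi ^ 2 / 4 : ℝ) ν N (saddle N) y) := fun N hN =>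
    hasSum_besselTerm hA hν (by exact_mod_cast hN) (saddle_pos hN)
  have hpi : (2 * Real.pi : ℂ) ≠ 0 := by exact_mod_cast (by positivity : 2 * Real.pi ≠ 0)
  have hre : ∀ N : ℕ, 0 < N → HasSum (besselTerm (Real.pi ^ 2 / 4) ν N)
      (∑' k, besselTerm (Real.pi ^ 2 / 4) ν N k) := by
    intro N hN
    have h1 := (hs N hN).summable.mul_left (2 * Real.pi : ℂ)⁻¹
    have h2 : Summable fun k => (besselTerm (Real.pi ^ 2 / 4) ν N k : ℂ) :=
      h1.congr fun k => by rw [inv_mul_cancel_left₀ hpi]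
    exact (Complex.summable_ofReal.1 h2).hasSum
  refine ⟨fun N => ∑' k, besselTerm (Real.pi ^ 2 / 4) ν N k, hre, ?_⟩
  have hb := (isBigO_mul_saddle_rpow_mul_exp (a := 1 / 2) (by norm_num) (-(ν + 1))).const_mul_left
    (∫ y : ℝ, (1 + ‖y‖) ^ (-(ν + 1)))
  refine Asymptotics.IsBigO.trans (Asymptotics.IsBigO.of_bound 1 ?_) hb
  filter_upwards [eventually_ge_atTop 4] with N hN
  have hN0 : 0 < N := by omega
  have h1 : ∫ y, besselKernel (Real.pi ^ 2 / 4 : ℝ) ν N (saddle N) y =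
      2 * Real.pi * ((∑' k, besselTerm (Real.pi ^ 2 / 4) ν N k : ℝ) : ℂ) := by
    rw [← (hs N hN0).tsum_eq, tsum_mul_left, Complex.ofReal_tsum]
  rw [← h1, norm_sub_rev, one_mul]
  have h2 := norm_integral_sub_arcIntegral_le (x := (N : ℝ)) hA hν (saddle_pos hN0)
  rw [min_eq_left (saddle_le_one hN)] at h2
  refine (h2.trans (le_of_eq ?_)).trans (Real.le_norm_self _)
  rw [show saddle N / 2 = 1 / 2 * saddle N by ring]
  ring

/-- Series and arc integral satisfy the same three-term recurrence up to an exponentially small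
term, so the approximation descends to lower orders. -/
theorem BesselArc.pred {ν : ℝ} (hν : ∀ k : ℕ, (k : ℝ) + ν ≠ 0) (h : BesselArc ν)
    (h' : BesselArc (ν + 1)) : BesselArc (ν - 1) := by
  obtain ⟨B, hB, hBO⟩ := h
  obtain ⟨B', hB', hBO'⟩ := h'
  have hA : 0 ≤ Real.pi ^ 2 / 4 := by positivity
  refine ⟨fun N => (ν * B N + Real.pi ^ 2 / 4 * B' N) / N, fun N hN =>
    hasSum_besselTerm_pred hν (by exact_mod_cast hN) (hB N hN) (hB' N hN), ?_⟩
  choose! z hz hzb using fun (N : ℕ) (hN : 0 < N) =>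
    arcIntegral_pred (Real.pi ^ 2 / 4) ν (N : ℝ) (saddle_pos hN)
  have hzO : z =O[atTop] fun N : ℕ => Real.exp ((Real.pi - 1 / 10000) * Real.sqrt N) := by
    have hb := ((isBigO_mul_saddle_rpow_mul_exp (a := 1) (by norm_num) (-ν)).add
      (isBigO_mul_saddle_rpow_mul_exp (a := 2) (by norm_num) (-ν))).const_mul_left 2
    refine Asymptotics.IsBigO.trans (Asymptotics.IsBigO.of_bound 1 ?_) hb
    filter_upwards [eventually_gt_atTop 0] with N hN
    rw [one_mul]
    refine ((hzb N hN hA).trans (le_of_eq ?_)).trans (Real.le_norm_self _)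
    rw [one_mul]; ring
  have hsum := ((hBO.const_mul_left (ν : ℂ)).add
    (hBO'.const_mul_left (Real.pi ^ 2 / 4 : ℂ))).add hzO
  refine Asymptotics.IsBigO.trans (Asymptotics.IsBigO.of_bound 1 ?_) hsum
  filter_upwards [eventually_gt_atTop 0] with N hN
  have hN1 : (1 : ℝ) ≤ N := by exact_mod_cast hN
  have hN0 : (N : ℂ) ≠ 0 := by exact_mod_cast hN.ne'
  have e := hz N hN
  push_cast at e ⊢
  have e2 : arcIntegral (Real.pi ^ 2 / 4) (ν - 1) N (saddle N) -
      2 * Real.pi * (((ν : ℂ) * B N + Real.pi ^ 2 / 4 * B' N) / N) =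
      (N : ℂ)⁻¹ * ((ν : ℂ) * (arcIntegral (Real.pi ^ 2 / 4) ν N (saddle N) - 2 * Real.pi * B N) +
        Real.pi ^ 2 / 4 * (arcIntegral (Real.pi ^ 2 / 4) (ν + 1) N (saddle N) -
          2 * Real.pi * B' N) + z N) := by
    field_simp
    linear_combination 4 * e
  rw [e2, norm_mul, norm_inv, Complex.norm_natCast, one_mul]
  exact mul_le_of_le_one_left (norm_nonneg _) (inv_le_one_of_one_le₀ hN1)

theorem besselArc_sub_three_half {r : ℕ} (hr : 1 ≤ r) : BesselArc ((r : ℝ) - 3 / 2) := by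
  rcases (by omega : r = 1 ∨ 2 ≤ r) with rfl | h
  · have h1 : BesselArc ((1 / 2 : ℝ) - 1) := BesselArc.pred (fun k => by positivity)
      (besselArc_of_pos (by norm_num)) (besselArc_of_pos (by norm_num))
    convert! h1 using 1; norm_num
  · have : (2 : ℝ) ≤ r := by exact_mod_cast h
    exact besselArc_of_pos (by linarith)

/-- Orders 1/2 and 3/2 give -1/2, then -1/2 and 1/2 give -3/2, the lowest order needed.
Half-integers never meet a pole of Γ. -/
theorem besselArc_sub_five_half {r : ℕ} (hr : 1 ≤ r) : BesselArc ((r : ℝ) - 5 / 2) := by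
  rcases (by omega : r = 1 ∨ 2 ≤ r) with rfl | h
  · have h1 : BesselArc (-1 / 2 : ℝ) := by
      convert! besselArc_sub_three_half (le_refl 1) using 1; norm_num
    have h2 : BesselArc ((-1 / 2 : ℝ) - 1) := by
      refine BesselArc.pred (fun k hk => ?_) h1 (besselArc_of_pos (by norm_num))
      have h3 : (2 : ℝ) * k = 1 := by linarith
      have h4 : 2 * k = 1 := by exact_mod_cast h3
      omega
    convert! h2 using 1; norm_num
  · obtain ⟨s, rfl⟩ := Nat.exists_eq_add_of_le' h
    convert! besselArc_sub_three_half (r := s + 1) (by omega) using 1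
    push_cast; ring

theorem eq_besselI_of_hasSum {ν S : ℝ} {N : ℕ} (hN : 0 < N)
    (h : HasSum (besselTerm (Real.pi ^ 2 / 4) ν N) S) :
    S = (Real.pi / 2) ^ (-ν) * (N : ℝ) ^ (ν / 2) * besselI ν (Real.pi * Real.sqrt N) := by
  rw [← h.tsum_eq, besselI, ← tsum_mul_left]
  congr 1
  funext k
  have hN' : (0 : ℝ) < N := by exact_mod_cast hN
  have hpi := Real.pi_pos
  rw [besselTerm, ← mul_div_assoc]
  congr 1
  rw [show Real.pi * Real.sqrt N / 2 = Real.pi / 2 * Real.sqrt N by ring,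
    Real.mul_rpow (by positivity) (by positivity), sqrt_natCast_rpow]
  have e1 : (Real.pi ^ 2 / 4) ^ k = (Real.pi / 2) ^ (-ν) * (Real.pi / 2) ^ (2 * (k : ℝ) + ν) := by
    rw [← Real.rpow_add (by positivity), show -ν + (2 * (k : ℝ) + ν) = ((2 * k : ℕ) : ℝ) by
      push_cast; ring, Real.rpow_natCast, pow_mul]
    congr 1; ring
  have e2 : (N : ℝ) ^ (ν + k) = (N : ℝ) ^ (ν / 2) * (N : ℝ) ^ ((2 * (k : ℝ) + ν) / 2) := by
    rw [← Real.rpow_add hN']; congr 1; ring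
  rw [e1, e2]; ring

theorem BesselArc.isBigO {ν : ℝ} (h : BesselArc ν) :
    (fun N : ℕ => arcIntegral (Real.pi ^ 2 / 4) ν N (saddle N) - 2 * Real.pi *
      (((Real.pi / 2) ^ (-ν) * (N : ℝ) ^ (ν / 2) * besselI ν (Real.pi * Real.sqrt N) : ℝ) : ℂ))
      =O[atTop] fun N : ℕ => Real.exp ((Real.pi - 1 / 10000) * Real.sqrt N) := by
  obtain ⟨B, hB, hO⟩ := h
  refine hO.congr' ?_ EventuallyEq.rfl
  filter_upwards [eventually_gt_atTop 0] with N hN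
  rw [eq_besselI_of_hasSum hN (hB N hN)]

end Overpart

/-! ### The circle method -/

namespace Overpart

open Filter Topology Complex MeasureTheory Set

theorem integral_exp_int_mul (k : ℤ) :
    ∫ y in (-Real.pi)..Real.pi, cexp (k * (y * I)) = if k = 0 then 2 * (Real.pi : ℂ) else 0 := by
  split_ifs with h
  · rw [h]
    simp only [Int.cast_zero, zero_mul, Complex.exp_zero, intervalIntegral.integral_const]
    rw [Complex.real_smul]; push_cast; ring
  · have hk : (k : ℂ) * I ≠ 0 := mul_ne_zero (by exact_mod_cast h) I_ne_zero
    have e : ∀ y : ℝ, cexp (k * (y * I)) = cexp ((k : ℂ) * I * y) := fun y => by congr 1; ring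
    simp_rw [e]
    rw [integral_exp_mul_complex hk, div_eq_zero_iff]
    left
    have h1 : cexp ((k : ℂ) * I * (Real.pi : ℂ)) =
        cexp ((k : ℂ) * I * ((-Real.pi : ℝ) : ℂ)) * cexp (k * (2 * Real.pi * I)) := by
      rw [← Complex.exp_add]; congr 1; push_cast; ring
    rw [h1, Complex.exp_int_mul_two_pi_mul_I, mul_one, sub_self]

theorem norm_exp_line (c y : ℝ) : ‖cexp (-(c + y * I))‖ = Real.exp (-c) := by
  rw [Complex.norm_exp]; simp

theorem norm_exp_line_lt_one {c : ℝ} (hc : 0 < c) (y : ℝ) : ‖cexp (-(c + y * I))‖ < 1 := by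
  rw [norm_exp_line, Real.exp_lt_one_iff]; linarith

theorem summable_abs_mul_exp {a : ℕ → ℝ} {F : ℂ → ℂ}
    (hF : ∀ q : ℂ, ‖q‖ < 1 → HasSum (fun N => (a N : ℂ) * q ^ N) (F q)) {c : ℝ} (hc : 0 < c) :
    Summable fun M => |a M| * Real.exp (-c) ^ M := by
  have h := (hF _ (norm_exp_line_lt_one hc 0)).summable.norm
  refine h.congr fun M => ?_
  rw [norm_mul, norm_pow, norm_exp_line, Complex.norm_real, Real.norm_eq_abs]

theorem continuous_genFun_line {a : ℕ → ℝ} {F : ℂ → ℂ}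
    (hF : ∀ q : ℂ, ‖q‖ < 1 → HasSum (fun N => (a N : ℂ) * q ^ N) (F q)) {c : ℝ} (hc : 0 < c) :
    Continuous fun y : ℝ => F (cexp (-(c + y * I))) := by
  have h : (fun y : ℝ => F (cexp (-(c + y * I)))) =
      fun y : ℝ => ∑' M : ℕ, (a M : ℂ) * cexp (-(c + y * I)) ^ M := by
    funext y; exact (hF _ (norm_exp_line_lt_one hc y)).tsum_eq.symm
  rw [h]
  refine continuous_tsum (fun M => by fun_prop) (summable_abs_mul_exp hF hc) fun M y => ?_
  rw [norm_mul, norm_pow, norm_exp_line, Complex.norm_real, Real.norm_eq_abs]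

/-- Cauchy's coefficient formula on |q| = e^{-c}, by termwise integration of the absolutely
convergent series and orthogonality of the exponentials. -/
theorem integral_genFun_line {a : ℕ → ℝ} {F : ℂ → ℂ}
    (hF : ∀ q : ℂ, ‖q‖ < 1 → HasSum (fun N => (a N : ℂ) * q ^ N) (F q)) {c : ℝ} (hc : 0 < c)
    (N : ℕ) :
    ∫ y in (-Real.pi)..Real.pi, F (cexp (-(c + y * I))) * cexp (N * (c + y * I)) =
      2 * Real.pi * a N := by
  have hs := summable_abs_mul_exp hF hc
  have hcont : ∀ M : ℕ, Continuous fun y : ℝ =>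
      (a M : ℂ) * cexp (-(c + y * I)) ^ M * cexp (N * (c + y * I)) := fun M => by fun_prop
  have h := intervalIntegral.hasSum_integral_of_dominated_convergence (μ := volume)
    (a := -Real.pi) (b := Real.pi)
    (F := fun (M : ℕ) (y : ℝ) => (a M : ℂ) * cexp (-(c + y * I)) ^ M * cexp (N * (c + y * I)))
    (f := fun y : ℝ => F (cexp (-(c + y * I))) * cexp (N * (c + y * I)))
    (fun M _ => |a M| * Real.exp (-c) ^ M * Real.exp (N * c))
    (fun M => (hcont M).aestronglyMeasurable)
    (fun M => Eventually.of_forall fun y _ => by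
      rw [norm_mul, norm_mul, norm_pow, norm_exp_line, Complex.norm_real, Real.norm_eq_abs,
        Complex.norm_exp]
      simp)
    (Eventually.of_forall fun y _ => hs.mul_right _)
    intervalIntegrable_const
    (Eventually.of_forall fun y _ => (hF _ (norm_exp_line_lt_one hc y)).mul_right _)
  have hterm : ∀ M : ℕ, ∫ y in (-Real.pi)..Real.pi,
      (a M : ℂ) * cexp (-(c + y * I)) ^ M * cexp (N * (c + y * I)) =
      if M = N then 2 * Real.pi * (a N : ℂ) else 0 := by
    intro M
    have e : ∀ y : ℝ, (a M : ℂ) * cexp (-(c + y * I)) ^ M * cexp (N * (c + y * I)) =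
        (a M : ℂ) * cexp ((((N : ℤ) - M : ℤ) : ℂ) * c) *
          cexp ((((N : ℤ) - M : ℤ) : ℂ) * (y * I)) := by
      intro y
      rw [← Complex.exp_nat_mul, mul_assoc, mul_assoc, ← Complex.exp_add, ← Complex.exp_add]
      congr 2
      push_cast; ring
    simp_rw [e]
    rw [intervalIntegral.integral_const_mul, integral_exp_int_mul]
    by_cases hMN : M = N
    · rw [if_pos (by omega), if_pos hMN, hMN]; simp; ring
    · rw [if_neg (by omega), if_neg hMN, mul_zero]
  simp_rw [hterm] at h
  exact h.unique (hasSum_ite_eq N _)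

theorem ofReal_mul_cpow {b : ℝ} (hb : 0 < b) {t : ℂ} (ht : t ≠ 0) (s : ℂ) :
    ((b : ℂ) * t) ^ s = (b : ℂ) ^ s * t ^ s := by
  have hb' : (b : ℂ) ≠ 0 := by exact_mod_cast hb.ne'
  rw [Complex.cpow_def_of_ne_zero (mul_ne_zero hb' ht), Complex.cpow_def_of_ne_zero hb',
    Complex.cpow_def_of_ne_zero ht, Complex.log_ofReal_mul hb ht, ← Complex.ofReal_log hb.le,
    ← Complex.exp_add]
  congr 1; ring

theorem overMain_eq {t : ℂ} (ht : t ≠ 0) :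
    overMain t = ((Real.pi ^ (-(1 / 2) : ℝ) / 2 : ℝ) : ℂ) * t ^ (1 / 2 : ℂ) *
      cexp ((Real.pi ^ 2 / 4 : ℝ) / t) := by
  have h : t / Real.pi = ((Real.pi⁻¹ : ℝ) : ℂ) * t := by push_cast; rw [div_eq_inv_mul]
  rw [overMain, h, ofReal_mul_cpow (inv_pos.2 Real.pi_pos) ht]
  have h2 : ((Real.pi⁻¹ : ℝ) : ℂ) ^ (1 / 2 : ℂ) = ((Real.pi ^ (-(1 / 2) : ℝ) : ℝ) : ℂ) := by
    rw [show (1 / 2 : ℂ) = ((1 / 2 : ℝ) : ℂ) by push_cast; rfl,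
      ← Complex.ofReal_cpow (inv_pos.2 Real.pi_pos).le, Real.inv_rpow Real.pi_pos.le,
      Real.rpow_neg Real.pi_pos.le]
  rw [h2]
  push_cast
  ring

theorem norm_overMain_le {c y : ℝ} (hc : 0 < c) :
    ‖overMain (c + y * I)‖ ≤ ‖(c : ℂ) + y * I‖ ^ (1 / 2 : ℝ) * Real.exp (Real.pi ^ 2 / 4 / c) := by
  have ht := line_ne_zero hc y
  have hp := Real.pi_pos
  rw [overMain_eq ht, norm_mul, norm_mul, Complex.norm_exp, re_div_line,
    show (1 / 2 : ℂ) = ((1 / 2 : ℝ) : ℂ) by push_cast; rfl, Complex.norm_cpow_real,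
    Complex.norm_real, Real.norm_of_nonneg (by positivity)]
  have h1 : Real.pi ^ (-(1 / 2) : ℝ) / 2 ≤ 1 := by
    have := Real.rpow_le_one_of_one_le_of_nonpos (x := Real.pi) (z := -(1 / 2))
      (by linarith [Real.pi_gt_three]) (by norm_num)
    linarith
  have h2 := div_add_sq_le (A := Real.pi ^ 2 / 4) (by positivity) hc y
  calc Real.pi ^ (-(1 / 2) : ℝ) / 2 * ‖(c : ℂ) + y * I‖ ^ (1 / 2 : ℝ) *
        Real.exp (Real.pi ^ 2 / 4 * c / (c ^ 2 + y ^ 2))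
      ≤ 1 * ‖(c : ℂ) + y * I‖ ^ (1 / 2 : ℝ) * Real.exp (Real.pi ^ 2 / 4 / c) := by gcongr
    _ = _ := by rw [one_mul]

theorem overMain_mul_eq_besselKernel {r : ℕ} (α β x : ℝ) {c : ℝ} (hc : 0 < c) (y : ℝ) :
    (((c : ℂ) + y * I) ^ r)⁻¹ * (overMain (c + y * I) * (α + β * (c + y * I))) *
      cexp (x * (c + y * I)) =
    ((Real.pi ^ (-(1 / 2) : ℝ) / 2 : ℝ) : ℂ) *
      (α * besselKernel (Real.pi ^ 2 / 4) (r - 3 / 2) x c y +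
        β * besselKernel (Real.pi ^ 2 / 4) (r - 5 / 2) x c y) := by
  have ht := line_ne_zero hc y
  rw [overMain_eq ht, besselKernel, besselKernel, Complex.exp_add]
  set t := (c : ℂ) + y * I
  have e1 : t ^ (-(((r - 3 / 2 : ℝ) : ℂ) + 1)) = (t ^ r)⁻¹ * t ^ (1 / 2 : ℂ) := by
    rw [← Complex.cpow_natCast, ← Complex.cpow_neg, ← Complex.cpow_add _ _ ht]
    congr 1; push_cast; ring
  have e2 : t ^ (-(((r - 5 / 2 : ℝ) : ℂ) + 1)) = (t ^ r)⁻¹ * t ^ (1 / 2 : ℂ) * t := by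
    rw [← Complex.cpow_natCast, ← Complex.cpow_neg, ← Complex.cpow_add _ _ ht]
    nth_rewrite 3 [← Complex.cpow_one t]
    rw [← Complex.cpow_add _ _ ht]
    congr 1; push_cast; ring
  rw [e1, e2]
  ring

/-- The error t² relative to the size t^{1/2-r} of the integrand's algebraic part gives |t|^{5/2-r};
c ≤ |t| ≤ 2c, and the sum of the two powers covers either sign of the exponent. -/
theorem norm_major_sub_le {r : ℕ} {α β C : ℝ} {F : ℂ → ℂ} (hC0 : 0 ≤ C)
    (hC : ∀ t : ℂ, 0 < t.re → |t.im| ≤ t.re / 4 → ‖t‖ ≤ 1 →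
      ‖t ^ r * F (cexp (-t)) - overMain t * (α + β * t)‖ ≤ C * ‖t‖ ^ 2 * ‖overMain t‖)
    (x : ℝ) {c y : ℝ} (hc : 0 < c) (hc1 : c ≤ 1 / 2) (hy : |y| ≤ c / 4) :
    ‖F (cexp (-(c + y * I))) * cexp (x * (c + y * I)) -
      ((Real.pi ^ (-(1 / 2) : ℝ) / 2 : ℝ) : ℂ) *
      (α * besselKernel (Real.pi ^ 2 / 4) (r - 3 / 2) x c y +
        β * besselKernel (Real.pi ^ 2 / 4) (r - 5 / 2) x c y)‖ ≤
      C * (c ^ (5 / 2 - r : ℝ) + (2 * c) ^ (5 / 2 - r : ℝ)) *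
        Real.exp (Real.pi ^ 2 / 4 / c + x * c) := by
  rw [← overMain_mul_eq_besselKernel α β x hc]
  have ht := line_ne_zero hc y
  have h1 := (norm_line_ge hc y).1
  have h2 : ‖(c : ℂ) + y * I‖ ≤ 2 * c := by
    refine (norm_add_le _ _).trans ?_
    rw [norm_mul, Complex.norm_I, Complex.norm_real, Complex.norm_real, Real.norm_eq_abs,
      Real.norm_eq_abs, abs_of_pos hc]
    linarith
  have hmain := hC (c + y * I) (by rw [line_re]; exact hc) (by simpa using hy) (by linarith)
  have hE := norm_overMain_le (y := y) hc
  set t := (c : ℂ) + y * I with htd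
  have hre : t.re = c := line_re c y
  have htn : 0 < ‖t‖ := norm_pos_iff.2 ht
  have e : F (cexp (-t)) * cexp (x * t) - (t ^ r)⁻¹ * (overMain t * (α + β * t)) * cexp (x * t) =
      (t ^ r)⁻¹ * (t ^ r * F (cexp (-t)) - overMain t * (α + β * t)) * cexp (x * t) := by
    have := pow_ne_zero r ht
    field_simp
  rw [e, norm_mul, norm_mul, norm_inv, norm_pow, Complex.norm_exp, Complex.re_ofReal_mul, hre]
  have hpow : (‖t‖ ^ r)⁻¹ * (‖t‖ ^ 2 * ‖t‖ ^ (1 / 2 : ℝ)) = ‖t‖ ^ (5 / 2 - r : ℝ) := by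
    rw [← Real.rpow_natCast, ← Real.rpow_natCast, ← Real.rpow_neg htn.le, ← Real.rpow_add htn,
      ← Real.rpow_add htn]
    congr 1; push_cast; ring
  have h3 : ‖t‖ ^ (5 / 2 - r : ℝ) ≤ c ^ (5 / 2 - r : ℝ) + (2 * c) ^ (5 / 2 - r : ℝ) := by
    have p1 : 0 ≤ c ^ (5 / 2 - r : ℝ) := Real.rpow_nonneg hc.le _
    have p2 : 0 ≤ (2 * c) ^ (5 / 2 - r : ℝ) := Real.rpow_nonneg (by linarith) _
    rcases le_total 0 (5 / 2 - r : ℝ) with hv | hv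
    · linarith [Real.rpow_le_rpow (norm_nonneg _) h2 hv]
    · linarith [Real.rpow_le_rpow_of_nonpos hc h1 hv]
  calc (‖t‖ ^ r)⁻¹ * ‖t ^ r * F (cexp (-t)) - overMain t * (α + β * t)‖ * Real.exp (x * c)
      ≤ (‖t‖ ^ r)⁻¹ * (C * ‖t‖ ^ 2 * (‖t‖ ^ (1 / 2 : ℝ) * Real.exp (Real.pi ^ 2 / 4 / c))) *
        Real.exp (x * c) := by gcongr; exact hmain.trans (by gcongr)
    _ = C * ((‖t‖ ^ r)⁻¹ * (‖t‖ ^ 2 * ‖t‖ ^ (1 / 2 : ℝ))) *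
        Real.exp (Real.pi ^ 2 / 4 / c + x * c) := by rw [Real.exp_add]; ring
    _ ≤ _ := by rw [hpow]; gcongr

/-- The circle is cut at y = ±c/4. The factor c in the first error is a bound for the length of the
major arc, and the factor 8 in the second bounds the lengths of the two minor pieces by 4 each. -/
theorem norm_coeff_sub_arcIntegral_le {r : ℕ} {α β C D : ℝ} {F : ℂ → ℂ} {a : ℕ → ℝ}
    (hF : ∀ q : ℂ, ‖q‖ < 1 → HasSum (fun N => (a N : ℂ) * q ^ N) (F q)) (hC0 : 0 ≤ C)
    (hC : ∀ t : ℂ, 0 < t.re → |t.im| ≤ t.re / 4 → ‖t‖ ≤ 1 →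
      ‖t ^ r * F (cexp (-t)) - overMain t * (α + β * t)‖ ≤ C * ‖t‖ ^ 2 * ‖overMain t‖)
    (hD0 : 0 ≤ D) (hD : ∀ c y : ℝ, 0 < c → c ≤ 1 → c / 4 ≤ |y| → |y| ≤ Real.pi →
      ‖F (cexp (-(c + y * I)))‖ ≤
        D * (1 / c ^ (r + 2)) * Real.exp ((Real.pi ^ 2 / 4 - 1 / 4000) / c))
    {c : ℝ} (hc : 0 < c) (hc1 : c ≤ 1 / 2) (N : ℕ) :
    ‖2 * Real.pi * (a N : ℂ) - ((Real.pi ^ (-(1 / 2) : ℝ) / 2 : ℝ) : ℂ) *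
      (α * arcIntegral (Real.pi ^ 2 / 4) (r - 3 / 2) N c +
        β * arcIntegral (Real.pi ^ 2 / 4) (r - 5 / 2) N c)‖ ≤
      C * (c ^ (5 / 2 - r : ℝ) + (2 * c) ^ (5 / 2 - r : ℝ)) * c *
        Real.exp (Real.pi ^ 2 / 4 / c + N * c) +
      8 * D * (1 / c ^ (r + 2)) * Real.exp ((Real.pi ^ 2 / 4 - 1 / 4000) / c + N * c) := by
  set g : ℝ → ℂ := fun y => F (cexp (-(c + y * I))) * cexp (N * (c + y * I)) with hg
  have hgc : Continuous g := (continuous_genFun_line hF hc).mul (by fun_prop)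
  have hgi := fun u v => hgc.intervalIntegrable (μ := volume) u v
  have h0 := integral_genFun_line hF hc N
  have hpi3 := Real.pi_gt_three
  have hsplit : ∫ y in (-Real.pi)..Real.pi, g y = (∫ y in (-Real.pi)..(-(c / 4)), g y) +
      (∫ y in (-(c / 4))..(c / 4), g y) + ∫ y in (c / 4)..Real.pi, g y := by
    rw [intervalIntegral.integral_add_adjacent_intervals (hgi _ _) (hgi _ _),
      intervalIntegral.integral_add_adjacent_intervals (hgi _ _) (hgi _ _)]
  have hminor : ∀ y : ℝ, c / 4 ≤ |y| → |y| ≤ Real.pi →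
      ‖g y‖ ≤ D * (1 / c ^ (r + 2)) * Real.exp ((Real.pi ^ 2 / 4 - 1 / 4000) / c + N * c) := by
    intro y h1 h2
    simp only [hg]
    rw [norm_mul, Complex.norm_exp, ← Complex.ofReal_natCast, Complex.re_ofReal_mul, line_re,
      Real.exp_add, ← mul_assoc]
    have := hD c y hc (by linarith) h1 h2
    gcongr
  have m1 := intervalIntegral.norm_integral_le_of_norm_le_const (a := -Real.pi) (b := -(c / 4))
    (f := g) (C := D * (1 / c ^ (r + 2)) * Real.exp ((Real.pi ^ 2 / 4 - 1 / 4000) / c + N * c))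
    (fun y hy => by
      rw [uIoc_of_le (by linarith)] at hy
      have : |y| = -y := abs_of_neg (by linarith [hy.2])
      exact hminor y (by linarith [hy.2]) (by linarith [hy.1]))
  have m2 := intervalIntegral.norm_integral_le_of_norm_le_const (a := c / 4) (b := Real.pi)
    (f := g) (C := D * (1 / c ^ (r + 2)) * Real.exp ((Real.pi ^ 2 / 4 - 1 / 4000) / c + N * c))
    (fun y hy => by
      rw [uIoc_of_le (by linarith)] at hy
      have : |y| = y := abs_of_pos (by linarith [hy.1])
      exact hminor y (by linarith [hy.1]) (by linarith [hy.2]))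
  have hki := fun ν => (continuous_besselKernel (Real.pi ^ 2 / 4) ν N hc).intervalIntegrable
    (μ := volume) (-(c / 4)) (c / 4)
  have hmid : ((Real.pi ^ (-(1 / 2) : ℝ) / 2 : ℝ) : ℂ) *
      (α * arcIntegral (Real.pi ^ 2 / 4) (r - 3 / 2) N c +
        β * arcIntegral (Real.pi ^ 2 / 4) (r - 5 / 2) N c) =
      ∫ y in (-(c / 4))..(c / 4), ((Real.pi ^ (-(1 / 2) : ℝ) / 2 : ℝ) : ℂ) *
      (α * besselKernel (Real.pi ^ 2 / 4) (r - 3 / 2) N c y +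
        β * besselKernel (Real.pi ^ 2 / 4) (r - 5 / 2) N c y) := by
    rw [intervalIntegral.integral_const_mul, intervalIntegral.integral_add ((hki _).const_mul _)
      ((hki _).const_mul _), intervalIntegral.integral_const_mul,
      intervalIntegral.integral_const_mul]
    rfl
  have m3 := intervalIntegral.norm_integral_le_of_norm_le_const (a := -(c / 4)) (b := c / 4)
    (f := fun y => g y - ((Real.pi ^ (-(1 / 2) : ℝ) / 2 : ℝ) : ℂ) *
      (α * besselKernel (Real.pi ^ 2 / 4) (r - 3 / 2) N c y +
        β * besselKernel (Real.pi ^ 2 / 4) (r - 5 / 2) N c y))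
    (C := C * (c ^ (5 / 2 - r : ℝ) + (2 * c) ^ (5 / 2 - r : ℝ)) *
      Real.exp (Real.pi ^ 2 / 4 / c + N * c))
    (fun y hy => by
      rw [uIoc_of_le (by linarith)] at hy
      exact norm_major_sub_le hC0 hC N hc hc1 (abs_le.2 ⟨hy.1.le, hy.2⟩))
  rw [intervalIntegral.integral_sub (hgi _ _) ((((hki _).const_mul _).add
    ((hki _).const_mul _)).const_mul _), ← hmid] at m3
  rw [← h0, hsplit]
  set X := ((Real.pi ^ (-(1 / 2) : ℝ) / 2 : ℝ) : ℂ) *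
      (α * arcIntegral (Real.pi ^ 2 / 4) (r - 3 / 2) N c +
        β * arcIntegral (Real.pi ^ 2 / 4) (r - 5 / 2) N c)
  rw [show (∫ y in (-Real.pi)..(-(c / 4)), g y) + (∫ y in (-(c / 4))..(c / 4), g y) +
    (∫ y in (c / 4)..Real.pi, g y) - X = ((∫ y in (-(c / 4))..(c / 4), g y) - X) +
    ((∫ y in (-Real.pi)..(-(c / 4)), g y) + ∫ y in (c / 4)..Real.pi, g y) by ring]
  have a1 : |(-(c / 4)) - -Real.pi| ≤ 4 := by
    rw [abs_of_pos (by linarith)]; linarith [Real.pi_le_four]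
  have a2 : |Real.pi - c / 4| ≤ 4 := by
    rw [abs_of_pos (by linarith)]; linarith [Real.pi_le_four]
  have a3 : |c / 4 - -(c / 4)| ≤ c := by
    rw [abs_of_pos (by linarith)]; linarith
  have b1 := m1.trans (mul_le_mul_of_nonneg_left a1 (by positivity))
  have b2 := m2.trans (mul_le_mul_of_nonneg_left a2 (by positivity))
  have b3 := m3.trans (mul_le_mul_of_nonneg_left a3 (by positivity))
  refine (norm_add_le _ _).trans ?_
  have b4 := norm_add_le (∫ y in (-Real.pi)..(-(c / 4)), g y) (∫ y in (c / 4)..Real.pi, g y)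
  linarith

end Overpart

/-! ### Error terms, constants and conclusion -/

namespace Overpart

open Filter Topology Complex MeasureTheory Set

theorem saddle_le_half {N : ℕ} (hN : 16 ≤ N) : saddle N ≤ 1 / 2 := by
  have h : (4 : ℝ) ≤ Real.sqrt N := by
    rw [Real.le_sqrt (by norm_num) (Nat.cast_nonneg N)]
    norm_num; exact_mod_cast hN
  unfold saddle
  rw [div_le_iff₀ (by linarith)]
  linarith [Real.pi_le_four]

theorem isBigO_exp_sqrt_target {b : ℝ} (hb : b < Real.pi) (K : ℝ) :
    (fun N : ℕ => Real.exp (b * Real.sqrt N)) =O[atTop]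
      fun N : ℕ => (N : ℝ) ^ K * Real.exp (Real.pi * Real.sqrt N) := by
  have h := (Asymptotics.isBigO_refl (fun N : ℕ => (N : ℝ) ^ K) atTop).mul
    (isBigO_rpow_mul_exp_sqrt (-K) hb)
  refine h.congr' ?_ EventuallyEq.rfl
  filter_upwards [eventually_gt_atTop 0] with N hN
  have hN' : (0 : ℝ) < N := by exact_mod_cast hN
  rw [← mul_assoc, ← Real.rpow_add hN', add_neg_cancel, Real.rpow_zero, one_mul]

theorem isBigO_coeff_sub_arcIntegral {r : ℕ} {α β : ℝ} {F : ℂ → ℂ} {a : ℕ → ℝ}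
    (hF : ∀ q : ℂ, ‖q‖ < 1 → HasSum (fun N => (a N : ℂ) * q ^ N) (F q))
    (h : CircleData r α β F) :
    (fun N : ℕ => 2 * Real.pi * (a N : ℂ) - ((Real.pi ^ (-(1 / 2) : ℝ) / 2 : ℝ) : ℂ) *
      (α * arcIntegral (Real.pi ^ 2 / 4) (r - 3 / 2) N (saddle N) +
        β * arcIntegral (Real.pi ^ 2 / 4) (r - 5 / 2) N (saddle N))) =O[atTop]
      fun N : ℕ => (N : ℝ) ^ ((r : ℝ) / 2 - 7 / 4) * Real.exp (Real.pi * Real.sqrt N) := by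
  obtain ⟨C, hC0, hC⟩ := h.major
  obtain ⟨D, hD0, hD⟩ := h.minor
  have hpi := Real.pi_pos
  have hmaj : (fun N : ℕ => C * (saddle N ^ (5 / 2 - r : ℝ) + (2 * saddle N) ^ (5 / 2 - r : ℝ)) *
      saddle N * Real.exp (Real.pi ^ 2 / 4 / saddle N + N * saddle N)) =O[atTop]
      fun N : ℕ => (N : ℝ) ^ ((r : ℝ) / 2 - 7 / 4) * Real.exp (Real.pi * Real.sqrt N) := by
    refine ((Asymptotics.isBigO_refl (fun N : ℕ => (N : ℝ) ^ ((r : ℝ) / 2 - 7 / 4) *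
      Real.exp (Real.pi * Real.sqrt N)) atTop).const_mul_left
      (C * (1 + 2 ^ (5 / 2 - r : ℝ)) * (Real.pi / 2) ^ (7 / 2 - r : ℝ))).congr' ?_ EventuallyEq.rfl
    filter_upwards [eventually_gt_atTop 0] with N hN
    have hs := saddle_pos hN
    -- The origin of the error exponent: c^{7/2-r} with c of order N^{-1/2} is of order N^{r/2-7/4}.
    have e1 : saddle N ^ (5 / 2 - r : ℝ) * saddle N =
        (Real.pi / 2) ^ (7 / 2 - r : ℝ) * (N : ℝ) ^ ((r : ℝ) / 2 - 7 / 4) := by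
      have h1 := mul_saddle_rpow (a := 1) (by norm_num) N (7 / 2 - r)
      rw [one_mul, one_mul] at h1
      rw [← Real.rpow_add_one hs.ne', show (5 / 2 - r : ℝ) + 1 = 7 / 2 - r by ring, h1]
      congr 2; ring
    rw [Real.mul_rpow (by norm_num) hs.le, div_saddle, mul_saddle,
      show Real.pi / 2 * Real.sqrt N + Real.pi / 2 * Real.sqrt N = Real.pi * Real.sqrt N by ring]
    linear_combination (-(C * (1 + 2 ^ (5 / 2 - r : ℝ)) * Real.exp (Real.pi * Real.sqrt N))) * e1
  have hmin : (fun N : ℕ => 8 * D * (1 / saddle N ^ (r + 2)) *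
      Real.exp ((Real.pi ^ 2 / 4 - 1 / 4000) / saddle N + N * saddle N)) =O[atTop]
      fun N : ℕ => (N : ℝ) ^ ((r : ℝ) / 2 - 7 / 4) * Real.exp (Real.pi * Real.sqrt N) := by
    -- The minor arc saving 1/(4000c) equals √N/(2000π), and 2000π < 10000.
    have hlt : Real.pi - 1 / (2000 * Real.pi) < Real.pi - 1 / 10000 := by
      have : 1 / 10000 < 1 / (2000 * Real.pi) := by
        apply one_div_lt_one_div_of_lt (by positivity)
        linarith [Real.pi_le_four]
      linarith
    refine Asymptotics.IsBigO.trans ?_ (isBigO_exp_sqrt_target (b := Real.pi - 1 / 10000)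
      (by linarith) _)
    refine ((isBigO_rpow_mul_exp_sqrt (((r : ℝ) + 2) / 2) hlt).const_mul_left
      (8 * D * (Real.pi / 2) ^ (-((r : ℝ) + 2)))).congr' ?_ EventuallyEq.rfl
    filter_upwards [eventually_gt_atTop 0] with N hN
    have hs := saddle_pos hN
    have e1 : 1 / saddle N ^ (r + 2) =
        (Real.pi / 2) ^ (-((r : ℝ) + 2)) * (N : ℝ) ^ (((r : ℝ) + 2) / 2) := by
      have h1 := mul_saddle_rpow (a := 1) (by norm_num) N (-((r : ℝ) + 2))
      rw [one_mul, one_mul] at h1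
      rw [one_div, ← Real.rpow_natCast, ← Real.rpow_neg hs.le]
      push_cast
      rw [h1]
      congr 2; ring
    have e2 : (Real.pi ^ 2 / 4 - 1 / 4000) / saddle N + N * saddle N =
        (Real.pi - 1 / (2000 * Real.pi)) * Real.sqrt N := by
      rw [sub_div, div_saddle, mul_saddle]
      have : 1 / 4000 / saddle N = 1 / (2000 * Real.pi) * Real.sqrt N := by
        unfold saddle
        have : 0 < Real.sqrt N := Real.sqrt_pos.2 (by exact_mod_cast hN)
        field_simp; norm_num
      rw [this]; ring
    rw [e1, e2]; ring
  refine Asymptotics.IsBigO.trans (Asymptotics.IsBigO.of_bound 1 ?_) (hmaj.add hmin)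
  filter_upwards [eventually_ge_atTop 16] with N hN
  rw [one_mul]
  exact (norm_coeff_sub_arcIntegral_le hF hC0 hC hD0 hD (saddle_pos (by omega))
    (saddle_le_half hN) N).trans (Real.le_norm_self _)

/-- The constant π^{-1/2}/2 of the main term of P, times the scaling (π/2)^{-p} between the Bessel
series and I_p(π√N). The values p = r - 3/2 and p = r - 5/2 give the prefactors of the two constants
of the theorem. -/
theorem const_mul_besselScale (p : ℝ) :
    Real.pi ^ (-(1 / 2) : ℝ) / 2 * (Real.pi / 2) ^ (-p) =
      Real.pi ^ (-(1 / 2) - p) * 2 ^ (p - 1) := by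
  have hpi := Real.pi_pos
  rw [Real.div_rpow hpi.le (by norm_num), Real.rpow_sub hpi, Real.rpow_sub_one (by norm_num),
    Real.rpow_neg hpi.le p, Real.rpow_neg (by norm_num) p]
  field_simp

theorem isBigO_coeff_sub_mainPart {r : ℕ} (hr : 1 ≤ r) {β : ℝ} {F : ℂ → ℂ} {a : ℕ → ℝ}
    (hF : ∀ q : ℂ, ‖q‖ < 1 → HasSum (fun N => (a N : ℂ) * q ^ N) (F q))
    (h : CircleData r (altZeta r) β F) :
    (fun N : ℕ => a N - mainPart (cTilde r)
      (Real.pi ^ (2 - (r : ℝ)) * 2 ^ ((r : ℝ) - 7 / 2) * β) r N) =O[atTop]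
      fun N : ℕ => (N : ℝ) ^ ((r : ℝ) / 2 - 7 / 4) * Real.exp (Real.pi * Real.sqrt N) := by
  set T : ℕ → ℝ := fun N => (N : ℝ) ^ ((r : ℝ) / 2 - 7 / 4) * Real.exp (Real.pi * Real.sqrt N)
  have h1 := isBigO_coeff_sub_arcIntegral hF h
  have hsmall : (fun N : ℕ => Real.exp ((Real.pi - 1 / 10000) * Real.sqrt N)) =O[atTop] T :=
    isBigO_exp_sqrt_target (by linarith) _
  have h2 := ((besselArc_sub_three_half hr).isBigO.trans hsmall).const_mul_left
    (((Real.pi ^ (-(1 / 2) : ℝ) / 2 : ℝ) : ℂ) * ((altZeta r : ℝ) : ℂ))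
  have h3 := ((besselArc_sub_five_half hr).isBigO.trans hsmall).const_mul_left
    (((Real.pi ^ (-(1 / 2) : ℝ) / 2 : ℝ) : ℂ) * (β : ℂ))
  have h4 := ((h1.add h2).add h3).const_mul_left (2 * Real.pi : ℂ)⁻¹
  have hpi : (Real.pi : ℂ) ≠ 0 := by exact_mod_cast Real.pi_ne_zero
  have h5 : (fun N : ℕ => ((a N - mainPart (cTilde r)
      (Real.pi ^ (2 - (r : ℝ)) * 2 ^ ((r : ℝ) - 7 / 2) * β) r N : ℝ) : ℂ)) =O[atTop] T := by
    refine h4.congr_left fun N => ?_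
    have c1 := const_mul_besselScale ((r : ℝ) - 3 / 2)
    have c2 := const_mul_besselScale ((r : ℝ) - 5 / 2)
    rw [show -(1 / 2) - ((r : ℝ) - 3 / 2) = 1 - r by ring,
      show (r : ℝ) - 3 / 2 - 1 = r - 5 / 2 by ring] at c1
    rw [show -(1 / 2) - ((r : ℝ) - 5 / 2) = 2 - r by ring,
      show (r : ℝ) - 5 / 2 - 1 = r - 7 / 2 by ring] at c2
    have c1' := congrArg Complex.ofReal c1
    have c2' := congrArg Complex.ofReal c2
    rw [mainPart, cTilde, show (r : ℝ) / 2 - 3 / 4 = ((r : ℝ) - 3 / 2) / 2 by ring,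
      show (r : ℝ) / 2 - 5 / 4 = ((r : ℝ) - 5 / 2) / 2 by ring]
    -- All powers and Bessel values become independent symbols, so that the identity is a linear
    -- consequence of the two relations between constants.
    generalize besselI ((r : ℝ) - 3 / 2) (Real.pi * Real.sqrt N) = I1
    generalize besselI ((r : ℝ) - 5 / 2) (Real.pi * Real.sqrt N) = I2
    generalize (N : ℝ) ^ (((r : ℝ) - 3 / 2) / 2) = N1
    generalize (N : ℝ) ^ (((r : ℝ) - 5 / 2) / 2) = N2
    generalize Real.pi ^ (-(1 / 2) : ℝ) = P0 at *
    generalize (Real.pi / 2) ^ (-((r : ℝ) - 3 / 2)) = P1 at *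
    generalize (Real.pi / 2) ^ (-((r : ℝ) - 5 / 2)) = P2 at *
    generalize Real.pi ^ (1 - (r : ℝ)) = Q1 at *
    generalize Real.pi ^ (2 - (r : ℝ)) = Q2 at *
    generalize (2 : ℝ) ^ ((r : ℝ) - 5 / 2) = Q3 at *
    generalize (2 : ℝ) ^ ((r : ℝ) - 7 / 2) = Q4 at *
    push_cast at c1' c2' ⊢
    field_simp
    linear_combination (-(4 * Real.pi * altZeta r * N1 * I1) : ℂ) * c1' -
      (4 * Real.pi * β * N2 * I2 : ℂ) * c2'
  exact (Complex.isBigO_ofReal_left).1 h5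

theorem isBigO_muPlus_sub_literal (r : ℕ) (K : ℝ) :
    (fun N : ℕ => muPlus r N - muPlusLiteral r N) =O[atTop]
      fun N : ℕ => (N : ℝ) ^ K * Real.exp (Real.pi * Real.sqrt N) := by
  refine Asymptotics.IsBigO.trans (Asymptotics.IsBigO.of_bound ((1 + (r - 1) / 2).choose r : ℝ) ?_)
    (isBigO_exp_sqrt_target (b := 2) (by linarith [Real.pi_gt_three]) K)
  filter_upwards [eventually_ge_atTop 1] with N hN
  obtain ⟨M, rfl⟩ := Nat.exists_eq_add_of_le' hN
  rw [Real.norm_eq_abs, Real.norm_of_nonneg (Real.exp_pos _).le]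
  refine (abs_muPlus_sub_literal_le r M).trans ?_
  gcongr
  simp

end Overpart
theorem theorem4p1 (r : ℕ) (hr : 1 ≤ r) :
    ((fun N : ℕ => Overpart.muPlus r N -
        Overpart.mainPart (Overpart.cTilde r) (Overpart.dTildeCrank r) r N)
      =O[Filter.atTop] fun N : ℕ =>
        (N : ℝ) ^ ((r : ℝ) / 2 - 7 / 4) * Real.exp (Real.pi * Real.sqrt N)) ∧
    ((fun N : ℕ => Overpart.muPlusLiteral r N -
        Overpart.mainPart (Overpart.cTilde r) (Overpart.dTildeCrank r) r N)
      =O[Filter.atTop] fun N : ℕ =>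
        (N : ℝ) ^ ((r : ℝ) / 2 - 7 / 4) * Real.exp (Real.pi * Real.sqrt N)) ∧
    ((fun N : ℕ => Overpart.etaPlus r N -
        Overpart.mainPart (Overpart.cTilde r) (Overpart.dTildeRank r) r N)
      =O[Filter.atTop] fun N : ℕ =>
        (N : ℝ) ^ ((r : ℝ) / 2 - 7 / 4) * Real.exp (Real.pi * Real.sqrt N)) ∧
    Overpart.dTildeCrank r ≠ Overpart.dTildeRank r := by
  have hcrank : (fun N : ℕ => Overpart.muPlus r N -
      Overpart.mainPart (Overpart.cTilde r) (Overpart.dTildeCrank r) r N) =O[Filter.atTop]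
      fun N : ℕ => (N : ℝ) ^ ((r : ℝ) / 2 - 7 / 4) * Real.exp (Real.pi * Real.sqrt N) := by
    have h := Overpart.isBigO_coeff_sub_mainPart hr
      (fun q hq => Overpart.hasSum_muPlus hr hq) (Overpart.circleData_crank hr)
    refine h.congr_left fun N => ?_
    congr 2
    rw [Overpart.dTildeCrank]; ring
  have hrank : (fun N : ℕ => Overpart.etaPlus r N -
      Overpart.mainPart (Overpart.cTilde r) (Overpart.dTildeRank r) r N) =O[Filter.atTop]
      fun N : ℕ => (N : ℝ) ^ ((r : ℝ) / 2 - 7 / 4) * Real.exp (Real.pi * Real.sqrt N) := by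
    have h := Overpart.isBigO_coeff_sub_mainPart hr
      (fun q hq => Overpart.hasSum_etaPlus hr hq) (Overpart.circleData_rank hr)
    refine h.congr_left fun N => ?_
    congr 2
    rw [Overpart.dTildeRank]; ring
  refine ⟨hcrank, ?_, hrank, Overpart.dTildeCrank_ne_dTildeRank hr⟩
  -- The literal moment differs from the conventional one by O(exp(2√N)), which any power of N times
  -- exp(π√N) absorbs.
  refine (hcrank.sub (Overpart.isBigO_muPlus_sub_literal r _)).congr_left fun N => ?_
  ring
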